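/- All spaces are over $\mathbb{C}$; lcHs means locally convex Hausdorff space. An inductive spectrum of Banach spaces is a sequence $(Z_n)_{n\in\mathbb{N}}$ of Banach spaces with $Z_n\subseteq Z_{n+1}$ and continuous inclusion maps; its inductive limit is $\bigcup_n Z_n$ with the finest locally convex topology making all inclusions of the $Z_n$ continuous. An $(LB)$-space is a Hausdorff inductive limit of such a spectrum; it is an $(LN)$-space if the spectrum can be chosen with nuclear inclusion maps $Z_n\to Z_{n+1}$. For an index set $I$ and functions $a_n: I\to(0,\infty)$ with $a_{n+1}\le a_n$ for all $n\in\mathbb{N}$, put $A=(a_n)_{n\in\mathbb{N}}$ and, for $p\in\{1,\infty\}$, let $k^p(A)$ be the inductive limit of the Banach spaces $\ell^p(a_n)=\{c\in\mathbb{C}^I : \|c\|=\|a_n c\|_{\ell^p(I)}<\infty\}$. A lcHs is locally complete if each of its bounded sets is contained in a Banach disk, i.e. in an absolutely convex bounded set $B$ whose linear span, normed by the Minkowski functional of $B$, is complete. A fundamental increasing sequence of bounded sets is an increasing sequence $(B_N)_{N\in\mathbb{N}}$ of bounded sets such that each bounded set is contained in some $B_N$. An $(LB)$-space $Z$ is called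 weakly $E$-acyclic if for every algebraically exact sequence $0\to X\xrightarrow{\iota}Y\xrightarrow{Q}Z\to0$ of $(LB)$-spaces with continuous linear maps $\iota$ and $Q$, and for every continuous linear map $T: X\to E$, there is a continuous linear map $S: Y\to E$ with $S\circ\iota=T$. Let $E$ be a lcHs with a fundamental increasing sequence of bounded sets $(B_N)_{N\in\mathbb{N}}$ and let $Z$ be the inductive limit of the inductive spectrum of Banach spaces $(Z_n)_{n\in\mathbb{N}}$. The pair $(E,Z)$ satisfies $(S)$ if $$\forall n\ \exists m\ge n\ \forall k\ge m\ \exists N\ \forall M\ge N,\ \varepsilon>0\ \exists K\ge M,\ C>0\ \forall z\in Z_n:\quad \|z\|_{Z_m}B_M\subseteq C\|z\|_{Z_k}B_K+\varepsilon\|z\|_{Z_n}B_N .$$ **Theorem.** Let $E$ be a locally complete lcHs with a fundamental increasing sequence of bounded sets $(B_N)_{N\in\mathbb{N}}$, and let $Z$ be an $(LB)$-space that is the inductive limit of an inductive spectrum of Banach spaces $(Z_n)_{n\in\mathbb{N}}$. Suppose that one of the following holds: (a) $E\cong k^\infty(A)$ for some $I$ and $A$ as above, and $E$ is not normable; (b)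 $E$ is an infinite-dimensional $(LN)$-space; (c) $Z\cong k^1(A)$ for some $I$ and $A$ as above; (d) $Z$ is an $(LN)$-space. Then $Z$ is weakly $E$-acyclic if and only if $(E,Z)$ satisfies $(S)$, for this (equivalently, any) choice of $(B_N)$ and $(Z_n)$. -/

import Mathlib

open scoped ENNReal Pointwise Topology

universe u v w

noncomputable section

/-! ### Inductive spectra of Banach spaces and (LB)-spaces -/

/-- An inductive spectrum `(X₀ ⊆ X₁ ⊆ …)` of complex Banach spaces inside the vector space `X`.
The `n`-th step is given as a Banach space `step n` with an injective linear map
`toLim n : step n → X` (the inclusion `Xₙ ⊆ X`); `incl h : step n → step m` is the inclusion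
map `Xₙ → Xₘ`, which is continuous. -/
structure BanachSpectrum (X : Type u) [AddCommGroup X] [Module ℂ X] where
  step : ℕ → Type u
  [normedAddCommGroup : ∀ n, NormedAddCommGroup (step n)]
  [normedSpace : ∀ n, NormedSpace ℂ (step n)]
  [completeSpace : ∀ n, CompleteSpace (step n)]
  toLim : ∀ n, step n →ₗ[ℂ] X
  toLim_injective : ∀ n, Function.Injective (toLim n)
  incl : ∀ {n m : ℕ}, n ≤ m → step n →L[ℂ] step m
  toLim_incl : ∀ {n m : ℕ} (h : n ≤ m) (x : step n), toLim m (incl h x) = toLim n x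

attribute [instance] BanachSpectrum.normedAddCommGroup BanachSpectrum.normedSpace
  BanachSpectrum.completeSpace

namespace BanachSpectrum

variable {X : Type*} [AddCommGroup X] [Module ℂ X]

/-- The locally convex vector space topologies on `X` for which all inclusion maps `Xₙ → X` are
continuous. -/
def admissibleTopologies (𝒳 : BanachSpectrum X) : Set (TopologicalSpace X) :=
  {t | @IsTopologicalAddGroup X t _ ∧ @ContinuousSMul ℂ X _ _ t ∧
    @LocallyConvexSpace ℝ X _ _ _ _ t ∧ ∀ n, @Continuous _ _ _ t (𝒳.toLim n)}

/-- The inductive limit topology: the finest locally convex topology on `X` for which all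
inclusion maps `Xₙ → X` are continuous (see `isLeast_limTopology`; in Mathlib's order on
topologies finer means smaller). -/
abbrev limTopology (𝒳 : BanachSpectrum X) : TopologicalSpace X :=
  sInf 𝒳.admissibleTopologies

theorem isLeast_limTopology (𝒳 : BanachSpectrum X) :
    IsLeast 𝒳.admissibleTopologies 𝒳.limTopology := by
  refine ⟨⟨?_, ?_, ?_, ?_⟩, fun t ht => sInf_le ht⟩
  · exact topologicalAddGroup_sInf fun t ht => ht.1
  · exact continuousSMul_sInf fun t ht => ht.2.1
  · exact LocallyConvexSpace.sInf fun t ht => ht.2.2.1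
  · exact fun n => continuous_sInf_rng.2 fun t ht => ht.2.2.2 n

/-- `X = Ind 𝒳`: the space `X` is the union of the steps of `𝒳` and carries the inductive limit
topology. -/
def IsLimit [τ : TopologicalSpace X] (𝒳 : BanachSpectrum X) : Prop :=
  (∀ x : X, ∃ n, x ∈ Set.range (𝒳.toLim n)) ∧ τ = 𝒳.limTopology

end BanachSpectrum

/-- `(LB)`-spaces: Hausdorff inductive limits of inductive spectra of Banach spaces. -/
def IsLBSpace (X : Type*) [AddCommGroup X] [Module ℂ X] [TopologicalSpace X] : Prop :=
  T2Space X ∧ ∃ 𝒳 : BanachSpectrum X, 𝒳.IsLimit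

/-- Nuclear maps between Banach spaces: `T x = ∑ⱼ ⟨aⱼ, x⟩ yⱼ` with `∑ⱼ ‖aⱼ‖ ‖yⱼ‖ < ∞`. -/
def IsNuclearMap {F G : Type*} [NormedAddCommGroup F] [NormedSpace ℂ F]
    [NormedAddCommGroup G] [NormedSpace ℂ G] (T : F →L[ℂ] G) : Prop :=
  ∃ (a : ℕ → F →L[ℂ] ℂ) (y : ℕ → G),
    Summable (fun j => ‖a j‖ * ‖y j‖) ∧ ∀ x, HasSum (fun j => a j x • y j) (T x)

/-- `(LN)`-spaces: Hausdorff inductive limits of inductive spectra of Banach spaces with nuclear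
inclusion maps `Xₙ → Xₙ₊₁`. -/
def IsLNSpace (X : Type*) [AddCommGroup X] [Module ℂ X] [TopologicalSpace X] : Prop :=
  T2Space X ∧ ∃ 𝒳 : BanachSpectrum X, 𝒳.IsLimit ∧ ∀ n, IsNuclearMap (𝒳.incl (Nat.le_succ n))

/-! ### Bounded sets and local completeness -/

section LocallyConvex

variable (E : Type*) [AddCommGroup E] [Module ℂ E] [TopologicalSpace E]

/-- `B` is a Banach disk: an absolutely convex bounded set such that its span `E_B`, normed by
the Minkowski functional of `B`, is complete. -/
def IsBanachDisk {E : Type*} [AddCommGroup E] [Module ℂ E] [TopologicalSpace E]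
    (B : Set E) : Prop :=
  Balanced ℂ B ∧ Convex ℝ B ∧ Bornology.IsVonNBounded ℂ B ∧
    ∀ u : ℕ → E, (∀ p, u p ∈ Submodule.span ℂ B) →
      (∀ ε > (0 : ℝ), ∃ p₀ : ℕ, ∀ p ≥ p₀, ∀ q ≥ p₀, gauge B (u p - u q) < ε) →
      ∃ x ∈ Submodule.span ℂ B, Filter.Tendsto (fun p => gauge B (u p - x)) Filter.atTop (𝓝 0)

/-- Every bounded set is contained in a Banach disk. -/
def IsLocallyComplete : Prop :=
  ∀ D : Set E, Bornology.IsVonNBounded ℂ D → ∃ B, IsBanachDisk B ∧ D ⊆ B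

/-- `(B_N)` is a fundamental increasing sequence of bounded sets. -/
def IsFundamentalBoundedSeq {E : Type*} [AddCommGroup E] [Module ℂ E] [TopologicalSpace E]
    (B : ℕ → Set E) : Prop :=
  Monotone B ∧ (∀ N, Bornology.IsVonNBounded ℂ (B N)) ∧
    ∀ D : Set E, Bornology.IsVonNBounded ℂ D → ∃ N, D ⊆ B N

/-- The topology of `E` is given by a single norm. -/
def IsNormable : Prop :=
  ∃ p : Seminorm ℂ E, (∀ x, p x = 0 → x = 0) ∧ WithSeminorms (fun _ : Fin 1 => p)

end LocallyConvex

/-! ### The co-echelon spaces `k^p(A)` -/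

/-- Positive functions on the index set `I`. -/
abbrev PosWeight (I : Type*) := I → Set.Ioi (0 : ℝ)

section WeightedLp

variable {I : Type*}

/-- The vector space of all `c : I → ℂ` with `a c ∈ ℓ^p(I)`. -/
def weightedLpSubmodule (p : ℝ≥0∞) (a : PosWeight I) : Submodule ℂ (I → ℂ) where
  carrier := {c | Memℓp (fun j => ((a j : ℝ) : ℂ) * c j) p}
  zero_mem' := by
    have h : (fun j => ((a j : ℝ) : ℂ) * (0 : I → ℂ) j) = 0 := by ext; simp
    simp only [Set.mem_ofPred_eq, h]
    exact zero_memℓp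
  add_mem' := by
    intro c d hc hd
    have h : (fun j => ((a j : ℝ) : ℂ) * (c + d) j) =
        (fun j => ((a j : ℝ) : ℂ) * c j) + fun j => ((a j : ℝ) : ℂ) * d j := by
      ext; simp [mul_add]
    simp only [Set.mem_ofPred_eq, h]
    exact hc.add hd
  smul_mem' := by
    intro r c hc
    have h : (fun j => ((a j : ℝ) : ℂ) * (r • c) j) =
        r • fun j => ((a j : ℝ) : ℂ) * c j := by
      ext; simp [mul_left_comm]
    simp only [Set.mem_ofPred_eq, h]
    exact Memℓp.const_smul hc r

/-- The space `ℓ^p(a) = {c : I → ℂ | a c ∈ ℓ^p(I)}`, as a type of its own (without the topology of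
pointwise convergence). -/
@[ext]
structure WeightedLp (p : ℝ≥0∞) (a : PosWeight I) where
  val : I → ℂ
  mem : val ∈ weightedLpSubmodule p a

namespace WeightedLp

/-- `ℓ^p(a)` carries the vector space structure of pointwise operations. -/
def equivSubmodule (p : ℝ≥0∞) (a : PosWeight I) : WeightedLp p a ≃ weightedLpSubmodule p a where
  toFun c := ⟨c.val, c.mem⟩
  invFun c := ⟨c.1, c.2⟩

instance (p : ℝ≥0∞) (a : PosWeight I) : AddCommGroup (WeightedLp p a) :=
  (equivSubmodule p a).addCommGroup

instance (p : ℝ≥0∞) (a : PosWeight I) : Module ℂ (WeightedLp p a) :=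
  (equivSubmodule p a).module ℂ

variable {p : ℝ≥0∞} {a : PosWeight I}

@[simp] theorem val_add (c d : WeightedLp p a) : (c + d).val = c.val + d.val := rfl

@[simp] theorem val_smul (r : ℂ) (c : WeightedLp p a) : (r • c).val = r • c.val := rfl

theorem weight_ne_zero (a : PosWeight I) (j : I) : ((a j : ℝ) : ℂ) ≠ 0 :=
  Complex.ofReal_ne_zero.2 (ne_of_gt (a j).2)

/-- The bijection `c ↦ a c` of `ℓ^p(a)` onto `ℓ^p(I)`. -/
def mulWeight (p : ℝ≥0∞) (a : PosWeight I) : WeightedLp p a ≃ₗ[ℂ] lp (fun _ : I => ℂ) p where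
  toFun c := ⟨fun j => ((a j : ℝ) : ℂ) * c.val j, c.mem⟩
  map_add' c d := by
    ext j
    exact mul_add _ _ _
  map_smul' r c := by
    ext j
    exact mul_left_comm _ _ _
  invFun x := ⟨fun j => ((a j : ℝ) : ℂ)⁻¹ * x j, by
    have h : (fun j => ((a j : ℝ) : ℂ) * (((a j : ℝ) : ℂ)⁻¹ * x j)) = fun j => x j :=
      funext fun j => mul_inv_cancel_left₀ (weight_ne_zero a j) _
    change Memℓp (fun j => ((a j : ℝ) : ℂ) * (((a j : ℝ) : ℂ)⁻¹ * x j)) p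
    rw [h]
    exact lp.memℓp x⟩
  left_inv c := by
    ext j
    exact inv_mul_cancel_left₀ (weight_ne_zero a j) _
  right_inv x := by
    ext j
    exact mul_inv_cancel_left₀ (weight_ne_zero a j) _

end WeightedLp

variable {p : ℝ≥0∞} [Fact (1 ≤ p)]

/-- The norm `‖c‖ = ‖a c‖_{ℓ^p}` of `ℓ^p(a)`. -/
instance (a : PosWeight I) : NormedAddCommGroup (WeightedLp p a) :=
  NormedAddCommGroup.induced _ _ (WeightedLp.mulWeight p a) (WeightedLp.mulWeight p a).injective

theorem WeightedLp.norm_def (a : PosWeight I) (c : WeightedLp p a) :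
    ‖c‖ = ‖WeightedLp.mulWeight p a c‖ := rfl

instance (a : PosWeight I) : NormedSpace ℂ (WeightedLp p a) :=
  NormedSpace.induced ℂ _ _ (WeightedLp.mulWeight p a).toLinearMap

instance (a : PosWeight I) : CompleteSpace (WeightedLp p a) :=
  (completeSpace_congr (e := (WeightedLp.mulWeight p a).toEquiv)
    (LinearIsometryEquiv.mk (WeightedLp.mulWeight p a) fun _ => rfl).isometry.isUniformEmbedding).2
    inferInstance

end WeightedLp

/-- A decreasing sequence `A = (a₀ ≥ a₁ ≥ …)` of positive functions on `I`. -/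
structure CoechelonMatrix (I : Type*) where
  weight : ℕ → PosWeight I
  antitone : ∀ (n : ℕ) (j : I), (weight (n + 1) j : ℝ) ≤ weight n j

namespace CoechelonMatrix

variable {I : Type u} (A : CoechelonMatrix I)

theorem weight_le {n m : ℕ} (h : n ≤ m) (j : I) : (A.weight m j : ℝ) ≤ A.weight n j :=
  antitone_nat_of_succ_le (f := fun n => (A.weight n j : ℝ)) (fun n => A.antitone n j) h

theorem norm_weight_mul_le {n m : ℕ} (h : n ≤ m) (c : I → ℂ) (j : I) :
    ‖((A.weight m j : ℝ) : ℂ) * c j‖ ≤ ‖((A.weight n j : ℝ) : ℂ) * c j‖ := by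
  have h0 : (0 : ℝ) < A.weight m j := (A.weight m j).2
  have h1 : (0 : ℝ) < A.weight n j := (A.weight n j).2
  rw [norm_mul, norm_mul, Complex.norm_of_nonneg h0.le, Complex.norm_of_nonneg h1.le]
  exact mul_le_mul_of_nonneg_right (A.weight_le h j) (norm_nonneg _)

theorem weightedLp_mono (p : ℝ≥0∞) {n m : ℕ} (h : n ≤ m) :
    weightedLpSubmodule p (A.weight n) ≤ weightedLpSubmodule p (A.weight m) :=
  fun c hc => Memℓp.mono' hc (A.norm_weight_mul_le h c)

/-- The union `⋃ₙ ℓ^p(aₙ)` as a vector space of functions on `I`. -/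
def unionSubmodule (p : ℝ≥0∞) : Submodule ℂ (I → ℂ) where
  carrier := ⋃ n, (weightedLpSubmodule p (A.weight n) : Set (I → ℂ))
  zero_mem' := Set.mem_iUnion.2 ⟨0, zero_mem _⟩
  add_mem' := by
    intro c d hc hd
    obtain ⟨n, hn⟩ := Set.mem_iUnion.1 hc
    obtain ⟨m, hm⟩ := Set.mem_iUnion.1 hd
    exact Set.mem_iUnion.2 ⟨max n m, add_mem (A.weightedLp_mono p (le_max_left n m) hn)
      (A.weightedLp_mono p (le_max_right n m) hm)⟩
  smul_mem' := by
    intro r c hc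
    obtain ⟨n, hn⟩ := Set.mem_iUnion.1 hc
    exact Set.mem_iUnion.2 ⟨n, Submodule.smul_mem _ r hn⟩

end CoechelonMatrix

/-- The space `k^p(A) = ⋃ₙ ℓ^p(aₙ)`; it carries the inductive limit topology below. -/
@[ext]
structure KSpace {I : Type u} (p : ℝ≥0∞) (A : CoechelonMatrix I) : Type u where
  val : I → ℂ
  mem : val ∈ A.unionSubmodule p

section KSpace

variable {I : Type u} (p : ℝ≥0∞) (A : CoechelonMatrix I)

/-- `k^p(A)` carries the vector space structure of pointwise operations. -/
def KSpace.equivSubmodule : KSpace p A ≃ A.unionSubmodule p where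
  toFun c := ⟨c.val, c.mem⟩
  invFun c := ⟨c.1, c.2⟩

instance : AddCommGroup (KSpace p A) := (KSpace.equivSubmodule p A).addCommGroup

instance : Module ℂ (KSpace p A) := (KSpace.equivSubmodule p A).module ℂ

@[simp] theorem KSpace.val_add (c d : KSpace p A) : (c + d).val = c.val + d.val := rfl

@[simp] theorem KSpace.val_smul (r : ℂ) (c : KSpace p A) : (r • c).val = r • c.val := rfl

namespace CoechelonMatrix

/-- The inclusion `ℓ^p(aₙ) → ℓ^p(aₘ)` for `n ≤ m`. -/
def inclLinear {n m : ℕ} (h : n ≤ m) :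
    WeightedLp p (A.weight n) →ₗ[ℂ] WeightedLp p (A.weight m) where
  toFun c := ⟨c.val, A.weightedLp_mono p h c.mem⟩
  map_add' _ _ := WeightedLp.ext (by simp)
  map_smul' _ _ := WeightedLp.ext (by simp)

/-- The inclusion `ℓ^p(aₙ) → k^p(A)`. -/
def toKSpace (n : ℕ) : WeightedLp p (A.weight n) →ₗ[ℂ] KSpace p A where
  toFun c := ⟨c.val, Set.mem_iUnion.2 ⟨n, c.mem⟩⟩
  map_add' _ _ := KSpace.ext (by simp)
  map_smul' _ _ := KSpace.ext (by simp)

theorem toKSpace_injective (n : ℕ) : Function.Injective (A.toKSpace p n) :=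
  fun _ _ h => WeightedLp.ext (congrArg KSpace.val h)

variable [Fact (1 ≤ p)]

theorem norm_inclLinear_le {n m : ℕ} (h : n ≤ m) (c : WeightedLp p (A.weight n)) :
    ‖A.inclLinear p h c‖ ≤ 1 * ‖c‖ := by
  rw [one_mul, WeightedLp.norm_def, WeightedLp.norm_def]
  have hp : p ≠ 0 := (zero_lt_one.trans_le (Fact.out : 1 ≤ p)).ne'
  exact lp.norm_mono hp fun j => A.norm_weight_mul_le h c.val j

/-- The inclusion `ℓ^p(aₙ) → ℓ^p(aₘ)` as a continuous linear map. -/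
def incl {n m : ℕ} (h : n ≤ m) :
    WeightedLp p (A.weight n) →L[ℂ] WeightedLp p (A.weight m) :=
  (A.inclLinear p h).mkContinuous 1 (A.norm_inclLinear_le p h)

theorem toKSpace_incl {n m : ℕ} (h : n ≤ m) (c : WeightedLp p (A.weight n)) :
    A.toKSpace p m (A.incl p h c) = A.toKSpace p n c :=
  KSpace.ext rfl

end CoechelonMatrix

/-- The inductive spectrum `(ℓ^p(aₙ))ₙ` in `k^p(A)`. -/
def kSpectrum [Fact (1 ≤ p)] : BanachSpectrum (KSpace p A) where
  step n := WeightedLp p (A.weight n)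
  toLim n := A.toKSpace p n
  toLim_injective n := A.toKSpace_injective p n
  incl h := A.incl p h
  toLim_incl h c := A.toKSpace_incl p h c

/-- `k^p(A) = Ind (ℓ^p(aₙ))ₙ` carries the inductive limit topology. -/
instance [Fact (1 ≤ p)] : TopologicalSpace (KSpace p A) := (kSpectrum p A).limTopology

end KSpace

/-! ### Weak `E`-acyclicity and the condition (S) -/

/-- `Z` is weakly `E`-acyclic: for every (algebraically) exact sequence `0 → X → Y → Z → 0` of
`(LB)`-spaces with continuous linear maps `ι : X → Y` and `Q : Y → Z`, every continuous linear
map `X → E` extends along `ι` to a continuous linear map `Y → E`. The spaces `X` and `Y` range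
over the universe `w`. -/
def IsWeaklyAcyclic (E : Type u) [AddCommGroup E] [Module ℂ E] [TopologicalSpace E]
    (Z : Type v) [AddCommGroup Z] [Module ℂ Z] [TopologicalSpace Z] : Prop :=
  ∀ (X Y : Type w) [AddCommGroup X] [Module ℂ X] [TopologicalSpace X]
    [AddCommGroup Y] [Module ℂ Y] [TopologicalSpace Y] (ι : X →L[ℂ] Y) (Q : Y →L[ℂ] Z),
    IsLBSpace X → IsLBSpace Y →
    Function.Injective ι → Function.Exact ι Q → Function.Surjective Q →
    ∀ T : X →L[ℂ] E, ∃ S : Y →L[ℂ] E, S.comp ι = T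

/-- The condition (S) for a sequence `(B_N)` of subsets of `E` and an inductive spectrum
`(Z_n)` of Banach spaces; for `z ∈ Z_n` and `m ≥ n`, the norm of `z` in `Z_m` is the norm of
its image under the inclusion map `Z_n → Z_m`. -/
def ConditionS {E : Type u} [AddCommGroup E] [Module ℂ E] (B : ℕ → Set E)
    {Z : Type v} [AddCommGroup Z] [Module ℂ Z] (𝒵 : BanachSpectrum Z) : Prop :=
  ∀ n : ℕ, ∃ (m : ℕ) (hnm : n ≤ m), ∀ (k : ℕ) (hmk : m ≤ k), ∃ N : ℕ,
    ∀ M ≥ N, ∀ ε > (0 : ℝ), ∃ K ≥ M, ∃ C > (0 : ℝ), ∀ z : 𝒵.step n,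
      ‖𝒵.incl hnm z‖ • B M ⊆
        (C * ‖𝒵.incl (hnm.trans hmk) z‖) • B K + (ε * ‖z‖) • B N

end

/-! Write E and Z as unions of Banach steps E_N and Z_n; local completeness makes every bounded
subset of E bounded in some E_N. By Grothendieck's factorization theorem (`exists_factor_bound`) a
continuous operator Z_n → E takes values in some E_N, boundedly. Under restriction these operators
form a projective spectrum, and both directions pass through its Proj¹: the solvability of f_i = s_i
− s_{i+1}|Z_φ(i) along a subsequence φ (`ProjOneZero`).

Necessity. The canonical resolution 0 → ⊕ Z_φ(i) → ⊕ Z_φ(i) → Z → 0 turns weak acyclicity into Proj¹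
= 0 along every φ. A gliding hump then forces every operator Z_m → E_M to split on Z_n into an
operator defined on Z_k and a small one into E_N (`exists_operator_split`). The factorization
theorem makes this uniform, at the price of a fixed constant in place of ε, and rank one operators
give a weak form of (S) (`weakPairS_of_projOneZero`). The ε returns through the Ehrling inequality
‖z‖_m ≤ C‖z‖_k + ε‖z‖_n (`NormInterpolation`). It comes from coordinates where a_M / a_N is small in
case (a), from a vector of E outside a compact set in case (b), from the columns of a suitable
operator in case (c), and from compactness of the inclusions in case (d).

Sufficiency. (S) speaks of single vectors z and b; each hypothesis upgrades it to operators
(`PairOp`). Over ℓ¹ this is done column by column, into ℓ^∞ row by row with Hahn–Banach, and for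
nuclear inclusions along the singular vectors of a linking operator on ℓ². A Mittag-Leffler argument
with σ-convex bounded sets gives Proj¹ = 0 along some φ (`Splits.projOneZero`). Moreover T : X → E
extends to each single step of Y (`IsLocallyAcyclic`): in (a) and (b) operators into the steps of E
extend, in (c) and (d) the steps of Z lift to Y. Consecutive local extensions differ by operators on
steps of Z, and Proj¹ = 0 corrects them so that they glue (`exists_extension_of_local`). -/

noncomputable section

set_option linter.unusedSectionVars false

/-! ### σ-convex sets and absorption -/

section SigmaConvex

variable {L : Type*} [AddCommGroup L] [Module ℝ L] [TopologicalSpace L]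

/-- `A` is closed under the series `∑ 2⁻⁽ⁱ⁺¹⁾ xᵢ` with terms `xᵢ` in `A`. -/
def SigmaConvex (A : Set L) : Prop :=
  ∀ x : ℕ → L, (∀ i, x i ∈ A) → ∃ s ∈ A,
    Filter.Tendsto (fun p => ∑ i ∈ Finset.range p, (1 / 2 : ℝ) ^ (i + 1) • x i) Filter.atTop (𝓝 s)

theorem SigmaConvex.image {M : Type*} [AddCommGroup M] [Module ℝ M] [TopologicalSpace M]
    {A : Set L} (hA : SigmaConvex A) (f : L →L[ℝ] M) : SigmaConvex (f '' A) := by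
  intro y hy
  choose x hx hxy using hy
  obtain ⟨s, hs, ht⟩ := hA x hx
  refine ⟨f s, ⟨s, hs, rfl⟩, ?_⟩
  have := (f.continuous.tendsto s).comp ht
  refine this.congr fun p => ?_
  simp [map_sum, hxy]

theorem SigmaConvex.smul [ContinuousConstSMul ℝ L] {A : Set L} (hA : SigmaConvex A) (c : ℝ) :
    SigmaConvex (c • A) := by
  exact hA.image (c • ContinuousLinearMap.id ℝ L)

theorem SigmaConvex.add [ContinuousAdd L] {A B : Set L} (hA : SigmaConvex A)
    (hB : SigmaConvex B) : SigmaConvex (A + B) := by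
  intro y hy
  choose a ha b hb hab using fun i => Set.mem_add.1 (hy i)
  obtain ⟨s, hs, hs'⟩ := hA a ha
  obtain ⟨t, ht, ht'⟩ := hB b hb
  refine ⟨s + t, Set.add_mem_add hs ht, (hs'.add ht').congr fun p => ?_⟩
  simp only [← Finset.sum_add_distrib, ← smul_add, hab]

/-- Continuity and uniqueness of limits identify `f s` with the sum formed in `B`, so neither set
has to be closed. -/
theorem SigmaConvex.inter_preimage {M : Type*} [AddCommGroup M] [Module ℝ M] [TopologicalSpace M]
    [T2Space M] {A : Set L} {B : Set M} (hA : SigmaConvex A) (hB : SigmaConvex B)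
    (f : L →L[ℝ] M) : SigmaConvex (f ⁻¹' B ∩ A) := by
  intro x hx
  obtain ⟨s, hs, hs'⟩ := hA x fun i => (hx i).2
  obtain ⟨t, ht, ht'⟩ := hB (fun i => f (x i)) fun i => (hx i).1
  have h1 := (f.continuous.tendsto s).comp hs'
  have h2 : f s = t := tendsto_nhds_unique h1 (ht'.congr fun p => by simp [map_sum])
  exact ⟨s, ⟨by simpa [h2] using ht, hs⟩, hs'⟩

theorem sigmaConvex_closedBall {F : Type*} [NormedAddCommGroup F] [NormedSpace ℝ F]
    [CompleteSpace F] (R : ℝ) : SigmaConvex (Metric.closedBall (0 : F) R) := by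
  intro x hx
  simp only [mem_closedBall_zero_iff] at hx
  have hsum : Summable fun i : ℕ => (1 / 2 : ℝ) ^ (i + 1) * R :=
    ((summable_geometric_two).mul_left (1 / 2 : ℝ)).mul_right R |>.congr fun i => by
      rw [pow_succ]; ring
  have htot : ∑' i : ℕ, (1 / 2 : ℝ) ^ (i + 1) * R = R := by
    have : (fun i : ℕ => (1 / 2 : ℝ) ^ (i + 1) * R) = fun i => (1 / 2 : ℝ) ^ i * (R / 2) := by
      ext i; rw [pow_succ]; ring
    rw [this, tsum_mul_right, tsum_geometric_two]; ring
  have hb : ∀ i, ‖(1 / 2 : ℝ) ^ (i + 1) • x i‖ ≤ (1 / 2 : ℝ) ^ (i + 1) * R := fun i => by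
    rw [norm_smul, Real.norm_of_nonneg (by positivity)]
    exact mul_le_mul_of_nonneg_left (hx i) (by positivity)
  have hs : Summable fun i => (1 / 2 : ℝ) ^ (i + 1) • x i := Summable.of_norm_bounded hsum hb
  refine ⟨_, ?_, hs.hasSum.tendsto_sum_nat⟩
  rw [mem_closedBall_zero_iff, ← htot]
  exact tsum_of_norm_bounded hsum.hasSum hb

/-- Iterating d = a₀ + ½ d₁, d₁ = a₁ + ½ d₂, … gives d = 2 ∑ 2⁻⁽ⁱ⁺¹⁾ aᵢ, because boundedness of `D`
kills the remainders 2⁻ᵖ d_p. This is the successive approximation of the open mapping theorem; it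
is used below whenever an error term must be absorbed. -/
theorem SigmaConvex.subset_two_smul [IsTopologicalAddGroup L] [ContinuousSMul ℝ L] [T2Space L]
    {A D : Set L} (hA : SigmaConvex A) (hD : Bornology.IsVonNBounded ℝ D)
    (h : D ⊆ A + (1 / 2 : ℝ) • D) : D ⊆ (2 : ℝ) • A := by
  have h' : ∀ d : D, ∃ a ∈ A, ∃ e : D, (d : L) = a + (1 / 2 : ℝ) • (e : L) := by
    rintro ⟨d, hd⟩
    obtain ⟨a, ha, e, he, hde⟩ := Set.mem_add.1 (h hd)
    obtain ⟨e, he', rfl⟩ := Set.mem_smul_set.1 he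
    exact ⟨a, ha, ⟨e, he'⟩, hde.symm⟩
  choose a ha e he using h'
  intro d hd
  let x : ℕ → D := fun i => e^[i] ⟨d, hd⟩
  have hx : ∀ i, (x i : L) = a (x i) + (1 / 2 : ℝ) • (x (i + 1) : L) := fun i => by
    simp only [x, Function.iterate_succ_apply']
    exact he _
  obtain ⟨s, hs, hs'⟩ := hA (fun i => a (x i)) fun i => ha _
  have hd' : ∀ p : ℕ, d = (2 : ℝ) • (∑ i ∈ Finset.range p, (1 / 2 : ℝ) ^ (i + 1) • a (x i)) +
      (1 / 2 : ℝ) ^ p • (x p : L) := by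
    intro p
    induction p with
    | zero => simp [x]
    | succ p ih =>
      rw [Finset.sum_range_succ, ih, hx p]
      simp only [smul_add, smul_smul, pow_succ]
      have : (2 : ℝ) * ((1 / 2) ^ p * (1 / 2)) = (1 / 2) ^ p := by ring
      rw [this, add_assoc]
  have hlim : Filter.Tendsto (fun p : ℕ => (1 / 2 : ℝ) ^ p • (x p : L)) Filter.atTop (𝓝 0) :=
    hD.smul_tendsto_zero (Filter.Eventually.of_forall fun p => (x p).2)
      (tendsto_pow_atTop_nhds_zero_of_lt_one (by norm_num) (by norm_num))
  have h2 := (hs'.const_smul (2 : ℝ)).add hlim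
  rw [add_zero] at h2
  have h3 : (2 : ℝ) • s = d := tendsto_nhds_unique h2
    ((tendsto_const_nhds (x := d)).congr fun p => hd' p)
  exact ⟨s, hs, h3⟩

end SigmaConvex

/-! ### Projective spectra of unions of Banach disks -/

/-- A projective spectrum of spaces `L n` with increasing sequences of bounded `σ`-convex absolutely
convex sets `B n N` in `L n`. -/
structure DiskSpectrum (L : ℕ → Type*) [∀ n, AddCommGroup (L n)] [∀ n, Module ℝ (L n)]
    [∀ n, TopologicalSpace (L n)] where
  r : ∀ {n m : ℕ}, n ≤ m → L m →L[ℝ] L n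
  r_refl : ∀ n (x : L n), r (le_refl n) x = x
  r_comp : ∀ {n m k : ℕ} (h : n ≤ m) (h' : m ≤ k) (x : L k), r h (r h' x) = r (h.trans h') x
  B : ∀ n : ℕ, ℕ → Set (L n)
  convex : ∀ n N, Convex ℝ (B n N)
  neg_mem : ∀ {n N x}, x ∈ B n N → -x ∈ B n N
  zero_mem : ∀ n N, 0 ∈ B n N
  sigmaConvex : ∀ n N, SigmaConvex (B n N)
  bounded : ∀ n N, Bornology.IsVonNBounded ℝ (B n N)
  mono : ∀ {n N M x}, N ≤ M → x ∈ B n N → x ∈ B n M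
  maps : ∀ {n m N x} (h : n ≤ m), x ∈ B m N → r h x ∈ B n N

namespace DiskSpectrum

variable {L : ℕ → Type*} [∀ n, AddCommGroup (L n)] [∀ n, Module ℝ (L n)]
  [∀ n, TopologicalSpace (L n)] (S : DiskSpectrum L)

/-- The linear span `⋃ C • B n N` of the disks. -/
def Bdd (n : ℕ) (x : L n) : Prop := ∃ N, ∃ C > (0 : ℝ), ∃ b ∈ S.B n N, x = C • b

variable {S}

theorem smul_mem {n N : ℕ} {x : L n} (hx : x ∈ S.B n N) {c : ℝ} (h0 : 0 ≤ c) (h1 : c ≤ 1) :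
    c • x ∈ S.B n N :=
  (S.convex n N).smul_mem_of_zero_mem (S.zero_mem n N) hx ⟨h0, h1⟩

theorem exists_add {n N M : ℕ} {x y : L n} (hx : x ∈ S.B n N) (hy : y ∈ S.B n M) {c d : ℝ}
    (hc : 0 < c) (hd : 0 < d) : ∃ z ∈ S.B n (max N M), c • x + d • y = (c + d) • z := by
  have hcd : 0 < c + d := add_pos hc hd
  refine ⟨(c / (c + d)) • x + (d / (c + d)) • y, S.convex n _ (S.mono (le_max_left _ _) hx)
    (S.mono (le_max_right _ _) hy) (by positivity) (by positivity) (by field_simp), ?_⟩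
  rw [smul_add, smul_smul, smul_smul, mul_div_cancel₀ _ hcd.ne', mul_div_cancel₀ _ hcd.ne']

theorem Bdd.add {n : ℕ} {x y : L n} (hx : S.Bdd n x) (hy : S.Bdd n y) : S.Bdd n (x + y) := by
  obtain ⟨N, C, hC, x, hx, rfl⟩ := hx
  obtain ⟨M, D, hD, y, hy, rfl⟩ := hy
  obtain ⟨z, hz, h⟩ := exists_add hx hy hC hD
  exact ⟨_, _, add_pos hC hD, z, hz, h⟩

theorem Bdd.neg {n : ℕ} {x : L n} (hx : S.Bdd n x) : S.Bdd n (-x) := by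
  obtain ⟨N, C, hC, x, hx, rfl⟩ := hx
  exact ⟨N, C, hC, -x, S.neg_mem hx, (smul_neg _ _).symm⟩

theorem Bdd.sub {n : ℕ} {x y : L n} (hx : S.Bdd n x) (hy : S.Bdd n y) : S.Bdd n (x - y) :=
  sub_eq_add_neg x y ▸ hx.add hy.neg

theorem Bdd.map {n m : ℕ} (h : n ≤ m) {x : L m} (hx : S.Bdd m x) : S.Bdd n (S.r h x) := by
  obtain ⟨N, C, hC, x, hx, rfl⟩ := hx
  exact ⟨N, C, hC, _, S.maps h hx, map_smul _ _ _⟩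

theorem bdd_zero (n : ℕ) : S.Bdd n 0 := ⟨0, 1, one_pos, 0, S.zero_mem n 0, by simp⟩

theorem Bdd.smul {n : ℕ} {x : L n} (hx : S.Bdd n x) {c : ℝ} (hc : 0 < c) : S.Bdd n (c • x) := by
  obtain ⟨N, C, hC, x, hx, rfl⟩ := hx
  exact ⟨N, c * C, mul_pos hc hC, x, hx, smul_smul _ _ _⟩

variable (S)

/-- `A` is contained in `C • r (B k K) + V` for some `K` and `C`. -/
def Sub {n k : ℕ} (h : n ≤ k) (A V : Set (L n)) : Prop :=
  ∃ K, ∃ C > (0 : ℝ), ∀ a ∈ A, ∃ x ∈ S.B k K, ∃ v ∈ V, a = C • S.r h x + v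

variable {S} {n k : ℕ} {h : n ≤ k} {A V W : Set (L n)}

theorem Sub.trans (h1 : S.Sub h A V) (h2 : S.Sub h V W) : S.Sub h A W := by
  obtain ⟨K, C, hC, h1⟩ := h1
  obtain ⟨K', C', hC', h2⟩ := h2
  refine ⟨max K K', C + C', add_pos hC hC', fun a ha => ?_⟩
  obtain ⟨x, hx, v, hv, rfl⟩ := h1 a ha
  obtain ⟨y, hy, w, hw, rfl⟩ := h2 v hv
  obtain ⟨z, hz, e⟩ := exists_add hx hy hC hC'
  refine ⟨z, hz, w, hw, ?_⟩
  rw [← add_assoc, ← map_smul, ← map_smul, ← map_add, e, map_smul]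

theorem Sub.of_subset (hAV : A ⊆ V) : S.Sub h A V :=
  ⟨0, 1, one_pos, fun a ha => ⟨0, S.zero_mem _ _, a, hAV ha, by simp⟩⟩

theorem Sub.smul (h1 : S.Sub h A V) {c : ℝ} (hc : 0 < c) : S.Sub h (c • A) (c • V) := by
  obtain ⟨K, C, hC, h1⟩ := h1
  refine ⟨K, c * C, mul_pos hc hC, ?_⟩
  rintro _ ⟨a, ha, rfl⟩
  obtain ⟨x, hx, v, hv, rfl⟩ := h1 a ha
  exact ⟨x, hx, _, Set.smul_mem_smul_set hv, by simp [smul_smul]⟩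

theorem Sub.map {m : ℕ} {h' : m ≤ n} (h1 : S.Sub h A V) :
    S.Sub (h'.trans h) (S.r h' '' A) (S.r h' '' V) := by
  obtain ⟨K, C, hC, h1⟩ := h1
  refine ⟨K, C, hC, ?_⟩
  rintro _ ⟨a, ha, rfl⟩
  obtain ⟨x, hx, v, hv, rfl⟩ := h1 a ha
  exact ⟨x, hx, _, ⟨v, hv, rfl⟩, by simp [S.r_comp]⟩

/-- The set C • r (B k K) + V is again σ-convex, so the error ½ A can be removed by successive
approximation, with doubled constants but the same K. -/
theorem Sub.absorb [∀ n, IsTopologicalAddGroup (L n)] [∀ n, ContinuousSMul ℝ (L n)]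
    [∀ n, T2Space (L n)] (hA : Bornology.IsVonNBounded ℝ A) (hV : SigmaConvex V)
    (h1 : S.Sub h A (V + (1 / 2 : ℝ) • A)) : S.Sub h A ((2 : ℝ) • V) := by
  obtain ⟨K, C, hC, h1⟩ := h1
  have hs : SigmaConvex (C • (S.r h '' S.B k K) + V) :=
    (((S.sigmaConvex k K).image _).smul C).add hV
  have h2 := hs.subset_two_smul hA fun a ha => by
    obtain ⟨x, hx, _, ⟨v, hv, w, hw, rfl⟩, rfl⟩ := h1 a ha
    exact ⟨_, ⟨_, ⟨_, ⟨x, hx, rfl⟩, rfl⟩, v, hv, rfl⟩, w, hw, add_assoc _ _ _⟩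
  refine ⟨K, 2 * C, by positivity, fun a ha => ?_⟩
  obtain ⟨_, ⟨_, ⟨_, ⟨x, hx, rfl⟩, rfl⟩, v, hv, rfl⟩, rfl⟩ := h2 ha
  exact ⟨x, hx, _, Set.smul_mem_smul_set hv, by simp [smul_smul]⟩

end DiskSpectrum

/-! ### Vanishing of Proj¹ from the splitting condition (Mittag-Leffler) -/

namespace DiskSpectrum

section Sufficiency

variable {L : ℕ → Type*} [∀ n, AddCommGroup (L n)] [∀ n, Module ℝ (L n)]
  [∀ n, TopologicalSpace (L n)] (S : DiskSpectrum L)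

/-- The condition `∀ n ∃ m ∀ k ∃ N ∀ M, ε ∃ K, C : r (B m M) ⊆ C • r (B k K) + ε • B n N`. -/
def Splits : Prop :=
  ∀ n, ∃ m, ∃ h : n ≤ m, ∀ k, ∀ hk : m ≤ k, ∃ N, ∀ M ≥ N, ∀ ε > (0 : ℝ),
    S.Sub (h.trans hk) (S.r h '' S.B m M) (ε • S.B n N)

/-- `D` is a `σ`-convex set with `r (B m M) ⊆ C • r (B k K) + ε • D` for all `k ≥ m`. -/
def Good (n : ℕ) (D : Set (L n)) : Prop :=
  SigmaConvex D ∧ ∃ m, ∀ m', ∀ h : n ≤ m', m ≤ m' → ∀ k, ∀ hk : m' ≤ k, ∀ M, ∀ ε > (0 : ℝ),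
    S.Sub (h.trans hk) (S.r h '' S.B m' M) (ε • D)

variable {S}

/-- Replaces the piece from level `m` by a piece from level `k`. The tolerance δ / C compensates the
factor C with which the disk of level `m` enters. -/
theorem Sub.through {n m k : ℕ} {h : n ≤ m} {h' : n ≤ k} {A V D : Set (L n)} (h1 : S.Sub h A V)
    (h2 : ∀ K, ∀ δ > (0 : ℝ), S.Sub h' (S.r h '' S.B m K) (δ • D)) {δ : ℝ} (hδ : 0 < δ) :
    S.Sub h' A (V + δ • D) := by
  obtain ⟨K, C, hC, h1⟩ := h1
  obtain ⟨K', C', hC', h2⟩ := h2 K (δ / C) (by positivity)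
  refine ⟨K', C * C', by positivity, fun a ha => ?_⟩
  obtain ⟨x, hx, v, hv, rfl⟩ := h1 a ha
  obtain ⟨y, hy, _, ⟨d, hd, rfl⟩, e⟩ := h2 _ ⟨x, hx, rfl⟩
  refine ⟨y, hy, v + δ • d, Set.add_mem_add hv (Set.smul_mem_smul_set hd), ?_⟩
  simp only [e, smul_add, smul_smul]
  rw [mul_div_cancel₀ _ hC.ne']
  abel

theorem image_image_r {n m k : ℕ} (h : n ≤ m) (h' : m ≤ k) (A : Set (L k)) :
    S.r h '' (S.r h' '' A) = S.r (h.trans h') '' A := by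
  rw [Set.image_image]
  simp only [S.r_comp]

theorem image_smul_r {n m : ℕ} (h : n ≤ m) (c : ℝ) (A : Set (L m)) :
    S.r h '' (c • A) = c • S.r h '' A :=
  Set.image_smul_comm _ _ _ fun _ => map_smul _ _ _

theorem Sub.mono_left {n k : ℕ} {h : n ≤ k} {A A' V : Set (L n)} (h1 : S.Sub h A V)
    (hA : A' ⊆ A) : S.Sub h A' V :=
  (Sub.of_subset hA).trans h1

theorem image_r_subset {n m k : ℕ} (h : n ≤ m) (h' : m ≤ k) (M : ℕ) :
    S.r (h.trans h') '' S.B k M ⊆ S.r h '' S.B m M := by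
  rw [← image_image_r h h']
  exact Set.image_mono (Set.image_subset_iff.2 fun x hx => S.maps h' hx)

theorem bounded_image {n m : ℕ} (h : n ≤ m) (M : ℕ) :
    Bornology.IsVonNBounded ℝ (S.r h '' S.B m M) :=
  (S.bounded m M).image (S.r h)

theorem r_mem_of_le {D : ∀ n, Set (L n)} (hD : ∀ n, ∀ x ∈ D (n + 1), S.r n.le_succ x ∈ D n)
    {n m : ℕ} (h : n ≤ m) {x : L m} (hx : x ∈ D m) : S.r h x ∈ D n := by
  induction m, h using Nat.le_induction with
  | base => rwa [S.r_refl]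
  | succ m h ih =>
    rw [← S.r_comp h m.le_succ]
    exact ih (hD m x hx)

variable [∀ n, IsTopologicalAddGroup (L n)] [∀ n, ContinuousSMul ℝ (L n)] [∀ n, T2Space (L n)]

/-- In the splitting condition, `N` can be chosen independently of `k`. -/
theorem Splits.exists_good (hS : S.Splits) (n : ℕ) : ∃ N, S.Good n (S.B n N) := by
  obtain ⟨m, h, hn⟩ := hS n
  obtain ⟨m', h', hm⟩ := hS m
  obtain ⟨N₀, hN₀⟩ := hn m' h'
  have hi : ∀ M, ∀ ε > (0 : ℝ), S.Sub (h.trans h') (S.r h '' S.B m M) (ε • S.B n N₀) :=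
    fun M ε hε => (hN₀ (max M N₀) (le_max_right _ _) ε hε).mono_left
      (Set.image_mono fun x hx => S.mono (le_max_left _ _) hx)
  refine ⟨N₀, S.sigmaConvex n N₀, m', fun m₁ h₁ h₁' k hk M ε hε => ?_⟩
  obtain ⟨N₁, hN₁⟩ := hm k (h₁'.trans hk)
  have hii : ∀ M, ∀ ε > (0 : ℝ), S.Sub (h₁.trans hk) (S.r (h.trans h') '' S.B m' M)
      (ε • S.r h '' S.B m N₁) := fun M ε hε => by
    rw [← image_image_r h h', ← image_smul_r]
    exact Sub.map ((hN₁ (max M N₁) (le_max_right _ _) ε hε).mono_left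
      (Set.image_mono fun x hx => S.mono (le_max_left _ _) hx))
  -- `N₁` depends on `k`, but r (B m N₁) splits over the fixed level `m'` with error in the fixed
  -- disk `B n N₀`. Passing from `m'` on to `k` costs only ½ r (B m N₁), which is absorbed.
  have hD : S.Sub (h₁.trans hk) (S.r h '' S.B m N₁) (ε • S.B n N₀) := by
    have h2 := ((hi N₁ (ε / 2) (by positivity)).through hii (one_half_pos (α := ℝ))).absorb
      (bounded_image h N₁) ((S.sigmaConvex n N₀).smul _)
    rwa [smul_smul, mul_div_cancel₀ _ two_ne_zero] at h2
  have h3 := hii M 1 one_pos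
  rw [one_smul] at h3
  exact (h3.trans hD).mono_left (image_r_subset _ h₁' M)

/-- The set D' collects bounded elements that restrict into `D`. The differences x − C₀ y arising
from a splitting with error in `D` lie in D', so r (B m N) is contained in D' up to a piece from
level m''. The intermediate level m' leaves room to send that piece to level k with an error that
`Sub.absorb` removes. -/
theorem Splits.good_succ (hS : S.Splits) {n : ℕ} {D : Set (L n)} (hD : S.Good n D) :
    ∃ D', S.Good (n + 1) D' ∧ (∀ x ∈ D', S.r n.le_succ x ∈ D) ∧ ∀ x ∈ D', S.Bdd (n + 1) x := by
  obtain ⟨hDs, m₀, hm₀⟩ := hD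
  obtain ⟨m, hm₀m, hnm⟩ : ∃ m, m₀ ≤ m ∧ n + 1 ≤ m := ⟨_, le_max_left _ _, le_max_right _ _⟩
  obtain ⟨N, -, m₁, hN⟩ := hS.exists_good m
  obtain ⟨m', hm₁, hm'⟩ : ∃ m', m₁ ≤ m' ∧ m ≤ m' := ⟨_, le_max_left _ _, le_max_right _ _⟩
  obtain ⟨N₂, -, m₂, hN₂⟩ := hS.exists_good m'
  obtain ⟨m'', hm₂, hm''⟩ : ∃ m'', m₂ ≤ m'' ∧ m' ≤ m'' := ⟨_, le_max_left _ _, le_max_right _ _⟩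
  obtain ⟨K₀, C₀, hC₀, h0⟩ :=
    hm₀ m (n.le_succ.trans hnm) hm₀m m'' (hm'.trans hm'') N 1 one_pos
  -- The factor 1 + C₀ and the index max N K₀ are those of x + C₀ (−y) with x from `B m N` and y
  -- from `B m'' K₀`.
  set D' : Set (L (n + 1)) :=
    S.r n.le_succ ⁻¹' D ∩ (1 + C₀) • S.B (n + 1) (max N K₀) with hD'
  have hD's : SigmaConvex D' := ((S.sigmaConvex _ _).smul _).inter_preimage hDs _
  have h1 : S.Sub (hnm.trans (hm'.trans hm'')) (S.r hnm '' S.B m N) D' := by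
    refine ⟨K₀, C₀, hC₀, ?_⟩
    rintro _ ⟨x, hx, rfl⟩
    obtain ⟨y, hy, _, ⟨d, hd, rfl⟩, e⟩ := h0 _ ⟨x, hx, rfl⟩
    refine ⟨y, hy, S.r hnm x - C₀ • S.r _ y, ⟨?_, ?_⟩, by abel⟩
    · have : S.r n.le_succ (S.r hnm x - C₀ • S.r (hnm.trans (hm'.trans hm'')) y) = d := by
        simp only [map_sub, map_smul, S.r_comp, e, one_smul]
        abel
      rwa [Set.mem_preimage, this]
    · obtain ⟨z, hz, e⟩ := exists_add (S.maps hnm hx)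
        (S.neg_mem (S.maps (hnm.trans (hm'.trans hm'')) hy)) one_pos hC₀
      refine ⟨z, hz, ?_⟩
      dsimp only
      rw [← e, one_smul, smul_neg, sub_eq_add_neg]
  refine ⟨D', ⟨hD's, m'', fun m₃ h₃ h₃' k hk M ε hε => ?_⟩, fun x hx => hx.1, fun x hx => ?_⟩
  · have hA' : ∀ M, ∀ δ > (0 : ℝ), S.Sub (h₃.trans hk)
        (S.r (hnm.trans (hm'.trans hm'')) '' S.B m'' M) (δ • S.r (hnm.trans hm') '' S.B m' N₂) :=
      fun M δ hδ => by
        rw [← image_image_r (hnm.trans hm') hm'', ← image_smul_r]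
        exact Sub.map (hN₂ m'' hm'' hm₂ k (h₃'.trans hk) M δ hδ)
    have hA : ∀ δ > (0 : ℝ), S.Sub (h₃.trans hk)
        (S.r (hnm.trans hm') '' S.B m' N₂) (δ • S.r hnm '' S.B m N) := fun δ hδ => by
      rw [← image_image_r hnm hm', ← image_smul_r]
      exact Sub.map (hN m' hm' hm₁ k (hm''.trans (h₃'.trans hk)) N₂ δ hδ)
    -- Up to pieces from level k, r (B m' N₂) lies in (ε/2) r (B m N), and this in (ε/2) D' + ½ r (B
    -- m' N₂); the last term is absorbed.
    have hQ : S.Sub (h₃.trans hk) (S.r (hnm.trans hm') '' S.B m' N₂) (ε • D') := by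
      have h2 := ((hA (ε / 2) (by positivity)).trans ((h1.smul (by positivity)).through hA'
        (one_half_pos (α := ℝ)))).absorb (bounded_image _ N₂) (hD's.smul _)
      rwa [smul_smul, mul_div_cancel₀ _ two_ne_zero] at h2
    have h3 := hA' M 1 one_pos
    rw [one_smul] at h3
    exact (h3.trans hQ).mono_left (image_r_subset _ h₃' M)
  · obtain ⟨_, b, hb, rfl⟩ := hx
    exact ⟨_, 1 + C₀, by positivity, b, hb, rfl⟩

theorem Splits.exists_good_seq (hS : S.Splits) : ∃ D : ∀ n, Set (L n), (∀ n, S.Good n (D n)) ∧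
    (∀ n, ∀ x ∈ D (n + 1), S.r n.le_succ x ∈ D n) ∧ ∀ n, ∀ x ∈ D n, S.Bdd n x := by
  choose f hf hfr hfB using fun (n : ℕ) (D : {D : Set (L n) // S.Good n D}) =>
    hS.good_succ D.2
  obtain ⟨N₀, h0⟩ := hS.exists_good 0
  let F : ∀ n, {D : Set (L n) // S.Good n D} := fun n =>
    Nat.rec ⟨S.B 0 N₀, h0⟩ (fun n D => ⟨f n D, hf n D⟩) n
  refine ⟨fun n => (F n).1, fun n => (F n).2, fun n x hx => hfr n (F n) x hx, fun n => ?_⟩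
  cases n with
  | zero => exact fun x hx => ⟨N₀, 1, one_pos, x, hx, (one_smul _ _).symm⟩
  | succ n => exact hfB n (F n)

variable (S) in
/-- Solvability of the equations `f i = s i - r (s (i + 1))` along the subsequence `φ`. -/
def ProjOneZero (φ : ℕ → ℕ) (hφ : StrictMono φ) : Prop :=
  ∀ f : ∀ i, L (φ i), (∀ i, S.Bdd _ (f i)) → ∃ s : ∀ i, L (φ i), (∀ i, S.Bdd _ (s i)) ∧
    ∀ i, f i = s i - S.r (hφ.monotone i.le_succ) (s (i + 1))

/-- Corrections g are chosen such that u_i = f_i + g_i − r g_{i+1} satisfies r u_{i+1} ∈ 2⁻⁽ⁱ⁺¹⁾ D.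
As the sets D are σ-convex and compatible with restriction, the tails ∑_{l>i} r u_l converge to
bounded elements, and u_i + ∑_{l>i} r u_l − g_i solves the equations. -/
theorem Splits.projOneZero (hS : S.Splits) : ∃ φ, ∃ hφ : StrictMono φ, S.ProjOneZero φ hφ := by
  obtain ⟨D, hD, hDr, hDB⟩ := hS.exists_good_seq
  choose m hm using fun n => (hD n).2
  -- Since φ (i + 1) ≥ m (φ i), elements of level φ (i + 1) can be approximated from level φ (i + 2)
  -- up to small multiples of `D (φ i)`.
  let φ : ℕ → ℕ := fun i => Nat.rec 0 (fun _ n => max (n + 1) (m n)) i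
  have hφ1 : ∀ i, φ i + 1 ≤ φ (i + 1) := fun i => le_max_left _ _
  have hφm : ∀ i, m (φ i) ≤ φ (i + 1) := fun i => le_max_right _ _
  have hφ : StrictMono φ := strictMono_nat_of_lt_succ hφ1
  refine ⟨φ, hφ, fun f hf => ?_⟩
  have step : ∀ i (x : L (φ (i + 1))), S.Bdd _ x → ∃ y : L (φ (i + 2)), S.Bdd _ y ∧ ∃ d ∈ D (φ i),
      S.r (hφ.monotone i.le_succ) (x - S.r (hφ.monotone (i + 1).le_succ) y) =
        (1 / 2 : ℝ) ^ (i + 1) • d := by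
    rintro i _ ⟨M, C, hC, x, hx, rfl⟩
    obtain ⟨K, C', hC', h⟩ := hm (φ i) (φ (i + 1)) (hφ.monotone i.le_succ) (hφm i)
      (φ (i + 2)) (hφ.monotone (i + 1).le_succ) M ((1 / 2) ^ (i + 1) / C) (by positivity)
    obtain ⟨y, hy, _, ⟨d, hd, rfl⟩, e⟩ := h _ ⟨x, hx, rfl⟩
    refine ⟨(C * C') • y, ⟨K, _, mul_pos hC hC', y, hy, rfl⟩, d, hd, ?_⟩
    simp only [map_sub, map_smul, e, S.r_comp, smul_add, smul_smul]
    rw [mul_div_cancel₀ _ hC.ne']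
    abel
  choose G hGB d hd hG using step
  -- The index is shifted: g 0 = g 1 = 0, and g (i + 2) is the correction belonging to f (i + 1) + g
  -- (i + 1).
  let g' : ∀ i, {x : L (φ (i + 1)) // S.Bdd _ x} := fun i =>
    Nat.rec ⟨0, bdd_zero _⟩ (fun i x => ⟨G i (f (i + 1) + x.1) ((hf (i + 1)).add x.2), hGB i _ ((hf (i + 1)).add x.2)⟩) i
  let g : ∀ i, L (φ i) := fun i => Nat.casesOn i 0 fun i => (g' i).1
  have hgB : ∀ i, S.Bdd _ (g i) := fun i => by
    cases i with
    | zero => exact bdd_zero _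
    | succ i => exact (g' i).2
  let u : ∀ i, L (φ i) := fun i => f i + g i - S.r (hφ.monotone i.le_succ) (g (i + 1))
  have huB : ∀ i, S.Bdd _ (u i) := fun i => ((hf i).add (hgB i)).sub ((hgB (i + 1)).map _)
  let e : ∀ i, L (φ i) := fun i => d i (f (i + 1) + g (i + 1)) ((hf (i + 1)).add (hgB (i + 1)))
  have heD : ∀ i, e i ∈ D (φ i) := fun i => hd _ _ _
  have hue : ∀ i, S.r (hφ.monotone i.le_succ) (u (i + 1)) = (1 / 2 : ℝ) ^ (i + 1) • e i :=
    fun i => hG i (f (i + 1) + g (i + 1)) ((hf (i + 1)).add (hgB (i + 1)))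
  let a : ∀ j l, j ≤ l → L (φ j) := fun j l h => S.r (hφ.monotone h) (e l)
  have haD : ∀ j l h, a j l h ∈ D (φ j) := fun j l h => r_mem_of_le hDr _ (heD l)
  -- The element 2⁻ʲ s j is the tail ∑_{l ≥ j} 2⁻⁽ˡ⁺¹⁾ r (e l) = ∑_{l > j} r (u l).
  choose s hsD hs using fun j => (hD (φ j)).1 (fun i => a j (j + i) (Nat.le_add_right j i))
    fun i => haD j (j + i) (Nat.le_add_right j i)
  have hrec : ∀ j, s j = (1 / 2 : ℝ) • e j +
      (1 / 2 : ℝ) • S.r (hφ.monotone j.le_succ) (s (j + 1)) := by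
    intro j
    have h1 := (Filter.tendsto_add_atTop_iff_nat 1).2 (hs j)
    have h2 := ((((S.r (hφ.monotone j.le_succ)).continuous.tendsto _).comp
      (hs (j + 1))).const_smul (1 / 2 : ℝ)).const_add ((1 / 2 : ℝ) • e j)
    refine tendsto_nhds_unique h1 (h2.congr fun p => ?_)
    have hcongr : ∀ l l' (h : j ≤ l) (h' : j ≤ l'), l = l' → a j l h = a j l' h' := by
      rintro l _ h h' rfl
      rfl
    rw [Finset.sum_range_succ']
    simp only [Function.comp_apply, map_sum, map_smul, Finset.smul_sum, smul_smul, zero_add,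
      pow_one]
    rw [add_comm]
    congr 1
    · refine Finset.sum_congr rfl fun i _ => ?_
      rw [pow_succ' _ (i + 1)]
      congr 1
      simp only [a, S.r_comp]
      exact hcongr (j + 1 + i) (j + (i + 1)) (by omega) (by omega) (by omega)
    · congr 1
      exact (S.r_refl _ _).symm.trans rfl
  refine ⟨fun i => u i + (1 / 2 : ℝ) ^ i • s i - g i, fun i =>
    ((huB i).add ((hDB _ _ (hsD i)).smul (by positivity))).sub (hgB i), fun i => ?_⟩
  have h1 := hue i
  simp only [map_sub, map_add, map_smul]
  rw [h1, hrec i, pow_succ, smul_add, smul_smul, smul_smul]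
  simp only [u]
  abel

end Sufficiency

/-! ### A splitting condition from vanishing of Proj¹ (gliding hump) -/

section Necessity

variable {L : ℕ → Type*} [∀ n, AddCommGroup (L n)] [∀ n, Module ℝ (L n)]
  [∀ n, TopologicalSpace (L n)] (S : DiskSpectrum L)

/-- If the equations `f i = s i - r (s (i + 1))` are solvable along all subsequences, then
`∀ n ∃ m ∀ k ∃ N ∀ M : r (L m)_M ⊆ r (L k) + B n N`. -/
theorem exists_split_of_projOneZero (hS : ∀ φ hφ, S.ProjOneZero φ hφ) :
    ∀ n, ∃ m, ∃ h : n ≤ m, ∀ k, ∀ hk : m ≤ k, ∃ N, ∀ M ≥ N, ∀ x ∈ S.B m M, ∀ C > (0 : ℝ),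
      ∃ y, S.Bdd k y ∧ S.r h (C • x) - S.r (h.trans hk) y ∈ S.B n N := by
  by_contra! hcon
  obtain ⟨n, hn⟩ := hcon
  choose k hk M hM f₀ hf₀ C hC hf using hn
  -- a state consists of `m ≥ n`, `N` and a bounded element of `L n`
  let State := {m : ℕ // n ≤ m} × ℕ × {s : L n // S.Bdd n s}
  -- Gliding hump: the new f is so large that no bounded y from the next level brings s + r f − r y
  -- into c • B n N with c ≤ i. The new state stores the partial sum s + r f.
  have hstep : ∀ (i : ℕ) (p : State), ∃ (q : State) (f : L p.1.1), S.Bdd _ f ∧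
      p.1.1 < q.1.1 ∧ p.2.1 < q.2.1 ∧ q.2.2.1 = p.2.2.1 + S.r p.1.2 f ∧
      ∀ (hpq : p.1.1 ≤ q.1.1) (y : L q.1.1), S.Bdd _ y →
        ∀ N ≤ p.2.1, ∀ b ∈ S.B n N, ∀ c > (0 : ℝ), c ≤ i →
          S.r p.1.2 f - S.r (p.1.2.trans hpq) y ≠ c • b - p.2.2.1 := by
    rintro i ⟨⟨m, hm⟩, N, s, hs⟩
    obtain ⟨N', R, hR, t, ht, hst⟩ := id hs
    have hx : S.Bdd m (C m hm (max N N') • f₀ m hm (max N N')) :=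
      ⟨_, _, hC _ _ _, _, hf₀ _ _ _, rfl⟩
    -- Here s ∈ R • B n N', and R + i + 1 dominates c + R for all c ≤ i. Division by it would put r
    -- (C f₀) − r y' into B n (max N N'), against the choice of f₀.
    have hρ : 0 < R + i + 1 := by positivity
    refine ⟨⟨⟨max (k m hm) (m + 1), (hm.trans m.le_succ).trans (le_max_right _ _)⟩, N + 1,
      s + S.r hm ((R + i + 1) • (C m hm (max N N') • f₀ m hm (max N N'))),
      hs.add ((hx.smul hρ).map hm)⟩, _, hx.smul hρ,
      Nat.lt_of_succ_le (le_max_right _ _), N.lt_succ_self, rfl, ?_⟩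
    intro hpq y hy N₂ hN₂ b hb c hc hci heq
    obtain ⟨z, hz, e⟩ := exists_add hb (S.neg_mem ht) hc hR
    refine hf m hm (max N N') ((R + i + 1)⁻¹ • S.r (le_max_left _ _) y)
      ((hy.map _).smul (by positivity)) ?_
    have h1 : S.r hm (C m hm (max N N') • f₀ m hm (max N N')) -
        S.r (hm.trans (hk m hm)) ((R + i + 1)⁻¹ • S.r (le_max_left _ _) y) =
        ((c + R) / (R + i + 1)) • z := by
      have h2 : (R + i + 1) • (S.r hm (C m hm (max N N') • f₀ m hm (max N N')) -
          S.r (hm.trans (hk m hm)) ((R + i + 1)⁻¹ • S.r (le_max_left _ _) y)) =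
          (c + R) • z := by
        rw [smul_sub, ← map_smul, ← map_smul (S.r (hm.trans (hk m hm))), smul_inv_smul₀ hρ.ne',
          S.r_comp, heq, ← e]
        change c • b - s = _
        rw [hst, smul_neg, sub_eq_add_neg]
      rw [div_eq_inv_mul, mul_smul, ← h2, inv_smul_smul₀ hρ.ne']
    rw [h1]
    exact smul_mem (S.mono (max_le_max hN₂ le_rfl) hz) (by positivity)
      ((div_le_one hρ).2 (by linarith))
  choose q f hfB hm hN hs hne using hstep
  let p : ℕ → State := fun i => Nat.rec ⟨⟨n, le_rfl⟩, 0, 0, bdd_zero n⟩ (fun i p => q i p) i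
  let φ : ℕ → ℕ := fun i => (p i).1.1
  have hφ : StrictMono φ := strictMono_nat_of_lt_succ fun i => hm i (p i)
  have hN' : ∀ i, i ≤ (p i).2.1 := fun i => (strictMono_nat_of_lt_succ
    (f := fun i => (p i).2.1) fun i => hN i (p i)).le_apply
  obtain ⟨σ, hσB, hσ⟩ := hS φ hφ (fun i => f i (p i)) fun i => hfB i (p i)
  have hsum : ∀ i, S.r (p 0).1.2 (σ 0) = (p i).2.2.1 + S.r (p i).1.2 (σ i) := by
    intro i
    induction i with
    | zero => exact (zero_add _).symm
    | succ i ih =>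
      have h1 : (p (i + 1)).2.2.1 = (p i).2.2.1 + S.r (p i).1.2 (f i (p i)) := hs i (p i)
      rw [ih, h1, hσ i, map_sub, S.r_comp]
      abel
  -- The image of σ 0 in `L n` lies in one set c • B n N, while telescoping writes it as s_i + r f_i
  -- + r σ_{i+1} for every i. This contradicts the choice of f_i as soon as i ≥ N and i ≥ c.
  obtain ⟨N, c, hc, b, hb, e⟩ := (hσB 0).map (p 0).1.2
  obtain ⟨i, hi, hci⟩ : ∃ i : ℕ, N ≤ i ∧ c ≤ i := by
    obtain ⟨j, hj⟩ := exists_nat_ge c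
    exact ⟨max N j, le_max_left _ _, hj.trans (by exact_mod_cast le_max_right _ _)⟩
  refine hne i (p i) (hm i (p i)).le (-σ (i + 1)) (hσB (i + 1)).neg N (hi.trans (hN' i)) b hb c hc hci ?_
  have h3 := hsum i
  have h4 : σ i = f i (p i) + S.r (hφ.monotone i.le_succ) (σ (i + 1)) := by
    rw [hσ i]
    abel
  rw [h4, map_add, S.r_comp, e] at h3
  rw [h3, map_neg]
  change _ - -S.r _ (σ (i + 1)) = _
  abel

end Necessity

end DiskSpectrum

/-! ### Grothendieck's factorization theorem -/

section Factorization

variable {F : Type*} [NormedAddCommGroup F] [NormedSpace ℂ F] {L : Type*} [AddCommGroup L]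
  [Module ℂ L]

theorem zero_mem_interior_of_convex_of_neg {F : Type*} [NormedAddCommGroup F] [NormedSpace ℝ F]
    {A : Set F} (hA : Convex ℝ A) (hneg : ∀ x ∈ A, -x ∈ A) (h : (interior A).Nonempty) :
    (0 : F) ∈ interior A := by
  obtain ⟨x, hx⟩ := h
  have hx' : -x ∈ A := hneg x (interior_subset hx)
  have := hA.combo_interior_self_mem_interior hx hx' (a := 1 / 2) (b := 1 / 2) (by norm_num)
    (by norm_num) (by norm_num)
  simpa using this

/-- Grothendieck's factorization theorem: if the range of a continuous linear map `J` on a Banach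
space is covered by the ranges of countably many continuous linear maps on Banach spaces, then it
is covered by one of them, with norm estimates. -/
theorem exists_factor_bound [CompleteSpace F] [TopologicalSpace L] [T2Space L]
    [IsTopologicalAddGroup L] [ContinuousSMul ℂ L]
    {κ : Type*} [Countable κ] {G : κ → Type*} [∀ i, NormedAddCommGroup (G i)]
    [∀ i, NormedSpace ℂ (G i)] [∀ i, CompleteSpace (G i)] (J : F →L[ℂ] L)
    (Ji : ∀ i, G i →L[ℂ] L) (hJ : ∀ x, ∃ i g, Ji i g = J x) :
    ∃ i, ∃ C > (0 : ℝ), ∀ x, ∃ g, Ji i g = J x ∧ ‖g‖ ≤ C * ‖x‖ := by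
  let q : ∀ i, F × G i →L[ℝ] L := fun i =>
    (J.restrictScalars ℝ).comp (ContinuousLinearMap.fst ℝ F (G i)) -
      ((Ji i).restrictScalars ℝ).comp (ContinuousLinearMap.snd ℝ F (G i))
  have hq : ∀ i x, q i x = J x.1 - Ji i x.2 := fun _ _ => rfl
  -- These sets are σ-convex as projections of σ-convex sets, but need not be closed. Baire's
  -- theorem is therefore applied to their closures.
  let A : κ × ℕ → Set F := fun i => ContinuousLinearMap.fst ℝ F (G i.1) ''
    (q i.1 ⁻¹' {0} ∩ Metric.closedBall 0 (i.2 : ℝ))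
  have hmem : ∀ i x, x ∈ A i ↔ ‖x‖ ≤ i.2 ∧ ∃ g, Ji i.1 g = J x ∧ ‖g‖ ≤ i.2 := by
    intro i x
    constructor
    · rintro ⟨⟨x, g⟩, ⟨h1, h2⟩, rfl⟩
      rw [mem_closedBall_zero_iff, norm_prod_le_iff] at h2
      rw [Set.mem_preimage, hq, Set.mem_singleton_iff, sub_eq_zero] at h1
      exact ⟨h2.1, g, h1.symm, h2.2⟩
    · rintro ⟨h1, g, h2, h3⟩
      refine ⟨(x, g), ⟨?_, ?_⟩, rfl⟩
      · rw [Set.mem_preimage, hq, Set.mem_singleton_iff, sub_eq_zero, h2]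
      · rw [mem_closedBall_zero_iff, norm_prod_le_iff]
        exact ⟨h1, h3⟩
  have hsingle : SigmaConvex ({0} : Set L) := fun x hx => by
    refine ⟨0, rfl, ?_⟩
    simp only [Set.mem_singleton_iff] at hx
    simp [hx]
  have hσ : ∀ i, SigmaConvex (A i) := fun i =>
    ((sigmaConvex_closedBall _).inter_preimage hsingle (q i.1)).image _
  have hconv : ∀ i, Convex ℝ (A i) := fun i =>
    (((convex_singleton 0).linear_preimage (q i.1).toLinearMap).inter
      (convex_closedBall _ _)).linear_image (ContinuousLinearMap.fst ℝ F (G i.1)).toLinearMap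
  have hneg : ∀ i, ∀ x ∈ A i, -x ∈ A i := by
    intro i x hx
    rw [hmem] at hx ⊢
    obtain ⟨h1, g, h2, h3⟩ := hx
    exact ⟨by rwa [norm_neg], -g, by rw [map_neg, h2, map_neg], by rwa [norm_neg]⟩
  have hcov : ⋃ i, closure (A i) = Set.univ := by
    refine Set.eq_univ_of_forall fun x => ?_
    obtain ⟨i, g, hg⟩ := hJ x
    obtain ⟨n, hn⟩ := exists_nat_ge (max ‖x‖ ‖g‖)
    exact Set.mem_iUnion.2 ⟨(i, n), subset_closure
      ((hmem _ _).2 ⟨(le_max_left _ _).trans hn, g, hg, (le_max_right _ _).trans hn⟩)⟩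
  obtain ⟨i, hi⟩ := nonempty_interior_of_iUnion_of_closed (fun i => isClosed_closure) hcov
  have h0 := zero_mem_interior_of_convex_of_neg (hconv i).closure (fun x hx => by
    have : -x ∈ closure (-A i) := by rwa [← neg_closure, Set.neg_mem_neg]
    refine closure_mono (fun y hy => ?_) this
    simpa using hneg i _ (Set.mem_neg.1 hy)) hi
  obtain ⟨δ, hδ, hball⟩ := Metric.mem_nhds_iff.1 (mem_interior_iff_mem_nhds.1 h0)
  -- A ball inside the closure of `A i` lies in `A i` plus half the ball, and σ-convexity removes
  -- the closure.
  have hD : Metric.ball (0 : F) δ ⊆ (2 : ℝ) • A i := by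
    refine (hσ i).subset_two_smul (NormedSpace.isVonNBounded_ball ℝ F δ) fun d hd => ?_
    obtain ⟨a, ha, hda⟩ := Metric.mem_closure_iff.1 (hball hd) (δ / 2) (by positivity)
    refine ⟨a, ha, d - a, ⟨(2 : ℝ) • (d - a), ?_, ?_⟩, add_sub_cancel _ _⟩
    · rw [dist_eq_norm] at hda
      rw [mem_ball_zero_iff, norm_smul, Real.norm_ofNat]
      linarith
    · simp [smul_smul]
  -- A nonzero x is scaled to norm δ/2, and the ball lies in 2 A, whence 4 i.2 / δ; the summand 1
  -- keeps the constant positive.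
  refine ⟨i.1, 4 * (i.2 + 1) / δ, by positivity, fun x => ?_⟩
  rcases eq_or_ne x 0 with rfl | hx
  · exact ⟨0, by simp, by simp⟩
  have hx' : 0 < ‖x‖ := norm_pos_iff.2 hx
  set c : ℝ := δ / (2 * ‖x‖) with hc
  have hc0 : 0 < c := by positivity
  have hcx : c • x ∈ Metric.ball (0 : F) δ := by
    rw [mem_ball_zero_iff, norm_smul, Real.norm_of_nonneg hc0.le, hc]
    field_simp
    linarith
  obtain ⟨a, ha, hac⟩ := hD hcx
  obtain ⟨-, g, hg, hgn⟩ := (hmem _ _).1 ha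
  have hxa : x = (2 / c) • a := by
    rw [div_eq_inv_mul, mul_smul, show (2 : ℝ) • a = c • x from hac, inv_smul_smul₀ hc0.ne']
  refine ⟨(2 / c) • g, ?_, ?_⟩
  · have h1 : Ji i.1 ((2 / c) • g) = (2 / c) • Ji i.1 g :=
      ((Ji i.1).restrictScalars ℝ).map_smul _ _
    have h2 : J ((2 / c) • a) = (2 / c) • J a := (J.restrictScalars ℝ).map_smul _ _
    rw [h1, hg, ← h2, ← hxa]
  · rw [norm_smul, Real.norm_of_nonneg (by positivity), hc]
    calc 2 / (δ / (2 * ‖x‖)) * ‖g‖ ≤ 2 / (δ / (2 * ‖x‖)) * (i.2 + 1) := by gcongr; linarith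
      _ = 4 * (i.2 + 1) / δ * ‖x‖ := by field_simp; norm_num

/-- Lifts g of J x are unique up to the kernel of J', where T vanishes; so T g depends on x alone,
and bounded lifts give the norm estimate. -/
theorem exists_descend {G H : Type*} [NormedAddCommGroup G] [NormedSpace ℂ G]
    [NormedAddCommGroup H] [NormedSpace ℂ H] {J : F →ₗ[ℂ] L} {J' : G →ₗ[ℂ] L} {C : ℝ} (hC : 0 ≤ C)
    (h : ∀ x, ∃ g, J' g = J x ∧ ‖g‖ ≤ C * ‖x‖) (T : G →L[ℂ] H) (hT : ∀ g, J' g = 0 → T g = 0) :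
    ∃ τ : F →L[ℂ] H, ‖τ‖ ≤ C * ‖T‖ ∧ ∀ x g, J' g = J x → τ x = T g := by
  choose s hs hsn using h
  have key : ∀ x g, J' g = J x → T (s x) = T g := fun x g hg => by
    rw [← sub_eq_zero, ← map_sub]
    exact hT _ (by rw [map_sub, hs, hg, sub_self])
  let τ : F →ₗ[ℂ] H :=
    { toFun := fun x => T (s x)
      map_add' := fun x y => by
        rw [key (x + y) (s x + s y) (by rw [map_add, map_add, hs, hs]), map_add]
      map_smul' := fun c x => by
        rw [key (c • x) (c • s x) (by rw [map_smul, map_smul, hs]), map_smul, RingHom.id_apply] }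
  refine ⟨τ.mkContinuous (C * ‖T‖) fun x => ?_, LinearMap.mkContinuous_norm_le _ (by positivity) _,
    key⟩
  calc ‖T (s x)‖ ≤ ‖T‖ * ‖s x‖ := T.le_opNorm _
    _ ≤ ‖T‖ * (C * ‖x‖) := by gcongr; exact hsn x
    _ = C * ‖T‖ * ‖x‖ := by ring

end Factorization

/-! ### Continuity and regularity of spectra -/

namespace BanachSpectrum

variable {X : Type*} [AddCommGroup X] [Module ℂ X]

theorem incl_eq (𝒳 : BanachSpectrum X) {n : ℕ} {x y : 𝒳.step n}
    (h : 𝒳.toLim n x = 𝒳.toLim n y) : x = y := 𝒳.toLim_injective n h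

theorem incl_incl (𝒳 : BanachSpectrum X) {n m k : ℕ} (h : n ≤ m) (h' : m ≤ k) (x : 𝒳.step n) :
    𝒳.incl h' (𝒳.incl h x) = 𝒳.incl (h.trans h') x :=
  𝒳.incl_eq (by simp only [toLim_incl])

theorem incl_refl (𝒳 : BanachSpectrum X) (n : ℕ) (x : 𝒳.step n) : 𝒳.incl (le_refl n) x = x :=
  𝒳.incl_eq (by simp only [toLim_incl])

theorem incl_injective (𝒳 : BanachSpectrum X) {n m : ℕ} (h : n ≤ m) :
    Function.Injective (𝒳.incl h) := fun x y hxy =>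
  𝒳.incl_eq (by rw [← 𝒳.toLim_incl h, hxy, 𝒳.toLim_incl h])

variable [TopologicalSpace X]

/-- The steps of `𝒳` are continuously included in `X` and exhaust `X`. -/
structure Covers (𝒳 : BanachSpectrum X) : Prop where
  continuous : ∀ n, Continuous (𝒳.toLim n)
  exhausts : ∀ x : X, ∃ n e, 𝒳.toLim n e = x

theorem IsLimit.covers {𝒳 : BanachSpectrum X} (h : 𝒳.IsLimit) : 𝒳.Covers := by
  refine ⟨fun n => ?_, h.1⟩
  have := 𝒳.isLeast_limTopology.1.2.2.2 n
  rwa [← h.2] at this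

/-- The topology induced by `g` is one of those over which the inductive limit topology is the
finest. -/
theorem IsLimit.continuous_of {𝒳 : BanachSpectrum X} (h : 𝒳.IsLimit) {G : Type*} [AddCommGroup G]
    [Module ℂ G] [τ : TopologicalSpace G] [IsTopologicalAddGroup G] [ContinuousSMul ℂ G]
    [LocallyConvexSpace ℝ G] (g : X →ₗ[ℂ] G) (hg : ∀ n, Continuous fun x => g (𝒳.toLim n x)) :
    Continuous g := by
  rw [continuous_iff_le_induced, h.2]
  refine sInf_le ⟨topologicalAddGroup_induced g, continuousSMul_induced g, ?_,
    fun n => continuous_induced_rng.2 (hg n)⟩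
  exact LocallyConvexSpace.induced (g.restrictScalars ℝ)

/-- The inclusion of the step as a continuous linear map. -/
def Covers.toLimL {𝒳 : BanachSpectrum X} (h : 𝒳.Covers) (n : ℕ) : 𝒳.step n →L[ℂ] X :=
  ⟨𝒳.toLim n, h.continuous n⟩

@[simp] theorem Covers.toLimL_apply {𝒳 : BanachSpectrum X} (h : 𝒳.Covers) (n : ℕ)
    (x : 𝒳.step n) : h.toLimL n x = 𝒳.toLim n x := rfl

/-- A continuous linear map from a Banach space factors through a step. -/
theorem Covers.exists_lift {𝒳 : BanachSpectrum X} (h : 𝒳.Covers) [T2Space X]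
    [IsTopologicalAddGroup X] [ContinuousSMul ℂ X] {F : Type*} [NormedAddCommGroup F]
    [NormedSpace ℂ F] [CompleteSpace F] (J : F →L[ℂ] X) :
    ∃ n, ∃ f : F →L[ℂ] 𝒳.step n, ∀ x, 𝒳.toLim n (f x) = J x := by
  obtain ⟨n, C, hC, hn⟩ := exists_factor_bound J h.toLimL fun x => h.exhausts (J x)
  obtain ⟨τ, -, hτ⟩ := exists_descend (J := J.toLinearMap) (J' := 𝒳.toLim n) hC.le hn
    (ContinuousLinearMap.id ℂ _) fun g hg => 𝒳.toLim_injective n (hg.trans (map_zero _).symm)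
  refine ⟨n, τ, fun x => ?_⟩
  obtain ⟨g, hg, -⟩ := hn x
  rw [hτ x g hg]
  exact hg

/-- A spectrum such that every bounded set of `X` is contained in and bounded in some step. -/
structure Regular (𝒳 : BanachSpectrum X) : Prop extends 𝒳.Covers where
  exists_step : ∀ D : Set X, Bornology.IsVonNBounded ℂ D →
    ∃ n, ∃ R > (0 : ℝ), ∀ x ∈ D, ∃ e, 𝒳.toLim n e = x ∧ ‖e‖ ≤ R

end BanachSpectrum

/-! ### The Banach space spanned by a Banach disk -/

/-- The linear span of `D`, without the topology induced by the ambient space. -/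
structure DiskSpan {E : Type*} [AddCommGroup E] [Module ℂ E] (D : Set E) where
  val : E
  mem : val ∈ Submodule.span ℂ D

namespace DiskSpan

variable {E : Type*} [AddCommGroup E] [Module ℂ E] {D : Set E}

/-- The identification of `DiskSpan D` with the span of `D`. -/
def equivSpan (D : Set E) : DiskSpan D ≃ Submodule.span ℂ D where
  toFun x := ⟨x.val, x.mem⟩
  invFun x := ⟨x.1, x.2⟩

instance : AddCommGroup (DiskSpan D) := (equivSpan D).addCommGroup

instance : Module ℂ (DiskSpan D) := (equivSpan D).module ℂ

/-- The inclusion of the span. -/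
def subtype (D : Set E) : DiskSpan D →ₗ[ℂ] E where
  toFun x := x.val
  map_add' _ _ := rfl
  map_smul' _ _ := rfl

theorem subtype_injective : Function.Injective (subtype D) := fun x y h => by
  cases x
  cases y
  congr

theorem gauge_subtype (x : DiskSpan D) : gauge (subtype D ⁻¹' D) x = gauge D (subtype D x) := by
  unfold gauge
  congr 1
  ext r
  simp only [Set.mem_ofPred_eq]
  refine and_congr_right fun hr => ?_
  rw [Set.mem_smul_set_iff_inv_smul_mem₀ hr.ne', Set.mem_smul_set_iff_inv_smul_mem₀ hr.ne']
  rfl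

end DiskSpan

namespace IsBanachDisk

variable {E : Type*} [AddCommGroup E] [Module ℂ E] [TopologicalSpace E] {D : Set E}

/-- The condition 0 ∈ D only excludes the empty set, which also satisfies the definition of a Banach
disk. -/
theorem exists_mem_smul (hD : IsBanachDisk D) (h0 : (0 : E) ∈ D) {x : E}
    (hx : x ∈ Submodule.span ℂ D) : ∃ r > (0 : ℝ), x ∈ r • D := by
  induction hx using Submodule.span_induction with
  | mem x hx => exact ⟨1, one_pos, by rwa [one_smul]⟩
  | zero => exact ⟨1, one_pos, by rwa [one_smul]⟩
  | add x y _ _ hx hy =>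
    obtain ⟨r, hr, hx⟩ := hx
    obtain ⟨s, hs, hy⟩ := hy
    refine ⟨r + s, add_pos hr hs, ?_⟩
    rw [hD.2.1.add_smul hr.le hs.le]
    exact Set.add_mem_add hx hy
  | smul c x _ hx =>
    obtain ⟨r, hr, d, hd, rfl⟩ := hx
    have hc : 0 < ‖c‖ + 1 := by positivity
    refine ⟨(‖c‖ + 1) * r, by positivity, (c / ((‖c‖ + 1 : ℝ) : ℂ)) • d,
      hD.1.smul_mem ?_ hd, ?_⟩
    · rw [norm_div, Complex.norm_of_nonneg hc.le]
      exact (div_le_one hc).2 (by linarith)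
    · simp only [← Complex.coe_smul, smul_smul]
      congr 1
      push_cast
      have : ((‖c‖ : ℂ) + 1) ≠ 0 := by exact_mod_cast hc.ne'
      field_simp

theorem balanced_preimage (hD : IsBanachDisk D) : Balanced ℂ (DiskSpan.subtype D ⁻¹' D) := by
  rintro c hc _ ⟨x, hx, rfl⟩
  exact hD.1.smul_mem hc hx

theorem convex_preimage (hD : IsBanachDisk D) : Convex ℝ (DiskSpan.subtype D ⁻¹' D) :=
  hD.2.1.linear_preimage ((DiskSpan.subtype D).restrictScalars ℝ)

theorem absorbent_preimage (hD : IsBanachDisk D) (h0 : (0 : E) ∈ D) :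
    Absorbent ℝ (DiskSpan.subtype D ⁻¹' D) := by
  intro x
  obtain ⟨r, hr, d, hd, hx⟩ := hD.exists_mem_smul h0 x.mem
  rw [absorbs_iff_norm]
  refine ⟨r, fun c hc => ?_⟩
  have hc0 : c ≠ 0 := by
    rintro rfl
    rw [norm_zero] at hc
    linarith
  rw [Set.singleton_subset_iff, Set.mem_smul_set_iff_inv_smul_mem₀ hc0, Set.mem_preimage]
  have h1 : DiskSpan.subtype D (c⁻¹ • x) = ((c⁻¹ * r : ℝ) : ℂ) • d := by
    rw [Complex.coe_smul, mul_smul, show r • d = DiskSpan.subtype D x from hx]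
    exact LinearMap.map_smul_of_tower _ _ _
  rw [h1]
  refine hD.1.smul_mem ?_ hd
  rw [Complex.norm_real, norm_mul, norm_inv, Real.norm_of_nonneg hr.le, inv_mul_le_iff₀ (by positivity),
    mul_one]
  exact hc

variable (hD : IsBanachDisk D) (h0 : (0 : E) ∈ D)

/-- The Minkowski functional of a Banach disk as a seminorm on its span. -/
def seminorm : Seminorm ℂ (DiskSpan D) :=
  gaugeSeminorm hD.balanced_preimage hD.convex_preimage (hD.absorbent_preimage h0)

theorem seminorm_apply (x : DiskSpan D) : hD.seminorm h0 x = gauge D (DiskSpan.subtype D x) :=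
  DiskSpan.gauge_subtype x

theorem mem_smul_of_seminorm_lt {x : DiskSpan D} {r : ℝ} (h : hD.seminorm h0 x < r) :
    ∃ d ∈ D, DiskSpan.subtype D x = r • d := by
  obtain ⟨b, hb0, hbr, d, hd, hx⟩ := exists_lt_of_gauge_lt (hD.absorbent_preimage h0) h
  refine ⟨(b / r) • DiskSpan.subtype D d, ?_, ?_⟩
  · rw [← Complex.coe_smul]
    refine hD.1.smul_mem ?_ hd
    have hr : 0 < r := hb0.trans hbr
    rw [Complex.norm_of_nonneg (by positivity)]
    exact (div_le_one hr).2 hbr.le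
  · rw [smul_smul, mul_div_cancel₀ _ (hb0.trans hbr).ne', ← hx]
    exact LinearMap.map_smul_of_tower _ _ _

theorem seminorm_le_one {x : DiskSpan D} (h : DiskSpan.subtype D x ∈ D) :
    hD.seminorm h0 x ≤ 1 :=
  gauge_le_one_of_mem h

/-- Such an x lies in D / (n + 1) for all n, and a bounded set shrinks to 0 in a Hausdorff space. -/
theorem eq_zero_of_seminorm_eq_zero [T2Space E] {x : DiskSpan D} (h : hD.seminorm h0 x = 0) :
    x = 0 := by
  have h1 : ∀ n : ℕ, ∃ d ∈ D, DiskSpan.subtype D x = (1 / ((n : ℝ) + 1)) • d := fun n =>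
    hD.mem_smul_of_seminorm_lt h0 (by rw [h]; positivity)
  choose d hd hx using h1
  have h2 : Filter.Tendsto (fun n : ℕ => (((1 / ((n : ℝ) + 1) : ℝ)) : ℂ)) Filter.atTop (𝓝 0) := by
    have := (Complex.continuous_ofReal.tendsto 0).comp
      (tendsto_one_div_add_atTop_nhds_zero_nat (𝕜 := ℝ))
    rw [Complex.ofReal_zero] at this
    exact this
  have h3 := hD.2.2.1.smul_tendsto_zero (Filter.Eventually.of_forall hd) h2
  refine DiskSpan.subtype_injective ?_
  rw [map_zero]
  refine tendsto_nhds_unique ((tendsto_const_nhds (x := DiskSpan.subtype D x)).congr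
    fun n => ?_) h3
  rw [hx n, Pi.smul_apply', Complex.coe_smul]

/-- The norm on the span of a Banach disk. -/
abbrev normedAddCommGroup [T2Space E] : NormedAddCommGroup (DiskSpan D) :=
  AddGroupNorm.toNormedAddCommGroup
    { (hD.seminorm h0).toAddGroupSeminorm with
      eq_zero_of_map_eq_zero' := fun _ h => hD.eq_zero_of_seminorm_eq_zero h0 h }

/-- The span of a Banach disk as a normed space. -/
abbrev normedSpace [T2Space E] :
    letI := hD.normedAddCommGroup h0
    NormedSpace ℂ (DiskSpan D) :=
  letI := hD.normedAddCommGroup h0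
  { (inferInstance : Module ℂ (DiskSpan D)) with
    norm_smul_le := fun a b => (map_smul_eq_mul (hD.seminorm h0) a b).le }

theorem completeSpace [T2Space E] :
    letI := hD.normedAddCommGroup h0
    CompleteSpace (DiskSpan D) := by
  let _ := hD.normedAddCommGroup h0
  have hnorm : ∀ x : DiskSpan D, ‖x‖ = gauge D (DiskSpan.subtype D x) := hD.seminorm_apply h0
  refine Metric.complete_of_cauchySeq_tendsto fun u hu => ?_
  obtain ⟨x, hx, hlim⟩ := hD.2.2.2 (fun p => DiskSpan.subtype D (u p)) (fun p => (u p).mem)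
    fun ε hε => by
      obtain ⟨p₀, h⟩ := Metric.cauchySeq_iff.1 hu ε hε
      refine ⟨p₀, fun p hp q hq => ?_⟩
      have := h p hp q hq
      rw [dist_eq_norm, hnorm] at this
      exact this
  refine ⟨⟨x, hx⟩, tendsto_iff_norm_sub_tendsto_zero.2 (hlim.congr fun p => ?_)⟩
  rw [hnorm]
  rfl

end IsBanachDisk

/-! ### Regular spectra of locally complete spaces -/

section DiskSpectra

variable {E : Type u} [AddCommGroup E] [Module ℂ E] [TopologicalSpace E] [T2Space E]

/-- The spectrum of the spans of an increasing sequence of Banach disks. -/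
def bddDiskSpectrum (D : ℕ → Set E) (hD : ∀ n, IsBanachDisk (D n)) (h0 : ∀ n, (0 : E) ∈ D n)
    (hmono : Monotone D) : BanachSpectrum E where
  step n := DiskSpan (D n)
  normedAddCommGroup n := (hD n).normedAddCommGroup (h0 n)
  normedSpace n := (hD n).normedSpace (h0 n)
  completeSpace n := (hD n).completeSpace (h0 n)
  toLim n := DiskSpan.subtype (D n)
  toLim_injective n := DiskSpan.subtype_injective
  incl {n m} h :=
    letI := (hD n).normedAddCommGroup (h0 n)
    letI := (hD n).normedSpace (h0 n)
    letI := (hD m).normedAddCommGroup (h0 m)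
    letI := (hD m).normedSpace (h0 m)
    LinearMap.mkContinuous
      { toFun := fun x => ⟨x.val, Submodule.span_mono (hmono h) x.mem⟩
        map_add' := fun _ _ => rfl
        map_smul' := fun _ _ => rfl } 1 fun x => by
      rw [one_mul]
      refine le_of_forall_gt_imp_ge_of_dense fun r hr => ?_
      obtain ⟨d, hd, hx⟩ := (hD n).mem_smul_of_seminorm_lt (h0 n) hr
      refine ((hD m).seminorm_apply (h0 m) _).le.trans (gauge_le_of_mem
        ((apply_nonneg ((hD n).seminorm (h0 n)) x).trans hr.le) ⟨d, hmono h hd, hx.symm⟩)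
  toLim_incl _ _ := rfl

variable {D : ℕ → Set E} {hD : ∀ n, IsBanachDisk (D n)} {h0 : ∀ n, (0 : E) ∈ D n}
  {hmono : Monotone D}

theorem bddDiskSpectrum_exists {n : ℕ} {x : E} (hx : x ∈ D n) :
    ∃ e, (bddDiskSpectrum D hD h0 hmono).toLim n e = x ∧ ‖e‖ ≤ 1 :=
  ⟨(⟨x, Submodule.subset_span hx⟩ : DiskSpan (D n)), rfl,
    (hD n).seminorm_le_one (h0 n) (x := ⟨x, Submodule.subset_span hx⟩) hx⟩

theorem bddDiskSpectrum_continuous [IsTopologicalAddGroup E] [ContinuousSMul ℂ E] (n : ℕ) :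
    Continuous ((bddDiskSpectrum D hD h0 hmono).toLim n) := by
  refine (LinearMap.clmOfExistsBoundedImage ((bddDiskSpectrum D hD h0 hmono).toLim n)
    ⟨Metric.ball 0 1, Metric.ball_mem_nhds _ one_pos, (hD n).2.2.1.subset ?_⟩).continuous
  rintro _ ⟨x, hx, rfl⟩
  rw [mem_ball_zero_iff] at hx
  obtain ⟨d, hd, hxd⟩ := (hD n).mem_smul_of_seminorm_lt (h0 n) (x := x) hx
  rw [one_smul] at hxd
  exact hxd.symm ▸ hd

theorem IsLocallyComplete.exists_disk (hE : IsLocallyComplete E) [IsTopologicalAddGroup E]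
    [ContinuousSMul ℂ E] {S : Set E} (hS : Bornology.IsVonNBounded ℂ S) :
    ∃ D, IsBanachDisk D ∧ (0 : E) ∈ D ∧ S ⊆ D := by
  obtain ⟨D, hD, h⟩ := hE (insert 0 S) (hS.insert 0)
  exact ⟨D, hD, h (Set.mem_insert _ _), (Set.subset_insert _ _).trans h⟩

variable [IsTopologicalAddGroup E] [ContinuousSMul ℂ E]

/-- Banach disks D_{n+1} ⊇ D_n ∪ B_n are chosen recursively; their spans exhaust E, and every
bounded set lies in one of the disks. -/
theorem IsLocallyComplete.exists_regular (hE : IsLocallyComplete E) {B : ℕ → Set E}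
    (hB : IsFundamentalBoundedSeq B) : ∃ 𝓔 : BanachSpectrum E, 𝓔.Regular := by
  have hstep : ∀ (n : ℕ) (D : {D : Set E // IsBanachDisk D ∧ (0 : E) ∈ D}),
      ∃ D' : {D : Set E // IsBanachDisk D ∧ (0 : E) ∈ D}, D.1 ∪ B n ⊆ D'.1 := fun n D => by
    obtain ⟨D', h1, h2, h3⟩ := hE.exists_disk (D.2.1.2.2.1.union (hB.2.1 n))
    exact ⟨⟨D', h1, h2⟩, h3⟩
  choose f hf using hstep
  obtain ⟨D₀, h1, h2, -⟩ := hE.exists_disk (Bornology.isVonNBounded_empty ℂ E)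
  let F : ℕ → {D : Set E // IsBanachDisk D ∧ (0 : E) ∈ D} := fun n =>
    Nat.rec ⟨D₀, h1, h2⟩ (fun n D => f n D) n
  have hmono : Monotone fun n => (F n).1 :=
    monotone_nat_of_le_succ fun n => Set.subset_union_left.trans (hf n (F n))
  have hBF : ∀ n, B n ⊆ (F (n + 1)).1 := fun n => Set.subset_union_right.trans (hf n (F n))
  have hreg : ∀ S : Set E, Bornology.IsVonNBounded ℂ S → ∃ n, ∃ R > (0 : ℝ), ∀ x ∈ S, ∃ e,
      (bddDiskSpectrum (fun n => (F n).1) (fun n => (F n).2.1) (fun n => (F n).2.2)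
        hmono).toLim n e = x ∧ ‖e‖ ≤ R := fun S hS => by
    obtain ⟨N, hN⟩ := hB.2.2 S hS
    exact ⟨N + 1, 1, one_pos, fun x hx => bddDiskSpectrum_exists (hBF N (hN hx))⟩
  refine ⟨bddDiskSpectrum (fun n => (F n).1) (fun n => (F n).2.1) (fun n => (F n).2.2) hmono,
    ⟨bddDiskSpectrum_continuous, fun x => ?_⟩, hreg⟩
  obtain ⟨n, R, -, h⟩ := hreg {x} (Bornology.isVonNBounded_singleton x)
  obtain ⟨e, he, -⟩ := h x rfl
  exact ⟨n, e, he⟩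

/-- A bounded set lies in a Banach disk, whose span is a Banach space continuously included in E. By
the factorization theorem this inclusion passes through one step. -/
theorem BanachSpectrum.Covers.regular {𝓔 : BanachSpectrum E} (h : 𝓔.Covers)
    (hE : IsLocallyComplete E) : 𝓔.Regular := by
  refine ⟨h, fun S hS => ?_⟩
  obtain ⟨D, hD, h0, hSD⟩ := hE.exists_disk hS
  let 𝓓 := bddDiskSpectrum (fun _ => D) (fun _ => hD) (fun _ => h0) monotone_const
  obtain ⟨n, f, hf⟩ := h.exists_lift
    (⟨𝓓.toLim 0, bddDiskSpectrum_continuous 0⟩ : 𝓓.step 0 →L[ℂ] E)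
  refine ⟨n, ‖f‖ + 1, by positivity, fun x hx => ?_⟩
  obtain ⟨e, he, hen⟩ := bddDiskSpectrum_exists (D := fun _ => D) (hD := fun _ => hD)
    (h0 := fun _ => h0) (hmono := monotone_const) (n := 0) (hSD hx)
  refine ⟨f e, (hf e).trans he, (f.le_opNorm e).trans ?_⟩
  nlinarith [norm_nonneg f]

end DiskSpectra

/-! ### The condition (S) for a pair of spectra -/

section PairS

variable {E : Type*} [AddCommGroup E] [Module ℂ E] {Z : Type*} [AddCommGroup Z] [Module ℂ Z]

/-- The condition (S) in terms of elements of the steps of two spectra. -/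
def PairS (𝓔 : BanachSpectrum E) (𝒵 : BanachSpectrum Z) : Prop :=
  ∀ n, ∃ m, ∃ hnm : n ≤ m, ∀ k, ∀ hmk : m ≤ k, ∃ N, ∀ M ≥ N, ∀ ε > (0 : ℝ), ∃ K ≥ M, ∃ C > (0 : ℝ),
    ∀ (z : 𝒵.step n) (b : 𝓔.step M), ∃ (u : 𝓔.step K) (v : 𝓔.step N),
      ‖𝒵.incl hnm z‖ • 𝓔.toLim M b = 𝓔.toLim K u + 𝓔.toLim N v ∧
      ‖u‖ ≤ C * ‖𝒵.incl (hnm.trans hmk) z‖ * ‖b‖ ∧ ‖v‖ ≤ ε * ‖z‖ * ‖b‖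

theorem BanachSpectrum.toLim_real_smul (𝓔 : BanachSpectrum E) (n : ℕ) (r : ℝ) (x : 𝓔.step n) :
    𝓔.toLim n (r • x) = r • 𝓔.toLim n x :=
  LinearMap.map_smul_of_tower _ _ _

theorem BanachSpectrum.Regular.exists_ball [TopologicalSpace E] {𝓔 : BanachSpectrum E}
    (h𝓔 : 𝓔.Regular) {D : Set E} (hD : Bornology.IsVonNBounded ℂ D) (N₀ : ℕ) :
    ∃ N ≥ N₀, ∃ R > (0 : ℝ), ∀ x ∈ D, ∃ e, 𝓔.toLim N e = x ∧ ‖e‖ ≤ R := by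
  obtain ⟨n, R, hR, h⟩ := h𝓔.exists_step D hD
  refine ⟨max n N₀, le_max_right _ _, (‖𝓔.incl (le_max_left n N₀)‖ + 1) * R, by positivity,
    fun x hx => ?_⟩
  obtain ⟨e, he, hen⟩ := h x hx
  refine ⟨𝓔.incl (le_max_left _ _) e, by rw [𝓔.toLim_incl, he],
    (ContinuousLinearMap.le_opNorm _ _).trans ?_⟩
  gcongr
  linarith

theorem BanachSpectrum.Covers.isVonNBounded [TopologicalSpace E] {𝓔 : BanachSpectrum E}
    (h𝓔 : 𝓔.Covers) (N : ℕ) (R : ℝ) :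
    Bornology.IsVonNBounded ℂ (𝓔.toLim N '' Metric.closedBall 0 R) :=
  (NormedSpace.isVonNBounded_closedBall ℂ (𝓔.step N) R).image (h𝓔.toLimL N)

theorem IsFundamentalBoundedSeq.exists_ge [TopologicalSpace E] {B : ℕ → Set E}
    (hB : IsFundamentalBoundedSeq B) {D : Set E} (hD : Bornology.IsVonNBounded ℂ D) (N₀ : ℕ) :
    ∃ N ≥ N₀, D ⊆ B N := by
  obtain ⟨N, hN⟩ := hB.2.2 D hD
  exact ⟨max N N₀, le_max_right _ _, hN.trans (hB.1 (le_max_left _ _))⟩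

/-- The sets `B N` and the balls of the steps of a regular spectrum are contained in multiples of
each other. The quantifiers of (S) tolerate the change of indices, and the constants are absorbed in
C and in the arbitrary ε. -/
theorem conditionS_of_pairS [TopologicalSpace E] {𝓔 : BanachSpectrum E} (h𝓔 : 𝓔.Regular)
    {B : ℕ → Set E} (hB : IsFundamentalBoundedSeq B) {𝒵 : BanachSpectrum Z} (h : PairS 𝓔 𝒵) :
    ConditionS B 𝒵 := by
  intro n
  obtain ⟨m, hnm, h⟩ := h n
  refine ⟨m, hnm, fun k hmk => ?_⟩
  obtain ⟨N', h⟩ := h k hmk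
  obtain ⟨N, -, hN⟩ := hB.exists_ge (h𝓔.isVonNBounded N' 1) 0
  refine ⟨N, fun M hM ε hε => ?_⟩
  obtain ⟨M', hM', R, hR, hBM⟩ := h𝓔.exists_ball (hB.2.1 M) N'
  obtain ⟨K', hK', C', hC', h⟩ := h M' hM' (ε / R) (by positivity)
  obtain ⟨K, hK, hBK⟩ := hB.exists_ge (h𝓔.isVonNBounded K' 1) M
  refine ⟨K, hK, C' * R, by positivity, fun z => ?_⟩
  have hmem : ∀ (P : ℕ) (x : 𝓔.step P) (c : ℝ) (S : Set E), 0 < c → ‖x‖ ≤ c →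
      𝓔.toLim P '' Metric.closedBall 0 1 ⊆ S → 𝓔.toLim P x ∈ c • S := by
    intro P x c S hc hx hS
    refine ⟨𝓔.toLim P (c⁻¹ • x), hS ⟨_, ?_, rfl⟩, ?_⟩
    · rw [mem_closedBall_zero_iff, norm_smul, Real.norm_of_nonneg (by positivity),
        inv_mul_le_iff₀ hc, mul_one]
      exact hx
    · dsimp only
      rw [← 𝓔.toLim_real_smul, smul_inv_smul₀ hc.ne']
  rintro _ ⟨b, hb, rfl⟩
  obtain ⟨b, rfl, hbR⟩ := hBM b hb
  rcases eq_or_ne z 0 with rfl | hz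
  · have h0 : ∀ P, (0 : E) ∈ 𝓔.toLim P '' Metric.closedBall 0 1 := fun P =>
      ⟨0, by simp, map_zero _⟩
    exact ⟨0, ⟨0, hBK (h0 _), by simp⟩, 0, ⟨0, hN (h0 _), by simp⟩, by simp⟩
  obtain ⟨u, v, huv, hu, hv⟩ := h z b
  have hz0 : 0 < ‖z‖ := norm_pos_iff.2 hz
  have hzk : 0 < ‖𝒵.incl (hnm.trans hmk) z‖ :=
    norm_pos_iff.2 fun h0 => hz (𝒵.incl_injective _ (h0.trans (map_zero _).symm))
  refine ⟨_, hmem K' u _ _ (by positivity) (hu.trans ?_) hBK, _,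
    hmem N' v _ _ (by positivity) (hv.trans ?_) hN, huv.symm⟩
  · calc C' * ‖𝒵.incl (hnm.trans hmk) z‖ * ‖b‖ ≤ C' * ‖𝒵.incl (hnm.trans hmk) z‖ * R := by gcongr
      _ = _ := by ring
  · calc ε / R * ‖z‖ * ‖b‖ ≤ ε / R * ‖z‖ * R := by gcongr
      _ = _ := by field_simp

theorem pairS_of_conditionS [TopologicalSpace E] {𝓔 : BanachSpectrum E} (h𝓔 : 𝓔.Regular)
    {B : ℕ → Set E} (hB : IsFundamentalBoundedSeq B) {𝒵 : BanachSpectrum Z}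
    (h : ConditionS B 𝒵) : PairS 𝓔 𝒵 := by
  intro n
  obtain ⟨m, hnm, h⟩ := h n
  refine ⟨m, hnm, fun k hmk => ?_⟩
  obtain ⟨N', h⟩ := h k hmk
  obtain ⟨N, -, R, hR, hN⟩ := h𝓔.exists_ball (hB.2.1 N') 0
  refine ⟨N, fun M hM ε hε => ?_⟩
  obtain ⟨M', hM', hBM⟩ := hB.exists_ge (h𝓔.isVonNBounded M 1) N'
  obtain ⟨K', hK', C', hC', h⟩ := h M' hM' (ε / R) (by positivity)
  obtain ⟨K, hK, R', hR', hBK⟩ := h𝓔.exists_ball (hB.2.1 K') M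
  refine ⟨K, hK, C' * R', by positivity, fun z b => ?_⟩
  rcases eq_or_ne b 0 with rfl | hb
  · exact ⟨0, 0, by simp, by simp, by simp⟩
  have hb0 : 0 < ‖b‖ := norm_pos_iff.2 hb
  have hbm : 𝓔.toLim M (‖b‖⁻¹ • b) ∈ B M' := hBM ⟨_, by
    rw [mem_closedBall_zero_iff, norm_smul, norm_inv, norm_norm, inv_mul_cancel₀ hb0.ne'], rfl⟩
  obtain ⟨_, ⟨x, hx, rfl⟩, _, ⟨y, hy, rfl⟩, hxy⟩ := h z ⟨_, hbm, rfl⟩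
  obtain ⟨x, rfl, hxR⟩ := hBK x hx
  obtain ⟨y, rfl, hyR⟩ := hN y hy
  refine ⟨(‖b‖ * (C' * ‖𝒵.incl (hnm.trans hmk) z‖)) • x, (‖b‖ * (ε / R * ‖z‖)) • y, ?_, ?_, ?_⟩
  · dsimp only at hxy
    rw [𝓔.toLim_real_smul, 𝓔.toLim_real_smul, mul_smul ‖b‖, mul_smul ‖b‖, ← smul_add, hxy,
      𝓔.toLim_real_smul, smul_comm ‖b‖, smul_inv_smul₀ hb0.ne']
  · rw [norm_smul, Real.norm_of_nonneg (by positivity)]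
    calc ‖b‖ * (C' * ‖𝒵.incl (hnm.trans hmk) z‖) * ‖x‖
        ≤ ‖b‖ * (C' * ‖𝒵.incl (hnm.trans hmk) z‖) * R' := by gcongr
      _ = _ := by ring
  · rw [norm_smul, Real.norm_of_nonneg (by positivity)]
    calc ‖b‖ * (ε / R * ‖z‖) * ‖y‖ ≤ ‖b‖ * (ε / R * ‖z‖) * R := by gcongr
      _ = _ := by field_simp

/-- Condition (S) does not depend on the spectrum of `Z`. -/
theorem PairS.congr [TopologicalSpace Z] [T2Space Z] [IsTopologicalAddGroup Z]
    [ContinuousSMul ℂ Z] {𝓔 : BanachSpectrum E} {𝒵 𝒵' : BanachSpectrum Z} (h𝒵 : 𝒵.Covers)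
    (h𝒵' : 𝒵'.Covers) (h : PairS 𝓔 𝒵) : PairS 𝓔 𝒵' := by
  intro n'
  obtain ⟨n, f, hf⟩ := h𝒵.exists_lift (h𝒵'.toLimL n')
  obtain ⟨m, hnm, h⟩ := h n
  obtain ⟨m₁, g, hg⟩ := h𝒵'.exists_lift (h𝒵.toLimL m)
  refine ⟨max n' m₁, le_max_left _ _, fun k' hk' => ?_⟩
  obtain ⟨k₁, p, hp⟩ := h𝒵.exists_lift (h𝒵'.toLimL k')
  obtain ⟨N, h⟩ := h (max k₁ m) (le_max_right _ _)
  refine ⟨N, fun M hM ε hε => ?_⟩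
  simp only [BanachSpectrum.Covers.toLimL_apply] at hf hg hp
  set g' := (𝒵'.incl (le_max_right n' m₁)).comp g with hg'
  set p' := (𝒵.incl (le_max_left k₁ m)).comp p with hp'
  have e1 : ∀ z, 𝒵'.incl (le_max_left n' m₁) z = g' (𝒵.incl hnm (f z)) := fun z =>
    𝒵'.incl_eq (by
      simp only [hg', ContinuousLinearMap.comp_apply, 𝒵'.toLim_incl, hg, 𝒵.toLim_incl, hf])
  have e2 : ∀ z, 𝒵.incl (hnm.trans (le_max_right k₁ m)) (f z) =
      p' (𝒵'.incl ((le_max_left n' m₁).trans hk') z) := fun z =>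
    𝒵.incl_eq (by
      simp only [hp', ContinuousLinearMap.comp_apply, 𝒵'.toLim_incl, hp, 𝒵.toLim_incl, hf])
  obtain ⟨K, hK, C, hC, h⟩ := h M hM (ε / ((‖g'‖ + 1) * (‖f‖ + 1))) (by positivity)
  refine ⟨K, hK, (‖g'‖ + 1) * C * (‖p'‖ + 1), by positivity, fun z b => ?_⟩
  obtain ⟨u, v, huv, hu, hv⟩ := h (f z) b
  rcases eq_or_ne z 0 with rfl | hz
  · exact ⟨0, 0, by simp, by simp, by simp⟩
  have hfz : f z ≠ 0 := fun h0 => hz (𝒵'.incl_eq (by rw [← hf, h0, map_zero, map_zero]))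
  have hmz : 0 < ‖𝒵.incl hnm (f z)‖ :=
    norm_pos_iff.2 fun h0 => hfz (𝒵.incl_injective _ (h0.trans (map_zero _).symm))
  -- Since the spectra interleave, the ratio of the two norms of z is bounded; multiplying the
  -- splitting by it replaces one norm on the left side by the other.
  set ρ := ‖𝒵'.incl (le_max_left n' m₁) z‖ / ‖𝒵.incl hnm (f z)‖ with hρ
  have hρ0 : 0 ≤ ρ := by positivity
  have hρ1 : ρ ≤ ‖g'‖ + 1 := by
    rw [hρ, div_le_iff₀ hmz, e1]
    exact (g'.le_opNorm _).trans (by gcongr; linarith)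
  refine ⟨ρ • u, ρ • v, ?_, ?_, ?_⟩
  · rw [𝓔.toLim_real_smul, 𝓔.toLim_real_smul, ← smul_add, ← huv, smul_smul, hρ,
      div_mul_cancel₀ _ hmz.ne']
  · rw [norm_smul, Real.norm_of_nonneg hρ0]
    have h2 : ‖𝒵.incl (hnm.trans (le_max_right k₁ m)) (f z)‖ ≤
        (‖p'‖ + 1) * ‖𝒵'.incl ((le_max_left n' m₁).trans hk') z‖ := by
      rw [e2]
      exact (p'.le_opNorm _).trans (by gcongr; linarith)
    calc ρ * ‖u‖ ≤ (‖g'‖ + 1) * (C * ((‖p'‖ + 1) *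
          ‖𝒵'.incl ((le_max_left n' m₁).trans hk') z‖) * ‖b‖) := by
          gcongr
          exact hu.trans (by gcongr)
      _ = _ := by ring
  · rw [norm_smul, Real.norm_of_nonneg hρ0]
    have h2 : ‖f z‖ ≤ (‖f‖ + 1) * ‖z‖ := (f.le_opNorm _).trans (by gcongr; linarith)
    calc ρ * ‖v‖ ≤ (‖g'‖ + 1) * (ε / ((‖g'‖ + 1) * (‖f‖ + 1)) * ((‖f‖ + 1) * ‖z‖) * ‖b‖) := by
          gcongr
          exact hv.trans (by gcongr)
      _ = _ := by field_simp

end PairS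

/-! ### The projective spectrum of the operators from the steps of `𝒵` to the steps of `𝓔` -/

theorem continuousSMul_real_of_complex (E : Type*) [AddCommGroup E] [Module ℂ E]
    [TopologicalSpace E] [ContinuousSMul ℂ E] : ContinuousSMul ℝ E :=
  ⟨by
    have : Continuous fun p : ℝ × E => (p.1 : ℂ) • p.2 :=
      (Complex.continuous_ofReal.comp continuous_fst).smul continuous_snd
    exact this⟩

namespace BanachSpectrum

section Weight

variable {X : Type*} [AddCommGroup X] [Module ℂ X] (𝒳 : BanachSpectrum X)

/-- Weights bounding the norms of the inclusion maps. -/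
def weight : ℕ → ℝ
  | 0 => 1
  | n + 1 => weight n * (1 + ‖𝒳.incl n.le_succ‖)

theorem weight_pos (n : ℕ) : 0 < 𝒳.weight n := by
  induction n with
  | zero => exact one_pos
  | succ n ih => exact mul_pos ih (by positivity)

theorem norm_incl_mul_weight_le {n m : ℕ} (h : n ≤ m) :
    ‖𝒳.incl h‖ * 𝒳.weight n ≤ 𝒳.weight m := by
  induction m, h using Nat.le_induction with
  | base =>
    have : ‖𝒳.incl (le_refl n)‖ ≤ 1 := ContinuousLinearMap.opNorm_le_bound _ zero_le_one
      fun x => by rw [𝒳.incl_refl, one_mul]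
    exact mul_le_of_le_one_left (𝒳.weight_pos n).le this
  | succ m h ih =>
    have : ‖𝒳.incl (h.trans m.le_succ)‖ ≤ ‖𝒳.incl m.le_succ‖ * ‖𝒳.incl h‖ := by
      have e : 𝒳.incl (h.trans m.le_succ) = (𝒳.incl m.le_succ).comp (𝒳.incl h) := by
        ext x
        exact (𝒳.incl_incl h _ x).symm
      rw [e]
      exact ContinuousLinearMap.opNorm_comp_le _ _
    calc ‖𝒳.incl (h.trans m.le_succ)‖ * 𝒳.weight n
        ≤ ‖𝒳.incl m.le_succ‖ * (‖𝒳.incl h‖ * 𝒳.weight n) := by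
          rw [← mul_assoc]
          exact mul_le_mul_of_nonneg_right this (𝒳.weight_pos n).le
      _ ≤ (1 + ‖𝒳.incl m.le_succ‖) * 𝒳.weight m := by
          have := 𝒳.weight_pos n
          exact mul_le_mul (by linarith) ih (by positivity) (by positivity)
      _ = 𝒳.weight (m + 1) := mul_comm _ _

end Weight

section Operators

variable {E : Type*} [AddCommGroup E] [Module ℂ E] [TopologicalSpace E] [IsTopologicalAddGroup E]
  [ContinuousSMul ℂ E] {Z : Type*} [AddCommGroup Z] [Module ℂ Z] {𝓔 : BanachSpectrum E}

/-- Operators `Z_n → E_N` as functions `Z_n → E`. -/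
def Covers.opMap (h𝓔 : 𝓔.Covers) (𝒵 : BanachSpectrum Z) (n N : ℕ) :
    (𝒵.step n →L[ℂ] 𝓔.step N) →L[ℂ] (𝒵.step n → E) :=
  ContinuousLinearMap.pi fun z =>
    (h𝓔.toLimL N).comp (ContinuousLinearMap.apply ℂ (𝓔.step N) z)

@[simp] theorem Covers.opMap_apply (h𝓔 : 𝓔.Covers) (𝒵 : BanachSpectrum Z) (n N : ℕ)
    (T : 𝒵.step n →L[ℂ] 𝓔.step N) (z : 𝒵.step n) : h𝓔.opMap 𝒵 n N T z = 𝓔.toLim N (T z) := rfl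

/-- Restriction of functions on `Z_m` to `Z_n`. -/
def restrictStep (E : Type*) [AddCommGroup E] [Module ℂ E] [TopologicalSpace E]
    (𝒵 : BanachSpectrum Z) {n m : ℕ} (h : n ≤ m) : (𝒵.step m → E) →L[ℝ] (𝒵.step n → E) :=
  ContinuousLinearMap.pi fun z => ContinuousLinearMap.proj (𝒵.incl h z)

@[simp] theorem restrictStep_apply (𝒵 : BanachSpectrum Z) {n m : ℕ} (h : n ≤ m)
    (f : 𝒵.step m → E) (z : 𝒵.step n) : restrictStep E 𝒵 h f z = f (𝒵.incl h z) := rfl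

/-- The projective spectrum of the operators from the steps of `𝒵` to the steps of `𝓔`. -/
def Covers.opSpectrum (h𝓔 : 𝓔.Covers) (𝒵 : BanachSpectrum Z) :
    DiskSpectrum fun n => 𝒵.step n → E where
  r h := restrictStep E 𝒵 h
  r_refl n x := by
    ext z
    simp [incl_refl]
  r_comp h h' x := by
    ext z
    simp [incl_incl]
  -- The weights absorb the norms of the inclusion maps, so that enlarging N and restricting to a
  -- smaller step map these balls into each other. The ambient space carries only pointwise
  -- convergence in E.
  B n N := (h𝓔.opMap 𝒵 n N).restrictScalars ℝ ''
    Metric.closedBall 0 (𝓔.weight N / 𝒵.weight n)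
  convex n N := (convex_closedBall _ _).linear_image
    ((h𝓔.opMap 𝒵 n N).restrictScalars ℝ).toLinearMap
  neg_mem := by
    rintro n N _ ⟨T, hT, rfl⟩
    exact ⟨-T, by simpa using hT, map_neg _ _⟩
  zero_mem n N := ⟨0, by
    have := 𝓔.weight_pos N
    have := 𝒵.weight_pos n
    rw [Metric.mem_closedBall, dist_self]
    positivity, map_zero _⟩
  sigmaConvex n N := (sigmaConvex_closedBall _).image _
  bounded n N := by
    have := continuousSMul_real_of_complex E
    exact (NormedSpace.isVonNBounded_closedBall ℝ _ _).image _
  mono := by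
    rintro n N M _ h ⟨T, hT, rfl⟩
    refine ⟨(𝓔.incl h).comp T, ?_, ?_⟩
    · rw [mem_closedBall_zero_iff] at hT ⊢
      have h1 := 𝓔.norm_incl_mul_weight_le h
      have h2 := 𝒵.weight_pos n
      calc ‖(𝓔.incl h).comp T‖ ≤ ‖𝓔.incl h‖ * ‖T‖ := ContinuousLinearMap.opNorm_comp_le _ _
        _ ≤ ‖𝓔.incl h‖ * (𝓔.weight N / 𝒵.weight n) := by gcongr
        _ = ‖𝓔.incl h‖ * 𝓔.weight N / 𝒵.weight n := by ring
        _ ≤ 𝓔.weight M / 𝒵.weight n := by gcongr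
    · ext z
      simp [𝓔.toLim_incl]
  maps := by
    rintro n m N _ h ⟨T, hT, rfl⟩
    refine ⟨T.comp (𝒵.incl h), ?_, ?_⟩
    · rw [mem_closedBall_zero_iff] at hT ⊢
      have h1 := 𝒵.norm_incl_mul_weight_le h
      have h2 := 𝒵.weight_pos n
      have h3 := 𝒵.weight_pos m
      have h4 := 𝓔.weight_pos N
      calc ‖T.comp (𝒵.incl h)‖ ≤ ‖T‖ * ‖𝒵.incl h‖ := ContinuousLinearMap.opNorm_comp_le _ _
        _ ≤ 𝓔.weight N / 𝒵.weight m * ‖𝒵.incl h‖ := by gcongr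
        _ = 𝓔.weight N / 𝒵.weight n * (‖𝒵.incl h‖ * 𝒵.weight n / 𝒵.weight m) := by field_simp
        _ ≤ 𝓔.weight N / 𝒵.weight n * 1 := by
          gcongr
          exact (div_le_one h3).2 h1
        _ = _ := mul_one _
    · ext z
      rfl

theorem Covers.mem_opSpectrum_B (h𝓔 : 𝓔.Covers) {𝒵 : BanachSpectrum Z} {n N : ℕ}
    {f : 𝒵.step n → E} : f ∈ (h𝓔.opSpectrum 𝒵).B n N ↔ ∃ T : 𝒵.step n →L[ℂ] 𝓔.step N,
      ‖T‖ ≤ 𝓔.weight N / 𝒵.weight n ∧ f = fun z => 𝓔.toLim N (T z) := by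
  constructor
  · rintro ⟨T, hT, rfl⟩
    exact ⟨T, mem_closedBall_zero_iff.1 hT, rfl⟩
  · rintro ⟨T, hT, rfl⟩
    exact ⟨T, mem_closedBall_zero_iff.2 hT, rfl⟩

@[simp] theorem Covers.opSpectrum_r (h𝓔 : 𝓔.Covers) {𝒵 : BanachSpectrum Z} {n m : ℕ} (h : n ≤ m)
    (f : 𝒵.step m → E) (z : 𝒵.step n) : (h𝓔.opSpectrum 𝒵).r h f z = f (𝒵.incl h z) := rfl

theorem Covers.smul_mem_opSpectrum (h𝓔 : 𝓔.Covers) {𝒵 : BanachSpectrum Z} {n N : ℕ}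
    (T : 𝒵.step n →L[ℂ] 𝓔.step N) {c : ℝ} (hc : 0 < c) (hT : ‖T‖ ≤ c) :
    ∃ b ∈ (h𝓔.opSpectrum 𝒵).B n N,
      (fun z => 𝓔.toLim N (T z)) = (c / (𝓔.weight N / 𝒵.weight n)) • b := by
  have h1 : 0 < 𝓔.weight N / 𝒵.weight n := div_pos (𝓔.weight_pos N) (𝒵.weight_pos n)
  refine ⟨_, h𝓔.mem_opSpectrum_B.2
    ⟨((𝓔.weight N / 𝒵.weight n) / c) • T, ?_, rfl⟩, ?_⟩
  · rw [norm_smul, Real.norm_of_nonneg (by positivity)]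
    calc 𝓔.weight N / 𝒵.weight n / c * ‖T‖ ≤ 𝓔.weight N / 𝒵.weight n / c * c := by gcongr
      _ = _ := div_mul_cancel₀ _ hc.ne'
  · ext z
    rw [Pi.smul_apply, smul_apply, 𝓔.toLim_real_smul, smul_smul,
      div_mul_div_cancel₀ h1.ne', div_self hc.ne', one_smul]

theorem Covers.opSpectrum_bdd_iff (h𝓔 : 𝓔.Covers) {𝒵 : BanachSpectrum Z} {n : ℕ}
    {f : 𝒵.step n → E} : (h𝓔.opSpectrum 𝒵).Bdd n f ↔
      ∃ N, ∃ T : 𝒵.step n →L[ℂ] 𝓔.step N, f = fun z => 𝓔.toLim N (T z) := by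
  constructor
  · rintro ⟨N, C, hC, b, hb, rfl⟩
    obtain ⟨T, hT, rfl⟩ := h𝓔.mem_opSpectrum_B.1 hb
    refine ⟨N, C • T, ?_⟩
    ext z
    rw [Pi.smul_apply, smul_apply, 𝓔.toLim_real_smul]
  · rintro ⟨N, T, rfl⟩
    obtain ⟨b, hb, e⟩ := h𝓔.smul_mem_opSpectrum T (c := ‖T‖ + 1) (by positivity) (by linarith)
    exact ⟨N, _, div_pos (by positivity) (div_pos (𝓔.weight_pos N) (𝒵.weight_pos n)), b, hb, e⟩

end Operators

end BanachSpectrum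

/-! ### (S) for operators and (S) with a fixed constant -/

section PairOp

variable {E : Type*} [AddCommGroup E] [Module ℂ E] {Z : Type*} [AddCommGroup Z] [Module ℂ Z]

/-- The condition (S) for operators. -/
def PairOp (𝓔 : BanachSpectrum E) (𝒵 : BanachSpectrum Z) : Prop :=
  ∀ n, ∃ m, ∃ hnm : n ≤ m, ∀ k, ∀ hmk : m ≤ k, ∃ N, ∀ M ≥ N, ∀ ε > (0 : ℝ), ∃ K, ∃ C > (0 : ℝ),
    ∀ T : 𝒵.step m →L[ℂ] 𝓔.step M, ‖T‖ ≤ 1 →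
      ∃ (U : 𝒵.step k →L[ℂ] 𝓔.step K) (V : 𝒵.step n →L[ℂ] 𝓔.step N), ‖U‖ ≤ C ∧ ‖V‖ ≤ ε ∧
        ∀ z, 𝓔.toLim M (T (𝒵.incl hnm z)) =
          𝓔.toLim K (U (𝒵.incl (hnm.trans hmk) z)) + 𝓔.toLim N (V z)

/-- The interpolation inequality `‖z‖ₘ ≤ C ‖z‖ₖ + ε ‖z‖ₙ`. -/
def NormInterpolation (𝒵 : BanachSpectrum Z) : Prop :=
  ∀ n, ∃ m, ∃ hnm : n ≤ m, ∀ k, ∀ hmk : m ≤ k, ∀ ε > (0 : ℝ), ∃ C > (0 : ℝ), ∀ z : 𝒵.step n,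
    ‖𝒵.incl hnm z‖ ≤ C * ‖𝒵.incl (hnm.trans hmk) z‖ + ε * ‖z‖

/-- The condition (S) with a fixed constant instead of `ε`. -/
def WeakPairS (𝓔 : BanachSpectrum E) (𝒵 : BanachSpectrum Z) : Prop :=
  ∀ n, ∃ m, ∃ hnm : n ≤ m, ∀ k, ∀ hmk : m ≤ k, ∃ N, ∀ M ≥ N, ∃ K ≥ M, ∃ C > (0 : ℝ),
    ∀ (z : 𝒵.step n) (b : 𝓔.step M), ∃ (u : 𝓔.step K) (v : 𝓔.step N),
      ‖𝒵.incl hnm z‖ • 𝓔.toLim M b = 𝓔.toLim K u + 𝓔.toLim N v ∧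
      ‖u‖ ≤ C * ‖𝒵.incl (hnm.trans hmk) z‖ * ‖b‖ ∧ ‖v‖ ≤ C * ‖z‖ * ‖b‖

/-- The weak condition is used from the intermediate step m on. There the error v is bounded by
C‖z‖_m‖b‖ with ‖z‖_m ≤ C'‖z‖_k + (ε/C)‖z‖_n. Dividing v in the proportion of these two terms moves
the first part to E_K and leaves an error with factor ε. -/
theorem WeakPairS.pairS {𝓔 : BanachSpectrum E} {𝒵 : BanachSpectrum Z} (h : WeakPairS 𝓔 𝒵)
    (hW : NormInterpolation 𝒵) : PairS 𝓔 𝒵 := by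
  intro n
  obtain ⟨m, hnm, hW⟩ := hW n
  obtain ⟨m', hmm', h⟩ := h m
  refine ⟨m', hnm.trans hmm', fun k hk => ?_⟩
  obtain ⟨N, h⟩ := h k hk
  refine ⟨N, fun M hM ε hε => ?_⟩
  obtain ⟨K, hK, C, hC, h⟩ := h M hM
  obtain ⟨C', hC', hW⟩ := hW k (hmm'.trans hk) (ε / C) (by positivity)
  refine ⟨K, hK, C + (‖𝓔.incl (hM.trans hK)‖ + 1) * (C * C'), by positivity, fun z b => ?_⟩
  rcases eq_or_ne z 0 with rfl | hz
  · exact ⟨0, 0, by simp, by simp, by simp⟩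
  obtain ⟨u, v, huv, hu, hv⟩ := h (𝒵.incl hnm z) b
  have hWz := hW z
  simp only [𝒵.incl_incl] at huv hu hWz
  set a := ‖𝒵.incl (hnm.trans (hmm'.trans hk)) z‖
  have hz0 : 0 < ‖z‖ := norm_pos_iff.2 hz
  have hs : 0 < C' * a + ε / C * ‖z‖ := by positivity
  set s := C' * a + ε / C * ‖z‖ with hsdef
  refine ⟨u + 𝓔.incl (hM.trans hK) ((C' * a / s) • v), (ε / C * ‖z‖ / s) • v, ?_, ?_, ?_⟩
  · rw [huv, map_add, 𝓔.toLim_incl, 𝓔.toLim_real_smul, 𝓔.toLim_real_smul, add_assoc, ← add_smul,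
      ← add_div, div_self hs.ne', one_smul]
  · have h1 : ‖(C' * a / s) • v‖ ≤ C * C' * a * ‖b‖ := by
      rw [norm_smul, Real.norm_of_nonneg (by positivity)]
      calc C' * a / s * ‖v‖ ≤ C' * a / s * (C * s * ‖b‖) := by
            gcongr
            exact hv.trans (by gcongr)
        _ = _ := by field_simp
    calc ‖u + 𝓔.incl (hM.trans hK) ((C' * a / s) • v)‖
        ≤ ‖u‖ + ‖𝓔.incl (hM.trans hK) ((C' * a / s) • v)‖ := norm_add_le _ _
      _ ≤ C * a * ‖b‖ + (‖𝓔.incl (hM.trans hK)‖ + 1) * (C * C' * a * ‖b‖) := by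
          gcongr
          exact (ContinuousLinearMap.le_opNorm _ _).trans (by gcongr; linarith)
      _ = _ := by ring
  · rw [norm_smul, Real.norm_of_nonneg (by positivity)]
    calc ε / C * ‖z‖ / s * ‖v‖ ≤ ε / C * ‖z‖ / s * (C * s * ‖b‖) := by
          gcongr
          exact hv.trans (by gcongr)
      _ = _ := by field_simp

variable [TopologicalSpace E] [IsTopologicalAddGroup E] [ContinuousSMul ℂ E]
  {𝓔 : BanachSpectrum E} {𝒵 : BanachSpectrum Z}

theorem PairOp.splits (h𝓔 : 𝓔.Covers) (h : PairOp 𝓔 𝒵) : (h𝓔.opSpectrum 𝒵).Splits := by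
  intro n
  obtain ⟨m, hnm, h⟩ := h n
  refine ⟨m, hnm, fun k hmk => ?_⟩
  obtain ⟨N, h⟩ := h k hmk
  refine ⟨N, fun M hM ε hε => ?_⟩
  have hw : ∀ n N, 0 < 𝓔.weight N / 𝒵.weight n := fun n N =>
    div_pos (𝓔.weight_pos N) (𝒵.weight_pos n)
  obtain ⟨K, C, hC, h⟩ := h M hM (ε * (𝓔.weight N / 𝒵.weight n) / (𝓔.weight M / 𝒵.weight m))
    (div_pos (mul_pos hε (hw _ _)) (hw _ _))
  set s := 𝓔.weight M / 𝒵.weight m with hs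
  have hs0 : 0 < s := hw _ _
  refine ⟨K, s * (C / (𝓔.weight K / 𝒵.weight k)), mul_pos hs0 (div_pos hC (hw _ _)), ?_⟩
  rintro _ ⟨f, hf, rfl⟩
  obtain ⟨T, hT, rfl⟩ := h𝓔.mem_opSpectrum_B.1 hf
  obtain ⟨U, V, hU, hV, hUV⟩ := h (s⁻¹ • T) (by
    rw [norm_smul, Real.norm_of_nonneg (by positivity), inv_mul_le_iff₀ hs0, mul_one]
    exact hT)
  obtain ⟨x, hx, hxU⟩ := h𝓔.smul_mem_opSpectrum U hC hU
  refine ⟨x, hx, _, ⟨_, h𝓔.mem_opSpectrum_B.2 ⟨(s / ε) • V, ?_, rfl⟩, rfl⟩, ?_⟩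
  · rw [norm_smul, Real.norm_of_nonneg (by positivity)]
    calc s / ε * ‖V‖ ≤ s / ε * (ε * (𝓔.weight N / 𝒵.weight n) / s) := by gcongr
      _ = _ := by field_simp
  · ext z
    have h1 := hUV z
    rw [smul_apply, 𝓔.toLim_real_smul] at h1
    have h2 := congrFun hxU (𝒵.incl (hnm.trans hmk) z)
    rw [Pi.smul_apply] at h2
    simp only [BanachSpectrum.Covers.opSpectrum_r, Pi.add_apply, Pi.smul_apply,
      smul_apply, 𝓔.toLim_real_smul, smul_smul]
    rw [mul_div_cancel₀ _ hε.ne', mul_smul, ← h2, ← smul_add, ← h1, smul_inv_smul₀ hs0.ne']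

/-- Surjectivity along all subsequences implies a splitting property of operators. -/
theorem exists_operator_split (h𝓔 : 𝓔.Covers)
    (hS : ∀ φ hφ, (h𝓔.opSpectrum 𝒵).ProjOneZero φ hφ) :
    ∀ n, ∃ m, ∃ hnm : n ≤ m, ∀ k, ∀ hmk : m ≤ k, ∃ N, ∀ M ≥ N,
      ∀ T : 𝒵.step m →L[ℂ] 𝓔.step M, ∀ ε > (0 : ℝ),
      ∃ K, ∃ (U : 𝒵.step k →L[ℂ] 𝓔.step K) (V : 𝒵.step n →L[ℂ] 𝓔.step N), ‖V‖ ≤ ε ∧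
        ∀ z, 𝓔.toLim M (T (𝒵.incl hnm z)) =
          𝓔.toLim K (U (𝒵.incl (hnm.trans hmk) z)) + 𝓔.toLim N (V z) := by
  intro n
  obtain ⟨m, hnm, h⟩ := DiskSpectrum.exists_split_of_projOneZero _ hS n
  refine ⟨m, hnm, fun k hmk => ?_⟩
  obtain ⟨N, h⟩ := h k hmk
  refine ⟨N, fun M hM T ε hε => ?_⟩
  have hw : ∀ n N, 0 < 𝓔.weight N / 𝒵.weight n := fun n N =>
    div_pos (𝓔.weight_pos N) (𝒵.weight_pos n)
  obtain ⟨b, hb, hTb⟩ := h𝓔.smul_mem_opSpectrum T (c := ‖T‖ + 1) (by positivity) (by linarith)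
  -- The splitting holds for every multiple of T with an error in the same ball; splitting s T and
  -- dividing by s makes the error as small as desired.
  set s := (𝓔.weight N / 𝒵.weight n) / ε with hs
  have hs0 : 0 < s := div_pos (hw _ _) hε
  obtain ⟨y, hy, hyV⟩ := h M hM b hb (s * ((‖T‖ + 1) / (𝓔.weight M / 𝒵.weight m)))
    (mul_pos hs0 (div_pos (by positivity) (hw _ _)))
  obtain ⟨K, U, rfl⟩ := h𝓔.opSpectrum_bdd_iff.1 hy
  obtain ⟨V, hV, hVe⟩ := h𝓔.mem_opSpectrum_B.1 hyV
  rw [mul_smul, ← hTb] at hVe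
  refine ⟨K, s⁻¹ • U, s⁻¹ • V, ?_, fun z => ?_⟩
  · rw [norm_smul, Real.norm_of_nonneg (by positivity), inv_mul_le_iff₀ hs0]
    exact hV.trans_eq (by rw [hs, div_mul_cancel₀ _ hε.ne'])
  · have h2 := congrFun hVe z
    simp only [map_smul, Pi.sub_apply, Pi.smul_apply, BanachSpectrum.Covers.opSpectrum_r] at h2
    rw [smul_apply, smul_apply, 𝓔.toLim_real_smul,
      𝓔.toLim_real_smul, ← smul_add, ← h2, add_sub_cancel, inv_smul_smul₀ hs0.ne']

/-- In the splitting of operators, K depends on T. The factorization theorem on the Banach space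
L(Z_m, E_M) yields one K with norm estimates, where the error is controlled by a fixed constant
only. Evaluating at rank one operators g ⊗ b, with g norming z in Z_m, gives the statement on
vectors. -/
theorem weakPairS_of_projOneZero [T2Space E] (h𝓔 : 𝓔.Covers)
    (hS : ∀ φ hφ, (h𝓔.opSpectrum 𝒵).ProjOneZero φ hφ) : WeakPairS 𝓔 𝒵 := by
  intro n
  obtain ⟨m, hnm, h⟩ := exists_operator_split h𝓔 hS n
  refine ⟨m, hnm, fun k hmk => ?_⟩
  obtain ⟨N, h⟩ := h k hmk
  refine ⟨N, fun M hM => ?_⟩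
  let J : (𝒵.step m →L[ℂ] 𝓔.step M) →L[ℂ] (𝒵.step n → E) := ContinuousLinearMap.pi fun z =>
    (h𝓔.toLimL M).comp (ContinuousLinearMap.apply ℂ (𝓔.step M) (𝒵.incl hnm z))
  let J' : ∀ K, (𝒵.step k →L[ℂ] 𝓔.step K) × (𝒵.step n →L[ℂ] 𝓔.step N) →L[ℂ] (𝒵.step n → E) :=
    fun K => ContinuousLinearMap.pi fun z =>
      ((h𝓔.toLimL K).comp (ContinuousLinearMap.apply ℂ (𝓔.step K)
        (𝒵.incl (hnm.trans hmk) z))).comp (ContinuousLinearMap.fst ℂ _ _) +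
      ((h𝓔.toLimL N).comp (ContinuousLinearMap.apply ℂ (𝓔.step N) z)).comp
        (ContinuousLinearMap.snd ℂ _ _)
  obtain ⟨K, C, hC, hK⟩ := exists_factor_bound J J' fun T => by
    obtain ⟨K, U, V, -, hUV⟩ := h M hM T 1 one_pos
    exact ⟨K, (U, V), funext fun z => (hUV z).symm⟩
  have hL : 0 < C * (‖𝓔.incl (le_max_left K M)‖ + 1) := by positivity
  refine ⟨max K M, le_max_right _ _, C * (‖𝓔.incl (le_max_left K M)‖ + 1), hL, fun z b => ?_⟩
  obtain ⟨g, hg, hgz⟩ := exists_dual_vector'' ℂ (𝒵.incl hnm z)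
  obtain ⟨⟨U, V⟩, hUV, hn⟩ := hK (g.smulRight b)
  have hn' : ‖(U, V)‖ ≤ C * ‖b‖ := hn.trans (by
    gcongr
    rw [ContinuousLinearMap.norm_smulRight_apply]
    exact mul_le_of_le_one_left (norm_nonneg _) hg)
  rw [norm_prod_le_iff] at hn'
  refine ⟨𝓔.incl (le_max_left _ _) (U (𝒵.incl (hnm.trans hmk) z)), V z, ?_, ?_, ?_⟩
  · have h1 := congrFun hUV z
    rw [𝓔.toLim_incl]
    refine Eq.trans ?_ h1.symm
    change _ = 𝓔.toLim M (g (𝒵.incl hnm z) • b)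
    rw [hgz, map_smul]
    rfl
  · calc ‖𝓔.incl (le_max_left K M) (U (𝒵.incl (hnm.trans hmk) z))‖
        ≤ ‖𝓔.incl (le_max_left K M)‖ * (‖U‖ * ‖𝒵.incl (hnm.trans hmk) z‖) :=
          (ContinuousLinearMap.le_opNorm _ _).trans (by gcongr; exact U.le_opNorm _)
      _ ≤ (‖𝓔.incl (le_max_left K M)‖ + 1) * (C * ‖b‖ * ‖𝒵.incl (hnm.trans hmk) z‖) := by
          gcongr
          · linarith
          · exact hn'.1
      _ = _ := by ring
  · calc ‖V z‖ ≤ C * ‖b‖ * ‖z‖ := (V.le_opNorm z).trans (by gcongr; exact hn'.2)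
      _ ≤ C * ‖b‖ * ‖z‖ * (‖𝓔.incl (le_max_left K M)‖ + 1) :=
          le_mul_of_one_le_right (by positivity) (by linarith [norm_nonneg (𝓔.incl (le_max_left K M))])
      _ = _ := by ring

end PairOp

/-! ### Direct sums of sequences of Banach spaces -/

/-- The direct sum of a sequence of Banach spaces, with the inductive limit topology below. -/
def BanachSum (F : ℕ → Type w) [∀ n, AddCommGroup (F n)] : Type w := Π₀ n, F n

namespace BanachSum

section Algebra

variable (F : ℕ → Type w) [∀ n, AddCommGroup (F n)] [∀ n, Module ℂ (F n)]

instance : AddCommGroup (BanachSum F) := inferInstanceAs (AddCommGroup (Π₀ n, F n))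

instance : Module ℂ (BanachSum F) := inferInstanceAs (Module ℂ (Π₀ n, F n))

/-- The coordinate inclusions. -/
def single (n : ℕ) : F n →ₗ[ℂ] BanachSum F := DFinsupp.lsingle n

/-- The coordinate projections. -/
def eval (n : ℕ) : BanachSum F →ₗ[ℂ] F n := DFinsupp.lapply n

variable {F}

theorem eval_single_same (n : ℕ) (x : F n) : eval F n (single F n x) = x :=
  DFinsupp.single_eq_same

theorem eval_single_ne {n m : ℕ} (h : n ≠ m) (x : F n) : eval F m (single F n x) = 0 :=
  DFinsupp.single_eq_of_ne h.symm

theorem ext_eval {x y : BanachSum F} (h : ∀ n, eval F n x = eval F n y) : x = y :=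
  DFinsupp.ext h

/-- The linear map defined by its restrictions to the summands. -/
def lift {G : Type*} [AddCommGroup G] [Module ℂ G] (g : ∀ n, F n →ₗ[ℂ] G) : BanachSum F →ₗ[ℂ] G :=
  DFinsupp.lsum ℂ g

@[simp] theorem lift_single {G : Type*} [AddCommGroup G] [Module ℂ G] (g : ∀ n, F n →ₗ[ℂ] G)
    (n : ℕ) (x : F n) : lift g (single F n x) = g n x :=
  DFinsupp.lsum_single _ _ _ _

theorem induction {p : BanachSum F → Prop} (x : BanachSum F) (h0 : p 0)
    (hs : ∀ n x, p (single F n x)) (ha : ∀ x y, p x → p y → p (x + y)) : p x := by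
  refine DFinsupp.induction x h0 fun n b f _ _ hf => ha _ _ (hs n b) hf

end Algebra

variable (F : ℕ → Type w) [∀ n, NormedAddCommGroup (F n)] [∀ n, NormedSpace ℂ (F n)]
  [∀ n, CompleteSpace (F n)]

/-- The inclusion of the finite sums. -/
def ofFin (F : ℕ → Type w) [∀ n, AddCommGroup (F n)] [∀ n, Module ℂ (F n)] (p : ℕ) :
    (∀ i : Fin (p + 1), F i) →ₗ[ℂ] BanachSum F where
  toFun f := ∑ i : Fin (p + 1), single F i (f i)
  map_add' f g := by simp only [Pi.add_apply, map_add, Finset.sum_add_distrib]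
  map_smul' c f := by
    simp only [Pi.smul_apply, map_smul, RingHom.id_apply, Finset.smul_sum]

theorem ofFin_apply (F : ℕ → Type w) [∀ n, AddCommGroup (F n)] [∀ n, Module ℂ (F n)] (p : ℕ)
    (f : ∀ i : Fin (p + 1), F i) : ofFin F p f = ∑ i : Fin (p + 1), single F i (f i) := rfl

theorem eval_ofFin (F : ℕ → Type w) [∀ n, AddCommGroup (F n)] [∀ n, Module ℂ (F n)] (p : ℕ)
    (f : ∀ i : Fin (p + 1), F i) (j : ℕ) :
    eval F j (ofFin F p f) = if hj : j < p + 1 then f ⟨j, hj⟩ else 0 := by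
  rw [ofFin_apply, map_sum]
  split_ifs with hj
  · rw [Finset.sum_eq_single (⟨j, hj⟩ : Fin (p + 1))]
    · exact eval_single_same _ _
    · intro i _ hij
      exact eval_single_ne (fun e => hij (Fin.ext e)) _
    · simp
  · exact Finset.sum_eq_zero fun i _ => eval_single_ne
      (fun e => hj (by have := i.2; omega)) _

/-- The finite sums, as a spectrum of Banach spaces. -/
def spectrum : BanachSpectrum (BanachSum F) where
  step p := ∀ i : Fin (p + 1), F i
  toLim p := ofFin F p
  toLim_injective p := by
    intro f g h
    funext j
    have h1 := congrArg (eval F j) h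
    rw [eval_ofFin, eval_ofFin, dif_pos j.2, dif_pos j.2] at h1
    exact h1
  incl {n m} h := ContinuousLinearMap.pi fun j : Fin (m + 1) =>
    if hj : (j : ℕ) < n + 1 then ContinuousLinearMap.proj (⟨j, hj⟩ : Fin (n + 1)) else 0
  toLim_incl {n m} h f := by
    refine ext_eval fun j => ?_
    rw [eval_ofFin, eval_ofFin]
    by_cases hj : j < n + 1
    · have hj' : j < m + 1 := by omega
      rw [dif_pos hj, dif_pos hj', ContinuousLinearMap.pi_apply, dif_pos hj]
      rfl
    · rw [dif_neg hj]
      split_ifs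
      · rw [ContinuousLinearMap.pi_apply, dif_neg hj]
        rfl
      · rfl

instance : TopologicalSpace (BanachSum F) := (spectrum F).limTopology

instance : IsTopologicalAddGroup (BanachSum F) := (spectrum F).isLeast_limTopology.1.1

instance : ContinuousSMul ℂ (BanachSum F) := (spectrum F).isLeast_limTopology.1.2.1

instance : LocallyConvexSpace ℝ (BanachSum F) := (spectrum F).isLeast_limTopology.1.2.2.1

theorem exists_single_eq (n : ℕ) : ∃ f : F n →L[ℂ] (spectrum F).step n,
    ∀ x, (spectrum F).toLim n (f x) = single F n x := by
  refine ⟨ContinuousLinearMap.single ℂ (fun i : Fin (n + 1) => F i) (Fin.last n), fun x => ?_⟩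
  change ofFin F n (Pi.single (M := fun i : Fin (n + 1) => F i) (Fin.last n) x) = _
  rw [ofFin_apply, Finset.sum_eq_single (Fin.last n)]
  · rw [Pi.single_eq_same]
    rfl
  · intro i _ hi
    rw [Pi.single_eq_of_ne hi, map_zero]
  · simp

theorem continuous_single (n : ℕ) : Continuous (single F n) := by
  obtain ⟨f, hf⟩ := exists_single_eq F n
  have h : Continuous ((spectrum F).toLim n) := (spectrum F).isLeast_limTopology.1.2.2.2 n
  exact (h.comp f.continuous).congr hf

theorem isLimit : (spectrum F).IsLimit := by
  refine ⟨fun x => ?_, rfl⟩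
  induction x using induction with
  | h0 => exact ⟨0, 0, map_zero _⟩
  | hs n x =>
    obtain ⟨f, hf⟩ := exists_single_eq F n
    exact ⟨n, f x, hf x⟩
  | ha x y hx hy =>
    obtain ⟨n, a, rfl⟩ := hx
    obtain ⟨m, b, rfl⟩ := hy
    exact ⟨max n m, (spectrum F).incl (le_max_left _ _) a + (spectrum F).incl (le_max_right _ _) b,
      by rw [map_add, (spectrum F).toLim_incl, (spectrum F).toLim_incl]⟩

variable {F}

theorem continuous_of {G : Type*} [AddCommGroup G] [Module ℂ G] [TopologicalSpace G]
    [IsTopologicalAddGroup G] [ContinuousSMul ℂ G] [LocallyConvexSpace ℝ G]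
    (g : BanachSum F →ₗ[ℂ] G) (hg : ∀ n, Continuous fun x => g (single F n x)) : Continuous g := by
  refine (isLimit F).continuous_of g fun n => ?_
  change Continuous fun x : ∀ i : Fin (n + 1), F i =>
    g (ofFin F n x)
  simp only [ofFin_apply, map_sum]
  exact continuous_finsetSum _ fun i _ => (hg i).comp (continuous_apply i)

instance : T2Space (BanachSum F) := by
  have h : ∀ n, Continuous (eval F n) := fun n => continuous_of _ fun m => by
    rcases eq_or_ne m n with rfl | hmn
    · simp only [eval_single_same]
      exact continuous_id
    · simp only [eval_single_ne hmn]
      exact continuous_const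
  exact T2Space.of_injective_continuous (f := fun (x : BanachSum F) n => eval F n x)
    (fun x y hxy => ext_eval fun n => congrFun hxy n) (continuous_pi h)

theorem isLBSpace : IsLBSpace (BanachSum F) := ⟨inferInstance, spectrum F, isLimit F⟩

end BanachSum

/-! ### The canonical resolution -/

section Resolution

variable {E : Type u} [AddCommGroup E] [Module ℂ E] [TopologicalSpace E] [IsTopologicalAddGroup E]
  [ContinuousSMul ℂ E] [LocallyConvexSpace ℝ E]
  {Z : Type v} [AddCommGroup Z] [Module ℂ Z] [TopologicalSpace Z] [IsTopologicalAddGroup Z]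
  [ContinuousSMul ℂ Z] [LocallyConvexSpace ℝ Z]

/-- In the canonical resolution 0 → ⊕ Z_φ(i) → ⊕ Z_φ(i) → Z → 0 the first map sends x in summand i
to x minus its image in summand i + 1, and the second is summation in Z. An extension of the map
(τ_i) along the first map has components S_i with exactly the required property. -/
theorem IsWeaklyAcyclic.exists_solution (h : IsWeaklyAcyclic.{u, v, max v w} E Z)
    {𝒵 : BanachSpectrum Z} (h𝒵 : 𝒵.Covers) {φ : ℕ → ℕ} (hφ : StrictMono φ)
    (τ : ∀ i, 𝒵.step (φ i) →L[ℂ] E) :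
    ∃ S : ∀ i, 𝒵.step (φ i) →L[ℂ] E, ∀ i z,
      τ i z = S i z - S (i + 1) (𝒵.incl (hφ.monotone i.le_succ) z) := by
  -- The lift places the sums in the universe over which X and Y range.
  let F : ℕ → Type (max v w) := fun i => ULift.{w} (𝒵.step (φ i))
  let d : ∀ i, F i →L[ℂ] 𝒵.step (φ i) := fun i => (ContinuousLinearEquiv.ulift :
    ULift.{w} (𝒵.step (φ i)) ≃L[ℂ] 𝒵.step (φ i)).toContinuousLinearMap
  let up : ∀ i, 𝒵.step (φ i) →L[ℂ] F i := fun i => (ContinuousLinearEquiv.ulift :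
    ULift.{w} (𝒵.step (φ i)) ≃L[ℂ] 𝒵.step (φ i)).symm.toContinuousLinearMap
  have hdu : ∀ i z, d i (up i z) = z := fun _ _ => rfl
  have hud : ∀ i z, up i (d i z) = z := fun _ _ => rfl
  let j : ∀ i, F i →L[ℂ] F (i + 1) := fun i =>
    (up (i + 1)).comp ((𝒵.incl (hφ.monotone i.le_succ)).comp (d i))
  let ι₀ : BanachSum F →ₗ[ℂ] BanachSum F := BanachSum.lift fun i =>
    BanachSum.single F i - BanachSum.single F (i + 1) ∘ₗ (j i).toLinearMap
  have hι₀ : ∀ i x, ι₀ (BanachSum.single F i x) =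
      BanachSum.single F i x - BanachSum.single F (i + 1) (j i x) := fun i x => by
    simp [ι₀]
  let ι : BanachSum F →L[ℂ] BanachSum F := ⟨ι₀, BanachSum.continuous_of _ fun i => by
    simp only [hι₀]
    exact (BanachSum.continuous_single F i).sub
      ((BanachSum.continuous_single F (i + 1)).comp (j i).continuous)⟩
  let Q₀ : BanachSum F →ₗ[ℂ] Z := BanachSum.lift fun i => 𝒵.toLim (φ i) ∘ₗ (d i).toLinearMap
  have hQ₀ : ∀ i x, Q₀ (BanachSum.single F i x) = 𝒵.toLim (φ i) (d i x) := fun i x => by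
    simp [Q₀]
  let Q : BanachSum F →L[ℂ] Z := ⟨Q₀, BanachSum.continuous_of _ fun i => by
    simp only [hQ₀]
    exact (h𝒵.continuous _).comp (d i).continuous⟩
  let T₀ : BanachSum F →ₗ[ℂ] E := BanachSum.lift fun i => (τ i).toLinearMap ∘ₗ (d i).toLinearMap
  have hT₀ : ∀ i x, T₀ (BanachSum.single F i x) = τ i (d i x) := fun i x => by
    simp [T₀]
  let T : BanachSum F →L[ℂ] E := ⟨T₀, BanachSum.continuous_of _ fun i => by
    simp only [hT₀]
    exact (τ i).continuous.comp (d i).continuous⟩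
  have hQj : ∀ i x, Q₀ (BanachSum.single F (i + 1) (j i x)) = Q₀ (BanachSum.single F i x) :=
    fun i x => by
      rw [hQ₀, hQ₀]
      exact 𝒵.toLim_incl _ _
  have hQι : ∀ x, Q₀ (ι₀ x) = 0 := fun x => by
    induction x using BanachSum.induction with
    | h0 => simp
    | hs i x => rw [hι₀, map_sub, hQj, sub_self]
    | ha x y hx hy => rw [map_add, map_add, hx, hy, add_zero]
  -- The coordinates of ι x are x_0 and x_{n+1} − j x_n, so ι x = 0 gives x = 0 by induction.
  have hinj : Function.Injective ι := by
    rw [injective_iff_map_eq_zero]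
    intro x hx
    have h0 : ∀ y, BanachSum.eval F 0 (ι₀ y) = BanachSum.eval F 0 y := fun y => by
      induction y using BanachSum.induction with
      | h0 => simp
      | hs i y => rw [hι₀, map_sub, BanachSum.eval_single_ne i.succ_ne_zero, sub_zero]
      | ha x y hx hy => rw [map_add, map_add, hx, hy, map_add]
    have hs : ∀ n y, BanachSum.eval F (n + 1) (ι₀ y) =
        BanachSum.eval F (n + 1) y - j n (BanachSum.eval F n y) := fun n y => by
      induction y using BanachSum.induction with
      | h0 => simp
      | hs i y =>
        rw [hι₀, map_sub]
        rcases eq_or_ne i n with rfl | hin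
        · rw [BanachSum.eval_single_same, BanachSum.eval_single_same]
        · rw [BanachSum.eval_single_ne hin, map_zero,
            BanachSum.eval_single_ne (fun e => hin (Nat.succ_injective e))]
      | ha x y hx hy =>
        rw [map_add, map_add, hx, hy, map_add, map_add, map_add]
        abel
    refine BanachSum.ext_eval fun n => ?_
    rw [map_zero]
    induction n with
    | zero => rw [← h0, show ι₀ x = 0 from hx, map_zero]
    | succ n ih =>
      have := hs n x
      rw [show ι₀ x = 0 from hx, map_zero, ih, map_zero, sub_zero] at this
      exact this.symm
  -- Modulo the range of ι every element can be pushed into a single summand, and Q is injective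
  -- there; this gives exactness in the middle.
  have hpush : ∀ i m (hm : i ≤ m) x, ∃ z y, BanachSum.single F i x =
      ι₀ y + BanachSum.single F m z := fun i m hm x => by
    induction m, hm using Nat.le_induction with
    | base => exact ⟨x, 0, by simp⟩
    | succ m _ ih =>
      obtain ⟨z, y, h⟩ := ih
      refine ⟨j m z, y + BanachSum.single F m z, ?_⟩
      rw [map_add, hι₀, h]
      abel
  have hrep : ∀ x, ∃ N z y, x = ι₀ y + BanachSum.single F N z := fun x => by
    induction x using BanachSum.induction with
    | h0 => exact ⟨0, 0, 0, by simp⟩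
    | hs i x => exact ⟨i, x, 0, by simp⟩
    | ha x x' hx hx' =>
      obtain ⟨N, z, y, rfl⟩ := hx
      obtain ⟨N', z', y', rfl⟩ := hx'
      obtain ⟨a, b, hab⟩ := hpush N (max N N') (le_max_left _ _) z
      obtain ⟨a', b', hab'⟩ := hpush N' (max N N') (le_max_right _ _) z'
      refine ⟨_, a + a', y + y' + b + b', ?_⟩
      rw [hab, hab']
      simp only [map_add]
      abel
  have hex : Function.Exact ι Q := fun x => by
    constructor
    · intro hx
      obtain ⟨N, z, y, rfl⟩ := hrep x
      have h1 : Q₀ (ι₀ y + BanachSum.single F N z) = 0 := hx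
      rw [map_add, hQι, zero_add, hQ₀] at h1
      have h2 : d N z = 0 := 𝒵.toLim_injective _ (h1.trans (map_zero _).symm)
      have h3 : z = 0 := by rw [← hud N z, h2, map_zero]
      exact ⟨y, by rw [h3, map_zero, add_zero]; rfl⟩
    · rintro ⟨y, rfl⟩
      exact hQι y
  have hsurj : Function.Surjective Q := fun z => by
    obtain ⟨n, e, rfl⟩ := h𝒵.exhausts z
    refine ⟨BanachSum.single F n (up n (𝒵.incl hφ.le_apply e)), (hQ₀ _ _).trans ?_⟩
    rw [hdu, 𝒵.toLim_incl]
  obtain ⟨S, hS⟩ := h (BanachSum F) (BanachSum F) ι Q BanachSum.isLBSpace BanachSum.isLBSpace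
    hinj hex hsurj T
  refine ⟨fun i => (S.comp ⟨BanachSum.single F i, BanachSum.continuous_single F i⟩).comp (up i),
    fun i z => ?_⟩
  have h1 := DFunLike.congr_fun hS (BanachSum.single F i (up i z))
  have h2 : S (ι₀ (BanachSum.single F i (up i z))) = T₀ (BanachSum.single F i (up i z)) := h1
  rw [hι₀, hT₀, hdu, map_sub] at h2
  exact h2.symm

/-- By factorization through a step, the bounded elements of the operator spectrum are exactly the
continuous operators Z_φ(i) → E. -/
theorem IsWeaklyAcyclic.projOneZero [T2Space E] (h : IsWeaklyAcyclic.{u, v, max v w} E Z)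
    {𝒵 : BanachSpectrum Z} (h𝒵 : 𝒵.Covers) {𝓔 : BanachSpectrum E} (h𝓔 : 𝓔.Covers) (φ : ℕ → ℕ)
    (hφ : StrictMono φ) : (h𝓔.opSpectrum 𝒵).ProjOneZero φ hφ := by
  intro f hf
  have hf' : ∀ i, ∃ τ : 𝒵.step (φ i) →L[ℂ] E, f i = τ := fun i => by
    obtain ⟨N, T, e⟩ := h𝓔.opSpectrum_bdd_iff.1 (hf i)
    exact ⟨(h𝓔.toLimL N).comp T, e⟩
  choose τ hτ using hf'
  obtain ⟨S, hS⟩ := h.exists_solution h𝒵 hφ τ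
  refine ⟨fun i => S i, fun i => ?_, fun i => ?_⟩
  · obtain ⟨N, T, hT⟩ := h𝓔.exists_lift (S i)
    exact h𝓔.opSpectrum_bdd_iff.2 ⟨N, T, funext fun z => (hT z).symm⟩
  · rw [hτ]
    exact funext fun z => hS i z

end Resolution

namespace BanachSpectrum.IsLimit

variable {X : Type*} [AddCommGroup X] [Module ℂ X] [TopologicalSpace X] {𝒳 : BanachSpectrum X}

theorem isTopologicalAddGroup (h : 𝒳.IsLimit) : IsTopologicalAddGroup X :=
  (by rw [h.2]; exact 𝒳.isLeast_limTopology.1 : _ ∈ 𝒳.admissibleTopologies).1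

theorem continuousSMul (h : 𝒳.IsLimit) : ContinuousSMul ℂ X :=
  (by rw [h.2]; exact 𝒳.isLeast_limTopology.1 : _ ∈ 𝒳.admissibleTopologies).2.1

theorem locallyConvexSpace (h : 𝒳.IsLimit) : LocallyConvexSpace ℝ X :=
  (by rw [h.2]; exact 𝒳.isLeast_limTopology.1 : _ ∈ 𝒳.admissibleTopologies).2.2.1

end BanachSpectrum.IsLimit

/-! ### Gluing local extensions -/

/-- For every exact sequence `0 → X → Y → Z → 0` of `(LB)`-spaces and every step of `Y`, every
continuous linear map `X → E` extends to the step. -/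
def IsLocallyAcyclic (E : Type u) [AddCommGroup E] [Module ℂ E] [TopologicalSpace E]
    (Z : Type v) [AddCommGroup Z] [Module ℂ Z] [TopologicalSpace Z] : Prop :=
  ∀ (X Y : Type w) [AddCommGroup X] [Module ℂ X] [TopologicalSpace X]
    [AddCommGroup Y] [Module ℂ Y] [TopologicalSpace Y] (ι : X →L[ℂ] Y) (Q : Y →L[ℂ] Z),
    IsLBSpace X → IsLBSpace Y →
    Function.Injective ι → Function.Exact ι Q → Function.Surjective Q →
    ∀ (T : X →L[ℂ] E) (𝒴 : BanachSpectrum Y), 𝒴.IsLimit → ∀ p, ∃ S : 𝒴.step p →L[ℂ] E,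
      ∀ x y, ι x = 𝒴.toLim p y → S y = T x

section Gluing

variable {E : Type u} [AddCommGroup E] [Module ℂ E] [TopologicalSpace E] [IsTopologicalAddGroup E]
  [ContinuousSMul ℂ E] [LocallyConvexSpace ℝ E] [T2Space E]
  {Z : Type v} [AddCommGroup Z] [Module ℂ Z] [TopologicalSpace Z] [IsTopologicalAddGroup Z]
  [ContinuousSMul ℂ Z] [LocallyConvexSpace ℝ Z] [T2Space Z]

/-- A surjection from a union of Banach spaces lifts, on every step, with bounds. -/
theorem BanachSpectrum.Covers.exists_lift_bound {Y : Type w} [AddCommGroup Y] [Module ℂ Y]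
    [TopologicalSpace Y] {𝒴 : BanachSpectrum Y} (h𝒴 : 𝒴.Covers) (Q : Y →L[ℂ] Z)
    (hQ : Function.Surjective Q) {F : Type*} [NormedAddCommGroup F] [NormedSpace ℂ F]
    [CompleteSpace F] (J : F →L[ℂ] Z) :
    ∃ p, ∃ C > (0 : ℝ), ∀ z, ∃ y, Q (𝒴.toLim p y) = J z ∧ ‖y‖ ≤ C * ‖z‖ :=
  exists_factor_bound J (fun p => Q.comp (h𝒴.toLimL p)) fun x => by
    obtain ⟨y, hy⟩ := hQ (J x)
    obtain ⟨p, e, rfl⟩ := h𝒴.exhausts y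
    exact ⟨p, e, hy⟩

/-- Let R_P(i) extend T to the step Y_P(i). Consecutive extensions differ by an operator vanishing
on ker Q, which descends to τ_i on Z_φ(i). If τ_i = U_i − U_{i+1}, then the maps R_P(i) + U_i ∘ Q
agree on common domains, and they still extend T because Q ∘ ι = 0. -/
theorem exists_extension_of_local {𝓔 : BanachSpectrum E} (h𝓔 : 𝓔.Covers) {𝒵 : BanachSpectrum Z}
    (h𝒵 : 𝒵.Covers) {φ : ℕ → ℕ} (hφ : StrictMono φ)
    (hproj : (h𝓔.opSpectrum 𝒵).ProjOneZero φ hφ) {X : Type*} {Y : Type w}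
    [AddCommGroup X] [Module ℂ X] [TopologicalSpace X] [AddCommGroup Y] [Module ℂ Y]
    [TopologicalSpace Y] (ι : X →L[ℂ] Y) (Q : Y →L[ℂ] Z) (hex : Function.Exact ι Q)
    (hQ : Function.Surjective Q) (T : X →L[ℂ] E) {𝒴 : BanachSpectrum Y} (h𝒴 : 𝒴.IsLimit)
    (hloc : ∀ p, ∃ S : 𝒴.step p →L[ℂ] E, ∀ x y, ι x = 𝒴.toLim p y → S y = T x) :
    ∃ S : Y →L[ℂ] E, S.comp ι = T := by
  choose R hR using hloc
  choose p₀ C₀ hC₀ hp₀ using fun i => h𝒴.covers.exists_lift_bound Q hQ (h𝒵.toLimL (φ i))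
  -- P is monotone, at least i so that all steps of Y are reached, and at least p₀ i so that Z_φ(i)
  -- lifts boundedly to Y_P(i).
  let P : ℕ → ℕ := fun i => i + ∑ j ∈ Finset.range (i + 1), p₀ j
  have hPm : Monotone P := monotone_nat_of_le_succ fun i => by
    simp only [P, Finset.sum_range_succ _ (i + 1)]
    omega
  have hPi : ∀ i, i ≤ P i := fun i => Nat.le_add_right _ _
  have hPp : ∀ i, p₀ i ≤ P i := fun i =>
    (Finset.single_le_sum (f := p₀) (fun _ _ => Nat.zero_le _)
      (Finset.self_mem_range_succ i)).trans (Nat.le_add_left _ _)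
  have hfac : ∀ i, ∃ C > (0 : ℝ), ∀ z : 𝒵.step (φ i), ∃ y : 𝒴.step (P i),
      (Q.toLinearMap ∘ₗ 𝒴.toLim (P i)) y = 𝒵.toLim (φ i) z ∧ ‖y‖ ≤ C * ‖z‖ := fun i => by
    refine ⟨(‖𝒴.incl (hPp i)‖ + 1) * C₀ i, by have := hC₀ i; positivity, fun z => ?_⟩
    obtain ⟨y, hy, hyn⟩ := hp₀ i z
    refine ⟨𝒴.incl (hPp i) y, ?_, ?_⟩
    · rw [LinearMap.comp_apply, 𝒴.toLim_incl]
      exact hy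
    · calc ‖𝒴.incl (hPp i) y‖ ≤ ‖𝒴.incl (hPp i)‖ * ‖y‖ := ContinuousLinearMap.le_opNorm _ _
        _ ≤ (‖𝒴.incl (hPp i)‖ + 1) * (C₀ i * ‖z‖) := by gcongr; linarith
        _ = _ := by ring
  have hdesc : ∀ i, ∃ τ : 𝒵.step (φ i) → E, (h𝓔.opSpectrum 𝒵).Bdd (φ i) τ ∧
      ∀ z y, Q (𝒴.toLim (P i) y) = 𝒵.toLim (φ i) z →
        τ z = R (P (i + 1)) (𝒴.incl (hPm i.le_succ) y) - R (P i) y := fun i => by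
    obtain ⟨N, D, hD⟩ := h𝓔.exists_lift ((R (P (i + 1))).comp (𝒴.incl (hPm i.le_succ)) - R (P i))
    obtain ⟨C, hC, hz⟩ := hfac i
    obtain ⟨τ, -, hτ⟩ := exists_descend hC.le hz D fun y hy => by
      obtain ⟨x, hx⟩ := (hex _).1 hy
      have h1 := hR _ x y hx
      have h2 := hR _ x (𝒴.incl (hPm i.le_succ) y) (hx.trans (𝒴.toLim_incl _ _).symm)
      refine 𝓔.toLim_injective N ?_
      rw [hD, map_zero]
      simp [h1, h2]
    refine ⟨fun z => 𝓔.toLim N (τ z), h𝓔.opSpectrum_bdd_iff.2 ⟨N, τ, rfl⟩, fun z y hy => ?_⟩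
    exact (congrArg (𝓔.toLim N) (hτ z y hy)).trans (hD y)
  choose f hf hfR using hdesc
  obtain ⟨s, hs, hfs⟩ := hproj f hf
  have hs' : ∀ i, ∃ U : 𝒵.step (φ i) →L[ℂ] E, s i = U := fun i => by
    obtain ⟨N, U, e⟩ := h𝓔.opSpectrum_bdd_iff.1 (hs i)
    exact ⟨(h𝓔.toLimL N).comp U, e⟩
  choose U hU using hs'
  -- This is meant for z representing Q y; for such pairs the value does not change when i grows, by
  -- the choice of U.
  let val : ∀ i, 𝒴.step (P i) → 𝒵.step (φ i) → E := fun i y z => R (P i) y + U i z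
  have hval : ∀ i y z, Q (𝒴.toLim (P i) y) = 𝒵.toLim (φ i) z →
      ∀ k (hk : i ≤ k), val k (𝒴.incl (hPm hk) y) (𝒵.incl (hφ.monotone hk) z) = val i y z := by
    intro i y z hyz k hk
    induction k, hk using Nat.le_induction with
    | base => rw [𝒴.incl_refl, 𝒵.incl_refl]
    | succ k hk ih =>
      rw [← ih]
      have h1 := hfR k (𝒵.incl (hφ.monotone hk) z) (𝒴.incl (hPm hk) y)
        (by rw [𝒴.toLim_incl, 𝒵.toLim_incl, hyz])
      have h2 := congrFun (hfs k) (𝒵.incl (hφ.monotone hk) z)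
      have h3 : f k (𝒵.incl (hφ.monotone hk) z) = U k (𝒵.incl (hφ.monotone hk) z) -
          U (k + 1) (𝒵.incl (hφ.monotone (hk.trans k.le_succ)) z) := by
        rw [h2, ← 𝒵.incl_incl (hφ.monotone hk) (hφ.monotone k.le_succ), ← hU, ← hU]
        rfl
      rw [h1, 𝒴.incl_incl] at h3
      simp only [val]
      rw [sub_eq_sub_iff_add_eq_add] at h3
      exact h3.trans (add_comm _ _)
  have hrep : ∀ p, ∃ i, ∃ hp : p ≤ P i, ∃ q : 𝒴.step p →L[ℂ] 𝒵.step (φ i),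
      ∀ y, 𝒵.toLim (φ i) (q y) = Q (𝒴.toLim p y) := fun p => by
    obtain ⟨n, q, hq⟩ := h𝒵.exists_lift (Q.comp (h𝒴.covers.toLimL p))
    refine ⟨max p n, (le_max_left _ _).trans (hPi _),
      (𝒵.incl ((le_max_right p n).trans hφ.le_apply)).comp q, fun y => ?_⟩
    rw [ContinuousLinearMap.comp_apply, 𝒵.toLim_incl, hq]
    rfl
  have hrep' : ∀ y : Y, ∃ i a b, 𝒴.toLim (P i) a = y ∧ 𝒵.toLim (φ i) b = Q y := fun y => by
    obtain ⟨p, e, rfl⟩ := h𝒴.covers.exhausts y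
    obtain ⟨i, hp, q, hq⟩ := hrep p
    exact ⟨i, 𝒴.incl hp e, q e, 𝒴.toLim_incl _ _, hq e⟩
  have hex' : ∀ y : Y, ∃ e : E, ∀ i a b, 𝒴.toLim (P i) a = y → 𝒵.toLim (φ i) b = Q y →
      e = val i a b := fun y => by
    obtain ⟨i, a, b, ha, hb⟩ := hrep' y
    refine ⟨val i a b, fun j a' b' ha' hb' => ?_⟩
    rw [← hval i a b (by rw [ha, hb]) (max i j) (le_max_left _ _),
      ← hval j a' b' (by rw [ha', hb']) (max i j) (le_max_right _ _)]
    congr 1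
    · exact 𝒴.incl_eq (by rw [𝒴.toLim_incl, 𝒴.toLim_incl, ha, ha'])
    · exact 𝒵.incl_eq (by rw [𝒵.toLim_incl, 𝒵.toLim_incl, hb, hb'])
  choose S₀ hS₀ using hex'
  have hup : ∀ y i a b, 𝒴.toLim (P i) a = y → 𝒵.toLim (φ i) b = Q y → ∀ k, i ≤ k →
      ∃ a b, 𝒴.toLim (P k) a = y ∧ 𝒵.toLim (φ k) b = Q y := fun y i a b ha hb k hk =>
    ⟨𝒴.incl (hPm hk) a, 𝒵.incl (hφ.monotone hk) b, by rw [𝒴.toLim_incl, ha],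
      by rw [𝒵.toLim_incl, hb]⟩
  let S₁ : Y →ₗ[ℂ] E :=
    { toFun := S₀
      map_add' := fun x y => by
        obtain ⟨i, a, b, ha, hb⟩ := hrep' x
        obtain ⟨j, a', b', ha', hb'⟩ := hrep' y
        obtain ⟨a, b, ha, hb⟩ := hup x i a b ha hb (max i j) (le_max_left _ _)
        obtain ⟨a', b', ha', hb'⟩ := hup y j a' b' ha' hb' (max i j) (le_max_right _ _)
        rw [hS₀ x _ a b ha hb, hS₀ y _ a' b' ha' hb',
          hS₀ (x + y) _ (a + a') (b + b') (by rw [map_add, ha, ha']) (by rw [map_add, map_add, hb, hb'])]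
        simp only [val, map_add]
        abel
      map_smul' := fun c x => by
        obtain ⟨i, a, b, ha, hb⟩ := hrep' x
        rw [hS₀ x _ a b ha hb, hS₀ (c • x) _ (c • a) (c • b) (by rw [map_smul, ha])
          (by rw [map_smul, map_smul, hb])]
        simp only [val, map_smul, smul_add, RingHom.id_apply] }
  refine ⟨⟨S₁, h𝒴.continuous_of S₁ fun p => ?_⟩, ?_⟩
  · obtain ⟨i, hp, q, hq⟩ := hrep p
    have h1 : ∀ y, val i (𝒴.incl hp y) (q y) = S₁ (𝒴.toLim p y) := fun y =>
      (hS₀ _ i _ _ (𝒴.toLim_incl _ _) (hq y)).symm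
    exact (((R (P i)).continuous.comp (𝒴.incl hp).continuous).add
      ((U i).continuous.comp q.continuous)).congr h1
  · ext x
    change S₀ (ι x) = T x
    obtain ⟨i, a, b, ha, hb⟩ := hrep' (ι x)
    have h0 : b = 0 := 𝒵.incl_eq (by rw [hb, map_zero]; exact (hex _).2 ⟨x, rfl⟩)
    rw [hS₀ _ i a b ha hb]
    simp only [val, h0, map_zero, add_zero]
    exact hR _ x a ha.symm

theorem IsLocallyAcyclic.isWeaklyAcyclic (h : IsLocallyAcyclic.{u, v, w} E Z)
    {𝓔 : BanachSpectrum E} (h𝓔 : 𝓔.Covers) {𝒵 : BanachSpectrum Z}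
    (h𝒵 : 𝒵.Covers) (hop : PairOp 𝓔 𝒵) : IsWeaklyAcyclic.{u, v, w} E Z := by
  have := continuousSMul_real_of_complex E
  obtain ⟨φ, hφ, hproj⟩ := (hop.splits h𝓔).projOneZero
  intro X Y _ _ _ _ _ _ ι Q hX hY hι hex hQ T
  obtain ⟨-, 𝒴, h𝒴⟩ := id hY
  exact exists_extension_of_local h𝓔 h𝒵 hφ hproj ι Q hex hQ T h𝒴
    (h X Y ι Q hX hY hι hex hQ T 𝒴 h𝒴)

/-- A continuous linear map on the kernel of the surjection is locally an operator of Banach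
spaces. -/
theorem exists_kernel_operator {𝓔 : BanachSpectrum E} (h𝓔 : 𝓔.Covers) {X Y : Type w}
    [AddCommGroup X] [Module ℂ X] [TopologicalSpace X] [AddCommGroup Y] [Module ℂ Y]
    [TopologicalSpace Y] (ι : X →L[ℂ] Y) (Q : Y →L[ℂ] Z) (hX : IsLBSpace X) (hY : IsLBSpace Y)
    (hι : Function.Injective ι) (hex : Function.Exact ι Q) (T : X →L[ℂ] E)
    {𝒴 : BanachSpectrum Y} (h𝒴 : 𝒴.IsLimit) (p : ℕ) :
    ∃ N, ∃ S : (Q.comp (h𝒴.covers.toLimL p)).ker →L[ℂ] 𝓔.step N,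
      ∀ x (y : (Q.comp (h𝒴.covers.toLimL p)).ker), ι x = 𝒴.toLim p y → 𝓔.toLim N (S y) = T x := by
  obtain ⟨_, 𝒳, h𝒳⟩ := hX
  have := hY.1
  have := h𝒴.isTopologicalAddGroup
  have := h𝒴.continuousSMul
  have hcl : IsClosed ((Q.comp (h𝒴.covers.toLimL p)).ker : Set (𝒴.step p)) :=
    (Q.comp (h𝒴.covers.toLimL p)).isClosed_ker
  have : CompleteSpace (Q.comp (h𝒴.covers.toLimL p)).ker := hcl.completeSpace_coe
  let J := (h𝒴.covers.toLimL p).comp (Q.comp (h𝒴.covers.toLimL p)).ker.subtypeL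
  -- The kernel of Q in step p is a Banach space inside ι(X), hence maps boundedly into one step of
  -- X; there T factors through a step of E.
  obtain ⟨q, C, hC, hq⟩ := exists_factor_bound J (fun q => ι.comp (h𝒳.covers.toLimL q)) fun y => by
    obtain ⟨x, hx⟩ := (hex _).1 y.2
    obtain ⟨q, e, rfl⟩ := h𝒳.covers.exhausts x
    exact ⟨q, e, hx⟩
  obtain ⟨N, D, hD⟩ := h𝓔.exists_lift (T.comp (h𝒳.covers.toLimL q))
  obtain ⟨S, -, hS⟩ := exists_descend (J := J.toLinearMap)
    (J' := ι.toLinearMap ∘ₗ 𝒳.toLim q) hC.le hq D fun e he => by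
      have h1 : 𝒳.toLim q e = 0 := hι (he.trans (map_zero _).symm)
      rw [𝒳.toLim_injective q (h1.trans (map_zero _).symm), map_zero]
  refine ⟨N, S, fun x y hxy => ?_⟩
  obtain ⟨e, he, -⟩ := hq y
  rw [hS y e he, hD]
  have h1 : 𝒳.toLim q e = x := hι (he.trans hxy.symm)
  rw [← h1]
  rfl

end Gluing

/-! ### The Banach spaces `ℓ¹(a)` and `ℓ^∞(a)` -/

namespace WeightedLp

variable {I : Type*} {p : ℝ≥0∞} [Fact (1 ≤ p)] (a : PosWeight I)

theorem weight_pos (j : I) : (0 : ℝ) < a j := (a j).2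

theorem norm_weight_mul (j : I) (x : ℂ) : ‖((a j : ℝ) : ℂ) * x‖ = a j * ‖x‖ := by
  rw [norm_mul, Complex.norm_of_nonneg (weight_pos a j).le]

/-- `c ↦ a c` as an isometry. -/
def isometryEquiv (p : ℝ≥0∞) [Fact (1 ≤ p)] (a : PosWeight I) :
    WeightedLp p a ≃ₗᵢ[ℂ] lp (fun _ : I => ℂ) p :=
  LinearIsometryEquiv.mk (mulWeight p a) fun _ => rfl

theorem isometryEquiv_apply (c : WeightedLp p a) (j : I) :
    isometryEquiv p a c j = ((a j : ℝ) : ℂ) * c.val j := rfl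

theorem weight_mul_norm_le (c : WeightedLp p a) (j : I) : a j * ‖c.val j‖ ≤ ‖c‖ := by
  rw [← norm_weight_mul]
  exact lp.norm_apply_le_norm (zero_lt_one.trans_le (Fact.out : 1 ≤ p)).ne' (mulWeight p a c) j

open Classical in
/-- The unit vectors. -/
def unit (p : ℝ≥0∞) [Fact (1 ≤ p)] (a : PosWeight I) (j : I) : WeightedLp p a :=
  (isometryEquiv p a).symm (lp.single p j ((a j : ℝ) : ℂ))

theorem norm_unit (j : I) : ‖unit p a j‖ = a j := by
  classical
  rw [unit, LinearIsometryEquiv.norm_map,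
    lp.norm_single (zero_lt_one.trans_le (Fact.out : 1 ≤ p)),
    Complex.norm_of_nonneg (weight_pos a j).le]

open Classical in
theorem val_unit (j : I) : (unit p a j).val = Pi.single j 1 := by
  funext i
  have h : ((a i : ℝ) : ℂ) * (unit p a j).val i = lp.single (E := fun _ : I => ℂ) p j ((a j : ℝ) : ℂ) i := by
    rw [← isometryEquiv_apply, unit, LinearIsometryEquiv.apply_symm_apply]
  refine mul_left_cancel₀ (weight_ne_zero a i) (h.trans ?_)
  rw [lp.single_apply]
  rcases eq_or_ne i j with rfl | hij
  · simp
  · simp [hij]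

theorem hasSum_unit (c : WeightedLp 1 a) : HasSum (fun j => c.val j • unit 1 a j) c := by
  classical
  have h := lp.hasSum_single (E := fun _ : I => ℂ) (p := 1) ENNReal.one_ne_top
    (isometryEquiv 1 a c)
  have h' := h.mapL (isometryEquiv 1 a).symm.toContinuousLinearEquiv.toContinuousLinearMap
  have e : (isometryEquiv 1 a).symm.toContinuousLinearEquiv.toContinuousLinearMap
      (isometryEquiv 1 a c) = c := (isometryEquiv 1 a).symm_apply_apply c
  rw [e] at h'
  convert h' using 2 with j
  change _ = (isometryEquiv 1 a).symm (lp.single 1 j (isometryEquiv 1 a c j))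
  rw [isometryEquiv_apply, mul_comm, ← smul_eq_mul, lp.single_smul, map_smul, unit]

theorem summable_norm (c : WeightedLp 1 a) : HasSum (fun j => a j * ‖c.val j‖) ‖c‖ := by
  have h := lp.hasSum_norm (p := 1) (by simp) (isometryEquiv 1 a c)
  simpa only [isometryEquiv_apply, norm_weight_mul, LinearIsometryEquiv.norm_map,
    ENNReal.toReal_one, Real.rpow_one] using h

theorem ext_unit {G : Type*} [AddCommGroup G] [Module ℂ G] [TopologicalSpace G] [T2Space G]
    {S T : WeightedLp 1 a →L[ℂ] G} (h : ∀ j, S (unit 1 a j) = T (unit 1 a j)) : S = T := by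
  ext c
  have h1 := (hasSum_unit a c).mapL S
  have h2 := (hasSum_unit a c).mapL T
  simp only [map_smul, h] at h1 h2
  exact h1.unique h2

variable {G : Type*} [NormedAddCommGroup G] [NormedSpace ℂ G]

/-- Operators on `ℓ¹(a)` are given by their columns. -/
theorem exists_operator_one [CompleteSpace G] {C : ℝ} (hC : 0 ≤ C) (g : I → G)
    (hg : ∀ j, ‖g j‖ ≤ C * a j) :
    ∃ T : WeightedLp 1 a →L[ℂ] G, ‖T‖ ≤ C ∧ ∀ j, T (unit 1 a j) = g j := by
  classical
  have hb : ∀ (c : WeightedLp 1 a) j, ‖c.val j • g j‖ ≤ C * (a j * ‖c.val j‖) := fun c j => by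
    rw [norm_smul]
    calc ‖c.val j‖ * ‖g j‖ ≤ ‖c.val j‖ * (C * a j) := by gcongr; exact hg j
      _ = _ := by ring
  have hs : ∀ c : WeightedLp 1 a, Summable fun j => c.val j • g j := fun c =>
    Summable.of_norm_bounded ((summable_norm a c).summable.mul_left C) (hb c)
  let T : WeightedLp 1 a →ₗ[ℂ] G :=
    { toFun := fun c => ∑' j, c.val j • g j
      map_add' := fun c d => by
        rw [← (hs c).tsum_add (hs d)]
        simp only [val_add, Pi.add_apply, add_smul]
      map_smul' := fun r c => by
        rw [RingHom.id_apply, ← (hs c).tsum_const_smul r]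
        simp only [val_smul, Pi.smul_apply, smul_assoc] }
  refine ⟨T.mkContinuous C fun c => ?_, T.mkContinuous_norm_le hC _, fun j => ?_⟩
  · exact tsum_of_norm_bounded ((summable_norm a c).mul_left C) (hb c)
  · change ∑' i, (unit 1 a j).val i • g i = g j
    rw [val_unit, tsum_eq_single j fun i hi => by rw [Pi.single_eq_of_ne hi, zero_smul],
      Pi.single_eq_same, one_smul]

/-- The coordinates. -/
def coord (p : ℝ≥0∞) [Fact (1 ≤ p)] (a : PosWeight I) (j : I) : WeightedLp p a →L[ℂ] ℂ :=
  LinearMap.mkContinuous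
    { toFun := fun c => c.val j
      map_add' := fun _ _ => rfl
      map_smul' := fun _ _ => rfl } (a j : ℝ)⁻¹ fun c => by
    rw [inv_mul_eq_div, le_div_iff₀ (weight_pos a j), mul_comm]
    exact weight_mul_norm_le a c j

theorem norm_le_of_forall {C : ℝ} (hC : 0 ≤ C) (c : WeightedLp ∞ a)
    (h : ∀ j, a j * ‖c.val j‖ ≤ C) : ‖c‖ ≤ C :=
  lp.norm_le_of_forall_le (f := mulWeight ∞ a c) hC fun j => by
    change ‖((a j : ℝ) : ℂ) * c.val j‖ ≤ C
    rw [norm_weight_mul]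
    exact h j

theorem mem_infty {c : I → ℂ} {C : ℝ} (h : ∀ j, a j * ‖c j‖ ≤ C) :
    c ∈ weightedLpSubmodule ∞ a := by
  refine memℓp_infty ⟨C, ?_⟩
  rintro _ ⟨j, rfl⟩
  exact (norm_weight_mul a j (c j)).trans_le (h j)

/-- Operators into `ℓ^∞(a)` are given by their coordinates. -/
theorem exists_operator_infty {C : ℝ} (hC : 0 ≤ C) (f : I → G →L[ℂ] ℂ)
    (hf : ∀ j, a j * ‖f j‖ ≤ C) :
    ∃ T : G →L[ℂ] WeightedLp ∞ a, ‖T‖ ≤ C ∧ ∀ j x, (T x).val j = f j x := by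
  have hb : ∀ x j, a j * ‖f j x‖ ≤ C * ‖x‖ := fun x j => by
    have := weight_pos a j
    calc a j * ‖f j x‖ ≤ a j * (‖f j‖ * ‖x‖) := by gcongr; exact (f j).le_opNorm x
      _ = a j * ‖f j‖ * ‖x‖ := by ring
      _ ≤ C * ‖x‖ := by gcongr; exact hf j
  let T : G →ₗ[ℂ] WeightedLp ∞ a :=
    { toFun := fun x => ⟨fun j => f j x, mem_infty a (hb x)⟩
      map_add' := fun x y => WeightedLp.ext (by funext j; simp)
      map_smul' := fun r x => WeightedLp.ext (by funext j; simp) }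
  exact ⟨T.mkContinuous C fun x => norm_le_of_forall a (by positivity) _ (hb x),
    T.mkContinuous_norm_le hC _, fun j x => rfl⟩

end WeightedLp

/-! ### Transport of spectra -/

namespace BanachSpectrum

variable {X Y : Type u} [AddCommGroup X] [Module ℂ X] [TopologicalSpace X]
  [AddCommGroup Y] [Module ℂ Y] [TopologicalSpace Y]

/-- The spectrum transported by an isomorphism. -/
def transport (e : X ≃L[ℂ] Y) (𝒴 : BanachSpectrum Y) : BanachSpectrum X where
  step := 𝒴.step
  toLim n := e.symm.toLinearEquiv.toLinearMap ∘ₗ 𝒴.toLim n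
  toLim_injective n := e.symm.injective.comp (𝒴.toLim_injective n)
  incl := 𝒴.incl
  toLim_incl h x := congrArg e.symm (𝒴.toLim_incl h x)

theorem Covers.transport {𝒴 : BanachSpectrum Y} (h : 𝒴.Covers) (e : X ≃L[ℂ] Y) :
    (𝒴.transport e).Covers where
  continuous n := e.symm.continuous.comp (h.continuous n)
  exhausts x := by
    obtain ⟨n, y, hy⟩ := h.exhausts (e x)
    exact ⟨n, y, by change e.symm (𝒴.toLim n y) = x; rw [hy, e.symm_apply_apply]⟩

end BanachSpectrum

theorem kSpectrum_isLimit {I : Type u} (p : ℝ≥0∞) [Fact (1 ≤ p)] (A : CoechelonMatrix I) :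
    (kSpectrum p A).IsLimit := by
  refine ⟨fun x => ?_, rfl⟩
  obtain ⟨n, hn⟩ := Set.mem_iUnion.1 x.mem
  exact ⟨n, ⟨x.val, hn⟩, rfl⟩

/-! ### Criteria for local acyclicity -/

section LocallyAcyclic

variable {E : Type u} [AddCommGroup E] [Module ℂ E] [TopologicalSpace E] [IsTopologicalAddGroup E]
  [ContinuousSMul ℂ E] [LocallyConvexSpace ℝ E] [T2Space E]
  {Z : Type v} [AddCommGroup Z] [Module ℂ Z] [TopologicalSpace Z] [IsTopologicalAddGroup Z]
  [ContinuousSMul ℂ Z] [LocallyConvexSpace ℝ Z] [T2Space Z]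

/-- On the kernel of Q in a step of Y, T is an operator into a step of E, and this operator is
extended to the whole step. -/
theorem isLocallyAcyclic_of_extends {𝓔 : BanachSpectrum E} (h𝓔 : 𝓔.Covers)
    (hext : ∀ (F : Type w) [NormedAddCommGroup F] [NormedSpace ℂ F] [CompleteSpace F]
      (W : Submodule ℂ F) (N : ℕ) (T : W →L[ℂ] 𝓔.step N),
      ∃ S : F →L[ℂ] E, ∀ x : W, S x = 𝓔.toLim N (T x)) : IsLocallyAcyclic.{u, v, w} E Z := by
  intro X Y _ _ _ _ _ _ ι Q hX hY hι hex hQ T 𝒴 h𝒴 p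
  obtain ⟨N, S, hS⟩ := exists_kernel_operator h𝓔 ι Q hX hY hι hex T h𝒴 p
  obtain ⟨R, hR⟩ := hext _ _ N S
  exact ⟨R, fun x y hxy => by
    rw [← hS x ⟨y, by
      change Q (𝒴.toLim p y) = 0
      rw [← hxy]
      exact (hex _).2 ⟨x, rfl⟩⟩ hxy, ← hR]⟩

/-- If σ lifts a step of Z containing Q(Y_p), then y − σ (Q y) lies in the kernel of Q, where T
makes sense. The map y ↦ T (y − σ (Q y)) extends T since Q ∘ ι = 0. -/
theorem isLocallyAcyclic_of_lifts (hE : IsLocallyComplete E) {B : ℕ → Set E}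
    (hB : IsFundamentalBoundedSeq B) {𝒵 : BanachSpectrum Z} (h𝒵 : 𝒵.Covers)
    (hlift : ∀ (Y : Type w) [AddCommGroup Y] [Module ℂ Y] [TopologicalSpace Y] (Q : Y →L[ℂ] Z)
      (𝒴 : BanachSpectrum Y), 𝒴.Covers → Function.Surjective Q → ∀ n, ∃ p,
      ∃ σ : 𝒵.step n →L[ℂ] 𝒴.step p, ∀ z, Q (𝒴.toLim p (σ z)) = 𝒵.toLim n z) :
    IsLocallyAcyclic.{u, v, w} E Z := by
  intro X Y _ _ _ _ _ _ ι Q hX hY hι hex hQ T 𝒴 h𝒴 p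
  obtain ⟨𝓔, h𝓔⟩ := hE.exists_regular hB
  obtain ⟨n, q, hq⟩ := h𝒵.exists_lift (Q.comp (h𝒴.covers.toLimL p))
  obtain ⟨p', σ, hσ⟩ := hlift Y Q 𝒴 h𝒴.covers hQ n
  obtain ⟨N, S, hS⟩ :=
    exists_kernel_operator h𝓔.toCovers ι Q hX hY hι hex T h𝒴 (max p p')
  let D : 𝒴.step p →L[ℂ] 𝒴.step (max p p') :=
    𝒴.incl (le_max_left _ _) - (𝒴.incl (le_max_right _ _)).comp (σ.comp q)
  have hD : ∀ y, D y ∈ (Q.comp (h𝒴.covers.toLimL (max p p'))).ker := fun y => by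
    change Q (𝒴.toLim _ (𝒴.incl _ y - 𝒴.incl _ (σ (q y)))) = 0
    rw [map_sub, 𝒴.toLim_incl, 𝒴.toLim_incl, map_sub, hσ, hq]
    exact sub_self _
  refine ⟨(h𝓔.toLimL N).comp (S.comp (D.codRestrict _ hD)), fun x y hxy => ?_⟩
  have hqy : q y = 0 := 𝒵.incl_eq (by
    rw [hq, map_zero]
    change Q (𝒴.toLim p y) = 0
    rw [← hxy]
    exact (hex _).2 ⟨x, rfl⟩)
  refine hS x _ ?_
  change ι x = 𝒴.toLim _ (𝒴.incl _ y - 𝒴.incl _ (σ (q y)))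
  rw [hqy, map_zero, map_zero, sub_zero, 𝒴.toLim_incl, hxy]

end LocallyAcyclic

/-! ### The spaces `k¹(A)` -/

theorem CoechelonMatrix.incl_unit {I : Type*} (A : CoechelonMatrix I) (p : ℝ≥0∞) [Fact (1 ≤ p)]
    {n m : ℕ} (h : n ≤ m) (j : I) :
    A.incl p h (WeightedLp.unit p (A.weight n) j) = WeightedLp.unit p (A.weight m) j :=
  WeightedLp.ext ((WeightedLp.val_unit _ j).trans (WeightedLp.val_unit _ j).symm)

/-- The unit vectors in the steps of `k^p(A)`. -/
def CoechelonMatrix.kUnit {I : Type*} (A : CoechelonMatrix I) (p : ℝ≥0∞) [Fact (1 ≤ p)] (n : ℕ)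
    (j : I) : (kSpectrum p A).step n :=
  WeightedLp.unit p (A.weight n) j

theorem CoechelonMatrix.norm_kUnit {I : Type*} (A : CoechelonMatrix I) (p : ℝ≥0∞) [Fact (1 ≤ p)]
    (n : ℕ) (j : I) : ‖A.kUnit p n j‖ = A.weight n j :=
  WeightedLp.norm_unit _ j

theorem CoechelonMatrix.incl_kUnit {I : Type*} (A : CoechelonMatrix I) (p : ℝ≥0∞) [Fact (1 ≤ p)]
    {n m : ℕ} (h : n ≤ m) (j : I) : (kSpectrum p A).incl h (A.kUnit p n j) = A.kUnit p m j :=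
  A.incl_unit p h j

theorem exists_continuousLinearMap_eq_one {E : Type*} [AddCommGroup E] [Module ℂ E]
    [TopologicalSpace E] [IsTopologicalAddGroup E] [ContinuousSMul ℂ E] [LocallyConvexSpace ℝ E]
    [T2Space E] {b : E} (hb : b ≠ 0) : ∃ y : E →L[ℂ] ℂ, y b = 1 := by
  have := continuousSMul_real_of_complex E
  obtain ⟨f, hf⟩ := SeparatingDual.exists_ne_zero (R := ℝ) hb
  let g : E →L[ℂ] ℂ := StrongDual.extendRCLike f
  have hg : g b ≠ 0 := fun h => hf (by
    rw [← StrongDual.re_extendRCLike_apply (𝕜 := ℂ) f b]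
    exact congrArg Complex.re h)
  exact ⟨(g b)⁻¹ • g, by simp [hg]⟩

section KOne

variable {E : Type u} [AddCommGroup E] [Module ℂ E] [TopologicalSpace E] [IsTopologicalAddGroup E]
  [ContinuousSMul ℂ E] [LocallyConvexSpace ℝ E] [T2Space E]
  {Z : Type v} [AddCommGroup Z] [Module ℂ Z] [TopologicalSpace Z] [IsTopologicalAddGroup Z]
  [ContinuousSMul ℂ Z] [LocallyConvexSpace ℝ Z] [T2Space Z] {I : Type v} (A : CoechelonMatrix I)

/-- An operator on ℓ¹(a) is the same as a family of columns of norm at most C a(j). Hence (S) for z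
= e_j and b = T e_j / a_m(j) splits T column by column, with the right bounds. -/
theorem PairS.pairOp_kOne {𝓔 : BanachSpectrum E} (h𝓔 : 𝓔.Covers)
    (h : PairS 𝓔 (kSpectrum 1 A)) : PairOp 𝓔 (kSpectrum 1 A) := by
  intro n
  obtain ⟨m, hnm, h⟩ := h n
  refine ⟨m, hnm, fun k hmk => ?_⟩
  obtain ⟨N, h⟩ := h k hmk
  refine ⟨N, fun M hM ε hε => ?_⟩
  obtain ⟨K, hK, C, hC, h⟩ := h M hM ε hε
  refine ⟨K, C, hC, fun (T : (kSpectrum 1 A).step m →L[ℂ] 𝓔.step M) hT => ?_⟩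
  have ha : ∀ n j, (0 : ℝ) < A.weight n j := fun n j => (A.weight n j).2
  have key : ∀ j, ∃ (u : 𝓔.step K) (v : 𝓔.step N),
      𝓔.toLim M (T (A.kUnit 1 m j)) = 𝓔.toLim K u + 𝓔.toLim N v ∧
      ‖u‖ ≤ C * A.weight k j ∧ ‖v‖ ≤ ε * A.weight n j := fun j => by
    obtain ⟨u, v, huv, hu, hv⟩ := h (A.kUnit 1 n j)
      ((A.weight m j : ℝ)⁻¹ • T (A.kUnit 1 m j))
    have hb : ‖(A.weight m j : ℝ)⁻¹ • T (A.kUnit 1 m j)‖ ≤ 1 := by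
      rw [norm_smul, norm_inv, Real.norm_of_nonneg (ha m j).le, inv_mul_le_iff₀ (ha m j), mul_one]
      refine (T.le_of_opNorm_le hT _).trans ?_
      rw [one_mul, A.norm_kUnit]
    rw [A.incl_kUnit, A.norm_kUnit] at hu
    rw [A.norm_kUnit] at hv
    rw [A.incl_kUnit, A.norm_kUnit, ← 𝓔.toLim_real_smul, smul_inv_smul₀ (ha m j).ne'] at huv
    refine ⟨u, v, huv, hu.trans ?_, hv.trans ?_⟩
    · exact mul_le_of_le_one_right (by have := ha k j; positivity) hb
    · exact mul_le_of_le_one_right (by have := ha n j; positivity) hb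
  choose u v huv hu hv using key
  obtain ⟨U, hU, hUu⟩ := WeightedLp.exists_operator_one (A.weight k) hC.le u hu
  obtain ⟨V, hV, hVv⟩ := WeightedLp.exists_operator_one (A.weight n) hε.le v hv
  have hV' : ∃ V' : (kSpectrum 1 A).step n →L[ℂ] 𝓔.step N, V' = V := ⟨V, rfl⟩
  obtain ⟨V, rfl⟩ := hV'
  refine ⟨U, V, hU, hV, fun z => ?_⟩
  have hLR : (h𝓔.toLimL M).comp (T.comp ((kSpectrum 1 A).incl hnm)) =
      (h𝓔.toLimL K).comp (U.comp ((kSpectrum 1 A).incl (hnm.trans hmk))) +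
        (h𝓔.toLimL N).comp V := by
    refine WeightedLp.ext_unit _ fun j => ?_
    change 𝓔.toLim M (T ((kSpectrum 1 A).incl hnm (A.kUnit 1 n j))) =
      𝓔.toLim K (U ((kSpectrum 1 A).incl (hnm.trans hmk) (A.kUnit 1 n j))) +
        𝓔.toLim N (V (A.kUnit 1 n j))
    rw [A.incl_kUnit, A.incl_kUnit, huv]
    exact congrArg₂ _ (congrArg _ (hUu j).symm) (congrArg _ (hVv j).symm)
  exact DFunLike.congr_fun hLR z

/-- Projectivity of ℓ¹: bounded lifts of the unit vectors determine a lift of the step. -/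
theorem exists_lift_kOne (e : Z ≃L[ℂ] KSpace 1 A) (Y : Type w) [AddCommGroup Y] [Module ℂ Y]
    [TopologicalSpace Y] (Q : Y →L[ℂ] Z) (𝒴 : BanachSpectrum Y) (h𝒴 : 𝒴.Covers)
    (hQ : Function.Surjective Q) (n : ℕ) : ∃ p,
      ∃ σ : ((kSpectrum 1 A).transport e).step n →L[ℂ] 𝒴.step p,
        ∀ z, Q (𝒴.toLim p (σ z)) = ((kSpectrum 1 A).transport e).toLim n z := by
  let h𝒵 := (kSpectrum_isLimit 1 A).covers.transport e
  obtain ⟨p, C, hC, hp⟩ := h𝒴.exists_lift_bound Q hQ (h𝒵.toLimL n)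
  choose y hy hyn using fun j => hp (WeightedLp.unit 1 (A.weight n) j)
  obtain ⟨σ, -, hσ⟩ := WeightedLp.exists_operator_one (A.weight n) hC.le y fun j =>
    (hyn j).trans_eq (congrArg (C * ·) (WeightedLp.norm_unit _ j))
  refine ⟨p, σ, fun z => ?_⟩
  have hLR : (Q.comp (h𝒴.toLimL p)).comp σ =
      (h𝒵.toLimL n : WeightedLp 1 (A.weight n) →L[ℂ] Z) :=
    WeightedLp.ext_unit _ fun j => by
      rw [ContinuousLinearMap.comp_apply, hσ]
      exact hy j
  exact DFunLike.congr_fun hLR z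

/-- The operator with columns a_m(j) b, for one fixed b ≠ 0, is split with a small error. Applying a
functional with value 1 at b gives a_m(j) ≤ C a_k(j) + ε a_n(j) for all j; multiplication by |z_j|
and summation give the norms. -/
theorem normInterpolation_kOne {𝓔 : BanachSpectrum E} (h𝓔 : 𝓔.Covers) [Nontrivial E]
    (hS : ∀ φ hφ, (h𝓔.opSpectrum (kSpectrum 1 A)).ProjOneZero φ hφ) :
    NormInterpolation (kSpectrum 1 A) := by
  intro n
  obtain ⟨m, hnm, h⟩ := exists_operator_split h𝓔 hS n
  refine ⟨m, hnm, fun k hmk ε hε => ?_⟩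
  obtain ⟨N, h⟩ := h k hmk
  obtain ⟨x, hx⟩ := exists_ne (0 : E)
  obtain ⟨y, hy⟩ := exists_continuousLinearMap_eq_one hx
  obtain ⟨M₀, b₀, hb₀⟩ := h𝓔.exhausts x
  let b : 𝓔.step (max N M₀) := 𝓔.incl (le_max_right _ _) b₀
  have hb : 𝓔.toLim _ b = x := (𝓔.toLim_incl _ _).trans hb₀
  have ha : ∀ n j, (0 : ℝ) < A.weight n j := fun n j => (A.weight n j).2
  obtain ⟨T, -, hT⟩ := WeightedLp.exists_operator_one (A.weight m) (norm_nonneg b)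
    (fun j => (A.weight m j : ℝ) • b) fun j => by
      rw [norm_smul, Real.norm_of_nonneg (ha m j).le, mul_comm]
  obtain ⟨K, U, V, hV, hUV⟩ := h _ (le_max_left N M₀) T (ε / (‖y.comp (h𝓔.toLimL N)‖ + 1))
    (by positivity)
  have key : ∀ j, (A.weight m j : ℝ) ≤
      (‖(y.comp (h𝓔.toLimL K)).comp U‖ + 1) * A.weight k j + ε * A.weight n j := fun j => by
    have h1 := congrArg y (hUV (A.kUnit 1 n j))
    rw [map_add] at h1
    rw [A.incl_kUnit, A.incl_kUnit] at h1
    have e3 : y (𝓔.toLim _ (T (A.kUnit 1 m j))) = (A.weight m j : ℝ) := by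
      rw [show T (A.kUnit 1 m j) = _ from hT j, 𝓔.toLim_real_smul, hb]
      rw [← Complex.coe_smul, map_smul, hy, smul_eq_mul, mul_one]
    have h2 := congrArg norm (e3.symm.trans h1)
    rw [Complex.norm_of_nonneg (ha m j).le] at h2
    rw [h2]
    refine (norm_add_le _ _).trans (add_le_add ?_ ?_)
    · refine (((y.comp (h𝓔.toLimL K)).comp U).le_opNorm _).trans ?_
      rw [A.norm_kUnit]
      have := ha k j
      gcongr
      linarith
    · refine ((y.comp (h𝓔.toLimL N)).le_opNorm _).trans ?_
      have h3 := V.le_of_opNorm_le hV (A.kUnit 1 n j)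
      rw [A.norm_kUnit] at h3
      have := ha n j
      calc ‖y.comp (h𝓔.toLimL N)‖ * ‖V (A.kUnit 1 n j)‖
          ≤ (‖y.comp (h𝓔.toLimL N)‖ + 1) *
            (ε / (‖y.comp (h𝓔.toLimL N)‖ + 1) * A.weight n j) := by
            gcongr
            linarith
        _ = ε * A.weight n j := by field_simp
  refine ⟨‖(y.comp (h𝓔.toLimL K)).comp U‖ + 1, by positivity,
    fun (z : WeightedLp 1 (A.weight n)) => ?_⟩
  have hm := WeightedLp.summable_norm _ (A.incl 1 hnm z)
  have hk := WeightedLp.summable_norm _ (A.incl 1 (hnm.trans hmk) z)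
  have hn := WeightedLp.summable_norm _ z
  refine hasSum_le (fun j => ?_) hm
    ((hk.mul_left (‖(y.comp (h𝓔.toLimL K)).comp U‖ + 1)).add (hn.mul_left ε))
  change (A.weight m j : ℝ) * ‖z.val j‖ ≤ _ * (A.weight k j * ‖z.val j‖) + _
  refine (mul_le_mul_of_nonneg_right (key j) (norm_nonneg (z.val j))).trans_eq ?_
  change _ = _ + ε * (A.weight n j * ‖z.val j‖)
  ring

end KOne

/-! ### The spaces `k^∞(A)` -/

/-- A functional dominated by a sum of two norms is a sum of functionals dominated by the norms. -/
theorem exists_functional_split {F G H : Type*} [AddCommGroup F] [Module ℂ F]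
    [NormedAddCommGroup G] [NormedSpace ℂ G] [NormedAddCommGroup H] [NormedSpace ℂ H]
    (f : F →ₗ[ℂ] ℂ) (i : F →ₗ[ℂ] G) (j : F →ₗ[ℂ] H) {α β : ℝ} (hα : 0 ≤ α) (hβ : 0 ≤ β)
    (h : ∀ x, ‖f x‖ ≤ α * ‖i x‖ + β * ‖j x‖) :
    ∃ (g : G →L[ℂ] ℂ) (l : H →L[ℂ] ℂ), ‖g‖ ≤ α ∧ ‖l‖ ≤ β ∧ ∀ x, f x = g (i x) + l (j x) := by
  -- On the range of (i, j) in G × H, f induces a functional dominated by q; its Hahn–Banach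
  -- extension restricts to g and l on the two factors.
  let q : Seminorm ℂ (G × H) :=
    α.toNNReal • (normSeminorm ℂ G).comp (LinearMap.fst ℂ G H) +
      β.toNNReal • (normSeminorm ℂ H).comp (LinearMap.snd ℂ G H)
  have hq : ∀ x, q x = α * ‖x.1‖ + β * ‖x.2‖ := fun x => by
    change (α.toNNReal : ℝ) * ‖x.1‖ + (β.toNNReal : ℝ) * ‖x.2‖ = _
    rw [Real.coe_toNNReal _ hα, Real.coe_toNNReal _ hβ]
  have hqc : Continuous q := by
    have : (q : G × H → ℝ) = fun x => α * ‖x.1‖ + β * ‖x.2‖ := funext hq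
    rw [this]
    fun_prop
  have hker : ∀ x, i.prod j x = 0 → f x = 0 := fun x hx => by
    have h1 : i x = 0 := congrArg Prod.fst hx
    have h2 : j x = 0 := congrArg Prod.snd hx
    have := h x
    rw [h1, h2, norm_zero, norm_zero, mul_zero, mul_zero, add_zero] at this
    exact norm_le_zero_iff.1 this
  have hsurj : ∀ x : LinearMap.range (i.prod j), ∃ y, i.prod j y = x := fun x => x.2
  choose s hs using hsurj
  have hfs : ∀ (x : LinearMap.range (i.prod j)) y, i.prod j y = x → f (s x) = f y :=
    fun x y hy => by
      rw [← sub_eq_zero, ← map_sub]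
      exact hker _ (by rw [map_sub, hs, hy, sub_self])
  let f₀ : LinearMap.range (i.prod j) →ₗ[ℂ] ℂ :=
    { toFun := fun x => f (s x)
      map_add' := fun x y => by
        rw [← map_add]
        exact hfs _ _ (by rw [map_add, hs, hs]; rfl)
      map_smul' := fun c x => by
        rw [RingHom.id_apply, ← map_smul]
        exact hfs _ _ (by rw [map_smul, hs]; rfl) }
  obtain ⟨F₀, hF, hFq⟩ := Module.Dual.exists_continuous_extension_of_le_seminorm _ f₀ hqc
    fun x => by
      refine (h (s x)).trans_eq ?_
      rw [hq, ← hs x]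
      rfl
  refine ⟨F₀.comp (ContinuousLinearMap.inl ℂ G H), F₀.comp (ContinuousLinearMap.inr ℂ G H),
    ContinuousLinearMap.opNorm_le_bound _ hα fun x => ?_,
    ContinuousLinearMap.opNorm_le_bound _ hβ fun x => ?_, fun x => ?_⟩
  · refine (hFq (x, 0)).trans_eq ?_
    rw [hq]
    simp
  · refine (hFq (0, x)).trans_eq ?_
    rw [hq]
    simp
  · have h1 := hF ⟨i.prod j x, x, rfl⟩
    have h2 : f₀ ⟨i.prod j x, x, rfl⟩ = f x := hfs _ x rfl
    rw [← h2, ← h1, ContinuousLinearMap.comp_apply, ContinuousLinearMap.comp_apply, ← map_add]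
    simp

section KInfty

variable {E : Type u} [AddCommGroup E] [Module ℂ E] [TopologicalSpace E] [IsTopologicalAddGroup E]
  [ContinuousSMul ℂ E] [LocallyConvexSpace ℝ E] [T2Space E]
  {Z : Type v} [AddCommGroup Z] [Module ℂ Z] {I : Type u} (A : CoechelonMatrix I)

/-- A splitting in `k^∞(A)` of multiples of a unit vector bounds its coefficient. -/
theorem le_of_unit_split {K N M : ℕ} {j : I} {r α β : ℝ} (hr : 0 ≤ r)
    {u : WeightedLp ∞ (A.weight K)} {v : WeightedLp ∞ (A.weight N)}
    (h : r • (kSpectrum ∞ A).toLim M (A.kUnit ∞ M j) =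
      (kSpectrum ∞ A).toLim K u + (kSpectrum ∞ A).toLim N v)
    (hu : ‖u‖ ≤ α) (hv : ‖v‖ ≤ β) : r ≤ α / A.weight K j + β / A.weight N j := by
  classical
  have h1 : (r : ℂ) • (Pi.single j 1 : I → ℂ) = u.val + v.val := by
    rw [← WeightedLp.val_unit (p := ∞) (A.weight M) j]
    exact congrArg KSpace.val ((Complex.coe_smul r _).trans h)
  have h2 := congrArg norm (congrFun h1 j)
  rw [Pi.smul_apply, Pi.single_eq_same, smul_eq_mul, mul_one, Complex.norm_of_nonneg hr] at h2
  rw [h2]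
  refine (norm_add_le _ _).trans (add_le_add ?_ ?_)
  · rw [le_div_iff₀ (A.weight K j).2, mul_comm]
    exact (WeightedLp.weight_mul_norm_le _ u j).trans hu
  · rw [le_div_iff₀ (A.weight N j).2, mul_comm]
    exact (WeightedLp.weight_mul_norm_le _ v j).trans hv

/-- For b = e_j, (S) bounds ‖z‖_m / a_M(j) by C‖z‖_k / a_K(j) + ε‖z‖_n / a_N(j). The j-th coordinate
of T is at most ‖z‖_m / a_M(j), so Hahn–Banach splits it into functionals of norms C / a_K(j) and ε
/ a_N(j), and these are the coordinates of operators into ℓ^∞ steps. -/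
theorem PairS.pairOp_kInfty {𝒵 : BanachSpectrum Z} (h : PairS (kSpectrum ∞ A) 𝒵) :
    PairOp (kSpectrum ∞ A) 𝒵 := by
  intro n
  obtain ⟨m, hnm, h⟩ := h n
  refine ⟨m, hnm, fun k hmk => ?_⟩
  obtain ⟨N, h⟩ := h k hmk
  refine ⟨N, fun M hM ε hε => ?_⟩
  obtain ⟨K, hK, C, hC, h⟩ := h M hM ε hε
  refine ⟨K, C, hC, fun (T : 𝒵.step m →L[ℂ] WeightedLp ∞ (A.weight M)) hT => ?_⟩
  have ha : ∀ n j, (0 : ℝ) < A.weight n j := fun n j => (A.weight n j).2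
  have key : ∀ j, ∃ (g : 𝒵.step k →L[ℂ] ℂ) (l : 𝒵.step n →L[ℂ] ℂ),
      ‖g‖ ≤ C / A.weight K j ∧ ‖l‖ ≤ ε / A.weight N j ∧
      ∀ z, (T (𝒵.incl hnm z)).val j = g (𝒵.incl (hnm.trans hmk) z) + l z := fun j => by
    refine exists_functional_split
      ((WeightedLp.coord ∞ (A.weight M) j).comp (T.comp (𝒵.incl hnm))).toLinearMap
      (𝒵.incl (hnm.trans hmk)).toLinearMap LinearMap.id (div_nonneg hC.le (ha K j).le)
      (div_nonneg hε.le (ha N j).le) fun z => ?_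
    obtain ⟨u, v, huv, hu, hv⟩ := h z (A.kUnit ∞ M j)
    rw [A.norm_kUnit] at hu hv
    have h1 := le_of_unit_split A (norm_nonneg _) huv hu hv
    have h2 : A.weight M j * ‖(T (𝒵.incl hnm z)).val j‖ ≤ ‖𝒵.incl hnm z‖ :=
      (WeightedLp.weight_mul_norm_le _ _ j).trans
        ((T.le_of_opNorm_le hT _).trans_eq (one_mul _))
    have h3 := h2.trans h1
    change ‖(T (𝒵.incl hnm z)).val j‖ ≤ C / A.weight K j * ‖𝒵.incl (hnm.trans hmk) z‖ +
      ε / A.weight N j * ‖z‖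
    refine le_of_mul_le_mul_left (h3.trans_eq ?_) (ha M j)
    ring
  choose g l hg hl hgl using key
  obtain ⟨U, hU, hUg⟩ := WeightedLp.exists_operator_infty (A.weight K) hC.le g fun j => by
    rw [mul_comm, ← le_div_iff₀ (ha K j)]
    exact hg j
  obtain ⟨V, hV, hVl⟩ := WeightedLp.exists_operator_infty (A.weight N) hε.le l fun j => by
    rw [mul_comm, ← le_div_iff₀ (ha N j)]
    exact hl j
  refine ⟨U, V, hU, hV, fun z => KSpace.ext (funext fun j => (hgl j z).trans ?_)⟩
  rw [← hUg, ← hVl]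
  rfl

/-- Injectivity of ℓ^∞: every coordinate is extended with the same norm. -/
theorem exists_extension_kInfty (e : E ≃L[ℂ] KSpace ∞ A) (F : Type w) [NormedAddCommGroup F]
    [NormedSpace ℂ F] (W : Submodule ℂ F) (N : ℕ)
    (T : W →L[ℂ] ((kSpectrum ∞ A).transport e).step N) :
    ∃ S : F →L[ℂ] E, ∀ x : W, S x = ((kSpectrum ∞ A).transport e).toLim N (T x) := by
  let h𝓔 := (kSpectrum_isLimit ∞ A).covers.transport e
  let T' : W →L[ℂ] WeightedLp ∞ (A.weight N) := T
  choose g hg hgn using fun j => exists_extension_norm_eq W ((WeightedLp.coord ∞ _ j).comp T')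
  obtain ⟨R, -, hR⟩ := WeightedLp.exists_operator_infty (A.weight N) (norm_nonneg T') g
    fun j => by
      rw [hgn, mul_comm, ← le_div_iff₀ (WeightedLp.weight_pos _ j)]
      refine ContinuousLinearMap.opNorm_le_bound _
        (div_nonneg (norm_nonneg _) (WeightedLp.weight_pos _ j).le) fun x => ?_
      rw [div_mul_eq_mul_div, le_div_iff₀ (WeightedLp.weight_pos _ j), mul_comm]
      exact (WeightedLp.weight_mul_norm_le _ (T' x) j).trans (T'.le_opNorm x)
  refine ⟨(h𝓔.toLimL N : WeightedLp ∞ (A.weight N) →L[ℂ] E).comp R, fun x => ?_⟩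
  have : R x = T' x := WeightedLp.ext (funext fun j => (hR j x).trans (hg j x))
  exact congrArg (h𝓔.toLimL N) this

/-- From N on the steps coincide with equivalent norms, so the inductive limit is the normed space
ℓ^∞(a_N). -/
theorem isNormable_of_weight_le (e : E ≃L[ℂ] KSpace ∞ A) (N : ℕ)
    (h : ∀ M ≥ N, ∃ δ > (0 : ℝ), ∀ j, δ * A.weight N j ≤ A.weight M j) : IsNormable E := by
  have hlim := kSpectrum_isLimit ∞ A
  have hstep : ∀ M, ∃ f : WeightedLp ∞ (A.weight M) →L[ℂ] WeightedLp ∞ (A.weight N),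
      ∀ c, (f c).val = c.val := fun M => by
    obtain ⟨δ, hδ, hM⟩ := h (max M N) (le_max_right _ _)
    let g : WeightedLp ∞ (A.weight M) →L[ℂ] WeightedLp ∞ (A.weight (max M N)) :=
      A.incl ∞ (le_max_left _ _)
    obtain ⟨f, -, hf⟩ := WeightedLp.exists_operator_infty (A.weight N)
      (C := ‖g‖ / δ) (by positivity)
      (fun j => (WeightedLp.coord ∞ (A.weight (max M N)) j).comp g) fun j => by
        rw [mul_comm, ← le_div_iff₀ (WeightedLp.weight_pos _ j)]
        refine ContinuousLinearMap.opNorm_le_bound _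
          (by have := WeightedLp.weight_pos (A.weight N) j; positivity) fun x => ?_
        rw [div_div, div_mul_eq_mul_div,
          le_div_iff₀ (mul_pos hδ (WeightedLp.weight_pos _ j)), mul_comm]
        calc δ * A.weight N j * ‖(g x).val j‖ ≤ A.weight (max M N) j * ‖(g x).val j‖ := by
              gcongr
              exact hM j
          _ ≤ ‖g x‖ := WeightedLp.weight_mul_norm_le _ _ j
          _ ≤ ‖g‖ * ‖x‖ := g.le_opNorm x
    exact ⟨f, fun c => funext fun j => hf j c⟩
  choose f hf using hstep
  have hinv : ∀ x : KSpace ∞ A, ∃ c : WeightedLp ∞ (A.weight N), c.val = x.val := fun x => by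
    obtain ⟨M, c, rfl⟩ := hlim.covers.exhausts x
    exact ⟨f M c, hf M c⟩
  choose g hg using hinv
  let G : KSpace ∞ A →ₗ[ℂ] WeightedLp ∞ (A.weight N) :=
    { toFun := g
      map_add' := fun x y => WeightedLp.ext (by rw [hg, WeightedLp.val_add, hg, hg, KSpace.val_add])
      map_smul' := fun c x => WeightedLp.ext (by
        rw [hg, RingHom.id_apply, WeightedLp.val_smul, hg, KSpace.val_smul]) }
  have hGc : Continuous G := hlim.continuous_of G fun M =>
    (f M).continuous.congr fun c => WeightedLp.ext (by
      rw [hf]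
      exact (hg ((kSpectrum ∞ A).toLim M c)).symm)
  let Φ : E →ₗ[ℂ] WeightedLp ∞ (A.weight N) := G ∘ₗ e.toLinearEquiv.toLinearMap
  have hleft : ∀ x, e.symm ((kSpectrum ∞ A).toLim N (Φ x)) = x := fun x => by
    rw [ContinuousLinearEquiv.symm_apply_eq]
    exact KSpace.ext (hg (e x))
  have hr : Continuous fun c : WeightedLp ∞ (A.weight N) => e.symm ((kSpectrum ∞ A).toLim N c) :=
    e.symm.continuous.comp (hlim.covers.continuous N)
  have hind : Topology.IsInducing Φ := Topology.IsInducing.of_comp (hGc.comp e.continuous) hr (by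
    rw [show (fun c : WeightedLp ∞ (A.weight N) => e.symm ((kSpectrum ∞ A).toLim N c)) ∘ Φ = id
      from funext hleft]
    exact Topology.IsInducing.id)
  refine ⟨(normSeminorm ℂ _).comp Φ, fun x hx => ?_, ?_⟩
  · have h0 : Φ x = 0 := norm_eq_zero.1 hx
    rw [← hleft x, h0]
    exact map_zero (e.symm.toLinearEquiv.toLinearMap ∘ₗ (kSpectrum ∞ A).toLim N)
  · exact hind.withSeminorms (norm_withSeminorms ℂ _)

/-- For the N of the weak condition, non-normability provides M such that a_M / a_N takes
arbitrarily small values. A unit vector e_j with C a_M(j) ≤ ε a_N(j) turns the fixed constant C into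
ε. -/
theorem normInterpolation_of_weakPairS_kInfty (e : E ≃L[ℂ] KSpace ∞ A) (hE : ¬ IsNormable E)
    {𝒵 : BanachSpectrum Z} (h : WeakPairS (kSpectrum ∞ A) 𝒵) : NormInterpolation 𝒵 := by
  intro n
  obtain ⟨m, hnm, h⟩ := h n
  refine ⟨m, hnm, fun k hmk ε hε => ?_⟩
  obtain ⟨N, h⟩ := h k hmk
  have hN : ∃ M ≥ N, ∀ δ > (0 : ℝ), ∃ j, (A.weight M j : ℝ) < δ * A.weight N j := by
    by_contra! hcon
    exact hE (isNormable_of_weight_le A e N hcon)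
  obtain ⟨M, hM, hδ⟩ := hN
  obtain ⟨K, hK, C, hC, h⟩ := h M hM
  obtain ⟨j, hj⟩ := hδ (ε / C) (by positivity)
  have hM0 := WeightedLp.weight_pos (A.weight M) j
  have hK0 := WeightedLp.weight_pos (A.weight K) j
  have hN0 := WeightedLp.weight_pos (A.weight N) j
  refine ⟨C * A.weight M j / A.weight K j, by positivity, fun z => ?_⟩
  obtain ⟨u, v, huv, hu, hv⟩ := h z (A.kUnit ∞ M j)
  rw [A.norm_kUnit] at hu hv
  refine (le_of_unit_split A (norm_nonneg _) huv hu hv).trans (add_le_add (le_of_eq ?_) ?_)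
  · ring
  · rw [div_le_iff₀ hN0]
    have h4 : C * A.weight M j ≤ ε * A.weight N j := by
      have := mul_le_mul_of_nonneg_left hj.le hC.le
      rwa [← mul_assoc, mul_div_cancel₀ _ hC.ne'] at this
    calc C * ‖z‖ * A.weight M j = C * A.weight M j * ‖z‖ := by ring
      _ ≤ ε * A.weight N j * ‖z‖ := by gcongr
      _ = _ := by ring

end KInfty

/-! ### Operators from and to `ℓ²` -/

/-- The Hilbert space `ℓ²(J)`. -/
abbrev EllTwo (J : Type*) := lp (fun _ : J => ℂ) 2

section EllTwo

variable {J : Type*} {G : Type*} [NormedAddCommGroup G] [NormedSpace ℂ G]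

theorem EllTwo.hasSum_sq (c : EllTwo J) : HasSum (fun j => ‖c j‖ ^ 2) (‖c‖ ^ 2) := by
  have h := lp.hasSum_norm (p := 2) (by simp) c
  simpa only [ENNReal.toReal_ofNat, Real.rpow_ofNat] using h

theorem EllTwo.sum_sq_le (c : EllTwo J) (s : Finset J) : ∑ j ∈ s, ‖c j‖ ^ 2 ≤ ‖c‖ ^ 2 :=
  sum_le_hasSum s (fun _ _ => sq_nonneg _) (EllTwo.hasSum_sq c)

open Classical in
/-- The unit vectors of `ℓ²(J)`. -/
def EllTwo.unit (j : J) : EllTwo J := lp.single 2 j 1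

theorem EllTwo.unit_apply_same (j : J) : EllTwo.unit j j = 1 := by
  classical
  exact lp.single_apply_self (E := fun _ : J => ℂ) 2 j 1

theorem EllTwo.unit_apply_ne {i j : J} (h : i ≠ j) : EllTwo.unit j i = 0 := by
  classical
  exact lp.single_apply_ne (E := fun _ : J => ℂ) 2 j 1 h

theorem EllTwo.hasSum_unit (c : EllTwo J) : HasSum (fun j => c j • EllTwo.unit j) c := by
  classical
  convert lp.hasSum_single (E := fun _ : J => ℂ) (p := 2) (by simp) c using 2 with j
  rw [EllTwo.unit, ← lp.single_smul, smul_eq_mul, mul_one]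

/-- By Cauchy–Schwarz, ∑ |c_j| ‖v_j‖ ≤ S ‖c‖. -/
theorem exists_columns [CompleteSpace G] (v : J → G) {S : ℝ} (hS : 0 ≤ S)
    (hv : ∀ s : Finset J, ∑ j ∈ s, ‖v j‖ ^ 2 ≤ S ^ 2) :
    ∃ R : EllTwo J →L[ℂ] G, ‖R‖ ≤ S ∧ ∀ j, R (EllTwo.unit j) = v j := by
  have hfin : ∀ (c : EllTwo J) (s : Finset J), ∑ j ∈ s, ‖c j • v j‖ ≤ S * ‖c‖ := fun c s => by
    refine abs_le_of_sq_le_sq' ?_ (by positivity) |>.2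
    simp only [norm_smul]
    refine (Finset.sum_mul_sq_le_sq_mul_sq s _ _).trans ?_
    rw [mul_pow, mul_comm (S ^ 2)]
    exact mul_le_mul (EllTwo.sum_sq_le c s) (hv s) (Finset.sum_nonneg fun _ _ => sq_nonneg _)
      (sq_nonneg _)
  have hsn : ∀ c : EllTwo J, Summable fun j => ‖c j • v j‖ := fun c =>
    summable_of_sum_le (fun _ => norm_nonneg _) (hfin c)
  let R : EllTwo J →ₗ[ℂ] G :=
    { toFun := fun c => ∑' j, c j • v j
      map_add' := fun c d => by
        rw [← (hsn c).of_norm.tsum_add (hsn d).of_norm]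
        simp only [lp.coeFn_add, Pi.add_apply, add_smul]
      map_smul' := fun r c => by
        rw [RingHom.id_apply, ← (hsn c).of_norm.tsum_const_smul r]
        simp only [lp.coeFn_smul, Pi.smul_apply, smul_assoc] }
  refine ⟨R.mkContinuous S fun c => ?_, R.mkContinuous_norm_le hS _, fun j => ?_⟩
  · exact (norm_tsum_le_tsum_norm (hsn c)).trans ((hsn c).tsum_le_of_sum_le (hfin c))
  · change ∑' i, EllTwo.unit j i • v i = v j
    rw [tsum_eq_single j fun i hi => by rw [EllTwo.unit_apply_ne hi, zero_smul],
      EllTwo.unit_apply_same, one_smul]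

theorem exists_rows (u : J → G →L[ℂ] ℂ) {S : ℝ} (hS : 0 ≤ S)
    (hu : ∀ s : Finset J, ∑ j ∈ s, ‖u j‖ ^ 2 ≤ S ^ 2) :
    ∃ R : G →L[ℂ] EllTwo J, ‖R‖ ≤ S ∧ ∀ x j, R x j = u j x := by
  have hfin : ∀ x (s : Finset J), ∑ j ∈ s, ‖u j x‖ ^ (2 : ℝ≥0∞).toReal ≤
      (S * ‖x‖) ^ (2 : ℝ≥0∞).toReal := fun x s => by
    simp only [ENNReal.toReal_ofNat, Real.rpow_ofNat]
    calc ∑ j ∈ s, ‖u j x‖ ^ 2 ≤ ∑ j ∈ s, ‖u j‖ ^ 2 * ‖x‖ ^ 2 :=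
          Finset.sum_le_sum fun j _ => by
            rw [← mul_pow]
            exact pow_le_pow_left₀ (norm_nonneg _) ((u j).le_opNorm x) 2
      _ = (∑ j ∈ s, ‖u j‖ ^ 2) * ‖x‖ ^ 2 := (Finset.sum_mul _ _ _).symm
      _ ≤ S ^ 2 * ‖x‖ ^ 2 := mul_le_mul_of_nonneg_right (hu s) (sq_nonneg _)
      _ = _ := (mul_pow _ _ _).symm
  let R : G →ₗ[ℂ] EllTwo J :=
    { toFun := fun x => ⟨fun j => u j x, memℓp_gen' (hfin x)⟩
      map_add' := fun x y => by
        ext j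
        exact map_add (u j) x y
      map_smul' := fun c x => by
        ext j
        exact map_smul (u j) c x }
  refine ⟨R.mkContinuous S fun x => ?_, R.mkContinuous_norm_le hS _, fun x j => rfl⟩
  exact lp.norm_le_of_forall_sum_le (by simp) (by positivity) (hfin x)

end EllTwo

/-! ### Bessel families and singular value decompositions -/

section Bessel

variable {H : Type w} [NormedAddCommGroup H] [InnerProductSpace ℂ H]

/-- Families satisfying Bessel's inequality. -/
def IsBesselFamily {J : Type*} (f : J → H) : Prop :=
  ∀ (w : H) (s : Finset J), ∑ j ∈ s, ‖inner ℂ (f j) w‖ ^ 2 ≤ ‖w‖ ^ 2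

theorem Orthonormal.isBesselFamily {J : Type*} {f : J → H} (h : Orthonormal ℂ f) :
    IsBesselFamily f := fun _ _ => h.sum_inner_products_le _

theorem IsBesselFamily.of_subtype {J : Type*} {f : J → H} {p : J → Prop}
    (h : IsBesselFamily fun j : {j // p j} => f j) (h0 : ∀ j, ¬ p j → f j = 0) :
    IsBesselFamily f := fun w s => by
  classical
  refine le_trans (le_of_eq ?_) (h w (s.subtype p))
  rw [Finset.sum_subtype_eq_sum_filter (f := fun j => ‖inner ℂ (f j) w‖ ^ 2), Finset.sum_filter]
  refine Finset.sum_congr rfl fun j _ => ?_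
  split_ifs with hp
  · rfl
  · rw [h0 j hp, inner_zero_left, norm_zero, zero_pow two_ne_zero]

variable [CompleteSpace H]

theorem IsBesselFamily.sum_sq_functional_le {J : Type*} {f : J → H} (h : IsBesselFamily f)
    (b : H →L[ℂ] ℂ) (s : Finset J) : ∑ j ∈ s, ‖b (f j)‖ ^ 2 ≤ ‖b‖ ^ 2 := by
  have hb : ∀ x, b x = inner ℂ ((InnerProductSpace.toDual ℂ H).symm b) x := fun x => by
    rw [InnerProductSpace.toDual_symm_apply]
  have hn : ‖(InnerProductSpace.toDual ℂ H).symm b‖ = ‖b‖ := LinearIsometryEquiv.norm_map _ _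
  rw [← hn]
  refine le_trans (le_of_eq (Finset.sum_congr rfl fun j _ => ?_)) (h _ s)
  rw [hb, norm_inner_symm]

/-- An operator to `ℓ²` with square summable rows is bounded in the Hilbert–Schmidt sense. -/
theorem IsBesselFamily.sum_sq_rows_le {J κ : Type*} {f : J → H} (h : IsBesselFamily f)
    (R : H →L[ℂ] EllTwo κ) (b : κ → H →L[ℂ] ℂ) (hR : ∀ x i, R x i = b i x) {S : ℝ}
    (hb : ∀ t : Finset κ, ∑ i ∈ t, ‖b i‖ ^ 2 ≤ S ^ 2) (s : Finset J) :
    ∑ j ∈ s, ‖R (f j)‖ ^ 2 ≤ S ^ 2 := by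
  -- The sums over the rows i and over the family f are interchanged; for each row, Bessel's
  -- inequality bounds the sum over f by ‖b i‖².
  have h1 : HasSum (fun i => ∑ j ∈ s, ‖R (f j) i‖ ^ 2) (∑ j ∈ s, ‖R (f j)‖ ^ 2) :=
    hasSum_sum fun j _ => EllTwo.hasSum_sq _
  refine hasSum_le_of_sum_le h1 fun t => (Finset.sum_le_sum fun i _ => ?_).trans (hb t)
  simp only [hR]
  exact h.sum_sq_functional_le (b i) s

/-- D*D is diagonalized by the spectral theorem: e consists of eigenvectors, kernel included, μ_j =
‖D e_j‖ and f_j = D e_j / μ_j. Where μ_j = 0 also f_j = 0, which is why f is only a Bessel family.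
-/
theorem exists_svd (D : H →L[ℂ] H)
    (hD : IsCompactOperator (ContinuousLinearMap.adjoint D ∘L D)) :
    ∃ (J : Type w) (e : HilbertBasis J ℂ H) (f : J → H) (μ : J → ℝ), IsBesselFamily f ∧
      (∀ j, D (e j) = (μ j : ℂ) • f j) ∧
      (∀ j, ContinuousLinearMap.adjoint D (f j) = (μ j : ℂ) • e j) ∧ ∀ j, μ j = 0 → f j = 0 := by
  set T := ContinuousLinearMap.adjoint D ∘L D with hT
  have hTapp : ∀ x y, inner ℂ x (T y) = inner ℂ (D x) (D y) := fun x y =>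
    ContinuousLinearMap.adjoint_inner_right D x (D y)
  have hsymm : (T : H →ₗ[ℂ] H).IsSymmetric := fun x y => by
    change inner ℂ (T x) y = inner ℂ x (T y)
    rw [hTapp]
    exact ContinuousLinearMap.adjoint_inner_left D y (D x)
  have hbot := ContinuousLinearMap.orthogonalComplement_iSup_eigenspaces_eq_bot hD hsymm
  let V : ℂ → Submodule ℂ H := fun μ => Module.End.eigenspace (T : H →ₗ[ℂ] H) μ
  have hVmem : ∀ μ (x : V μ), T x = μ • (x : H) := fun μ x => Module.End.mem_eigenspace_iff.1 x.2
  have hVc : ∀ μ, CompleteSpace (V μ) := fun μ => by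
    have : IsClosed (V μ : Set H) := by
      have e : (V μ : Set H) = {x | T x = μ • x} := by
        ext x
        exact Module.End.mem_eigenspace_iff
      rw [e]
      exact isClosed_eq T.continuous (continuous_const_smul μ)
    exact this.completeSpace_coe
  choose w b hb using fun μ => exists_hilbertBasis ℂ (V μ)
  let e₀ : (Σ μ : ℂ, w μ) → H := fun a => (b a.1 a.2 : H)
  have he₀ : Orthonormal ℂ e₀ :=
    hsymm.orthogonalFamily_eigenspaces.orthonormal_sigma_orthonormal fun μ => (b μ).orthonormal
  have hspan : (Submodule.span ℂ (Set.range e₀))ᗮ = ⊥ := by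
    rw [eq_bot_iff, ← hbot]
    intro x hx
    rw [Submodule.mem_orthogonal] at hx
    have hx' : ∀ μ, ∀ y : V μ, inner ℂ (y : H) x = 0 := fun μ y => by
      have hy := ((b μ).hasSum_repr y).mapL ((innerSL ℂ x).comp (V μ).subtypeL)
      have hz : ∀ i, ((innerSL ℂ x).comp (V μ).subtypeL) ((b μ).repr y i • b μ i) = 0 :=
        fun i => by
          rw [map_smul]
          have h1 := hx (b μ i) (Submodule.subset_span ⟨⟨μ, i⟩, rfl⟩)
          have h2 : ((innerSL ℂ x).comp (V μ).subtypeL) (b μ i) = inner ℂ x (b μ i : H) := rfl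
          rw [h2, ← inner_conj_symm, h1, map_zero, smul_zero]
      simp only [hz] at hy
      have h3 : inner ℂ x (y : H) = 0 := hy.unique hasSum_zero
      rw [← inner_conj_symm, h3, map_zero]
    rw [Submodule.mem_orthogonal]
    intro y hy
    refine Submodule.iSup_induction V (motive := fun y => inner ℂ y x = 0) hy
      (fun μ y hy => hx' μ ⟨y, hy⟩) (inner_zero_left x) fun y z hy hz => ?_
    rw [inner_add_left, hy, hz, add_zero]
  let e := HilbertBasis.mkOfOrthogonalEqBot he₀ hspan
  have hee : ∀ a, e a = e₀ a := fun a =>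
    congrFun (HilbertBasis.coe_mkOfOrthogonalEqBot he₀ hspan) a
  have hTe : ∀ a, T (e a) = ((‖D (e a)‖ : ℂ) ^ 2) • e a := fun a => by
    have h1 : T (e a) = a.1 • e a := by
      rw [hee]
      exact hVmem a.1 (b a.1 a.2)
    have h2 := hTapp (e a) (e a)
    rw [h1, inner_smul_right, inner_self_eq_norm_sq_to_K, inner_self_eq_norm_sq_to_K,
      e.orthonormal.1 a] at h2
    have h3 : a.1 = (‖D (e a)‖ : ℂ) ^ 2 := by simpa using h2
    rw [h1, ← h3]
  have hDD : ∀ a a', inner ℂ (D (e a)) (D (e a')) =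
      ((‖D (e a')‖ : ℂ) ^ 2) * inner ℂ (e a) (e a') := fun a a' => by
    rw [← hTapp, hTe, inner_smul_right]
  refine ⟨_, e, fun a => ((‖D (e a)‖ : ℂ)⁻¹) • D (e a), fun a => ‖D (e a)‖, ?_, fun a => ?_,
    fun a => ?_, fun a ha => ?_⟩
  · refine IsBesselFamily.of_subtype (p := fun a => D (e a) ≠ 0) (Orthonormal.isBesselFamily ?_)
      fun a ha => by rw [not_not.1 ha, smul_zero]
    refine ⟨fun a => ?_, fun a a' haa' => ?_⟩
    · rw [norm_smul, norm_inv, Complex.norm_real, norm_norm]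
      exact inv_mul_cancel₀ (norm_ne_zero_iff.2 a.2)
    · have h0 : inner ℂ (e a) (e a') = 0 := e.orthonormal.2 fun h => haa' (Subtype.ext h)
      simp only
      rw [inner_smul_left, inner_smul_right, hDD, h0, mul_zero, mul_zero, mul_zero]
  · rcases eq_or_ne (D (e a)) 0 with h | h
    · simp [h]
    · rw [smul_smul, mul_inv_cancel₀ (by simpa using h), one_smul]
  · rw [map_smul]
    change _ • T (e a) = _
    rw [hTe, smul_smul]
    rcases eq_or_ne (D (e a)) 0 with h | h
    · simp [h]
    · congr 1
      rw [pow_two, inv_mul_cancel_left₀ (by simpa using h)]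
  · simp only
    rw [norm_eq_zero.1 ha, smul_zero]

end Bessel

/-! ### Nuclear maps -/

theorem EllTwo.inner_unit {J : Type*} (j : J) (c : EllTwo J) :
    inner ℂ (EllTwo.unit j) c = c j := by
  classical
  rw [EllTwo.unit, lp.inner_single_left]
  simp

section Nuclear

variable {F G : Type*} [NormedAddCommGroup F] [NormedSpace ℂ F] [NormedAddCommGroup G]
  [NormedSpace ℂ G]

/-- Absolutely summable series of operators of rank one. -/
theorem exists_sum_rank_one [CompleteSpace G] (a : ℕ → F →L[ℂ] ℂ) (y : ℕ → G)
    (h : Summable fun j => ‖a j‖ * ‖y j‖) :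
    ∃ S : F →L[ℂ] G, HasSum (fun j => (a j).smulRight (y j)) S ∧
      ∀ x, HasSum (fun j => a j x • y j) (S x) := by
  have hs : Summable fun j => (a j).smulRight (y j) :=
    Summable.of_norm (by simpa only [ContinuousLinearMap.norm_smulRight_apply] using h)
  exact ⟨_, hs.hasSum, fun x => hs.hasSum.mapL (ContinuousLinearMap.apply ℂ G x)⟩

theorem IsNuclearMap.isCompactOperator [CompleteSpace G] {T : F →L[ℂ] G} (hT : IsNuclearMap T) :
    IsCompactOperator T := by
  obtain ⟨a, y, hs, hsum⟩ := hT
  obtain ⟨S, hS, hSx⟩ := exists_sum_rank_one a y hs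
  obtain rfl : S = T := ContinuousLinearMap.ext fun x => (hSx x).unique (hsum x)
  refine isCompactOperator_of_tendsto hS (Filter.Eventually.of_forall fun s => ?_)
  refine (compactOperator (RingHom.id ℂ) F G).sum_mem fun j _ => ?_
  exact (isCompactOperator_of_locallyCompactSpace_dom (a j)).clm_comp
    (ContinuousLinearMap.toSpanSingleton ℂ (y j))

/-- Replacing (a_j, y_j) by (t_j a_j, t_j⁻¹ y_j) with t_j² = ‖y_j‖ / ‖a_j‖ keeps the rank one terms
and gives both factors the norm √(‖a_j‖‖y_j‖). If one factor vanishes, both become 0. -/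
theorem IsNuclearMap.exists_square_summable {T : F →L[ℂ] G} (hT : IsNuclearMap T) :
    ∃ (a : ℕ → F →L[ℂ] ℂ) (y : ℕ → G) (S : ℝ), 0 ≤ S ∧
      (∀ s : Finset ℕ, ∑ j ∈ s, ‖a j‖ ^ 2 ≤ S ^ 2) ∧
      (∀ s : Finset ℕ, ∑ j ∈ s, ‖y j‖ ^ 2 ≤ S ^ 2) ∧ ∀ x, HasSum (fun j => a j x • y j) (T x) := by
  obtain ⟨a, y, hs, hsum⟩ := hT
  let t : ℕ → ℝ := fun j => Real.sqrt (‖y j‖ / ‖a j‖)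
  have ht0 : ∀ j, a j ≠ 0 → y j ≠ 0 → 0 < t j := fun j ha hy =>
    Real.sqrt_pos.2 (div_pos (norm_pos_iff.2 hy) (norm_pos_iff.2 ha))
  have hta : ∀ j, ‖(t j : ℂ) • a j‖ ^ 2 ≤ ‖a j‖ * ‖y j‖ := fun j => by
    rw [norm_smul, Complex.norm_of_nonneg (Real.sqrt_nonneg _), mul_pow, Real.sq_sqrt (by positivity)]
    rcases eq_or_ne (a j) 0 with h | h
    · simp [h]
    · have := norm_pos_iff.2 h
      apply le_of_eq
      field_simp
  have hty : ∀ j, ‖(t j : ℂ)⁻¹ • y j‖ ^ 2 ≤ ‖a j‖ * ‖y j‖ := fun j => by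
    rw [norm_smul, norm_inv, Complex.norm_of_nonneg (Real.sqrt_nonneg _), mul_pow, inv_pow,
      Real.sq_sqrt (by positivity)]
    rcases eq_or_ne (y j) 0 with h | h
    · simp [h]
    · have := norm_pos_iff.2 h
      apply le_of_eq
      field_simp
  have hS : Real.sqrt (∑' j, ‖a j‖ * ‖y j‖) ^ 2 = ∑' j, ‖a j‖ * ‖y j‖ :=
    Real.sq_sqrt (tsum_nonneg fun _ => by positivity)
  refine ⟨fun j => (t j : ℂ) • a j, fun j => (t j : ℂ)⁻¹ • y j,
    Real.sqrt (∑' j, ‖a j‖ * ‖y j‖), Real.sqrt_nonneg _, fun s => ?_, fun s => ?_, fun x => ?_⟩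
  · rw [hS]
    exact (Finset.sum_le_sum fun j _ => hta j).trans
      (hs.sum_le_tsum s fun _ _ => by positivity)
  · rw [hS]
    exact (Finset.sum_le_sum fun j _ => hty j).trans
      (hs.sum_le_tsum s fun _ _ => by positivity)
  · convert hsum x using 2 with j
    rcases eq_or_ne (a j) 0 with ha | ha
    · simp [ha]
    rcases eq_or_ne (y j) 0 with hy | hy
    · simp [hy]
    have h0 : (t j : ℂ) ≠ 0 := Complex.ofReal_ne_zero.2 (ht0 j ha hy).ne'
    rw [smul_apply, smul_smul, smul_eq_mul]
    congr 1
    field_simp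

/-- Nuclear maps factor through `ℓ²` with square summable rows and columns. -/
theorem IsNuclearMap.exists_factor [CompleteSpace G] {T : F →L[ℂ] G} (hT : IsNuclearMap T) :
    ∃ (h : F →L[ℂ] EllTwo ℕ) (r : EllTwo ℕ →L[ℂ] G) (a : ℕ → F →L[ℂ] ℂ) (y : ℕ → G) (S : ℝ),
      0 ≤ S ∧ r.comp h = T ∧ (∀ x j, h x j = a j x) ∧ (∀ j, r (EllTwo.unit j) = y j) ∧
      (∀ s : Finset ℕ, ∑ j ∈ s, ‖a j‖ ^ 2 ≤ S ^ 2) ∧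
      (∀ s : Finset ℕ, ∑ j ∈ s, ‖y j‖ ^ 2 ≤ S ^ 2) := by
  obtain ⟨a, y, S, hS, ha, hy, hsum⟩ := hT.exists_square_summable
  obtain ⟨h, -, hh⟩ := exists_rows a hS ha
  obtain ⟨r, -, hr⟩ := exists_columns y hS hy
  refine ⟨h, r, a, y, S, hS, ContinuousLinearMap.ext fun x => ?_, hh, hr, ha, hy⟩
  have h1 := (EllTwo.hasSum_unit (h x)).mapL r
  simp only [map_smul, hr, hh] at h1
  exact h1.unique (hsum x)

theorem IsNuclearMap.exists_hilbert_factor [CompleteSpace G] {T : F →L[ℂ] G}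
    (hT : IsNuclearMap T) :
    ∃ (h : F →L[ℂ] EllTwo ℕ) (r : EllTwo ℕ →L[ℂ] G), r.comp h = T := by
  obtain ⟨h, r, a, y, S, -, e, -⟩ := hT.exists_factor
  exact ⟨h, r, e⟩

variable {H : Type w} [NormedAddCommGroup H] [InnerProductSpace ℂ H] [CompleteSpace H]

theorem sum_norm_sq_mul_le {J : Type*} {K : Type*} [SeminormedAddCommGroup K] {s : Finset J}
    {g : J → ℝ} {x : J → K} {c S : ℝ} (hg : ∀ j ∈ s, 0 ≤ g j)
    (hgx : ∀ j ∈ s, g j ≤ c * ‖x j‖) (hx : ∑ j ∈ s, ‖x j‖ ^ 2 ≤ S ^ 2) :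
    ∑ j ∈ s, g j ^ 2 ≤ (c * S) ^ 2 := by
  calc ∑ j ∈ s, g j ^ 2 ≤ ∑ j ∈ s, c ^ 2 * ‖x j‖ ^ 2 := Finset.sum_le_sum fun j hj => by
        rw [← mul_pow]
        exact pow_le_pow_left₀ (hg j hj) (hgx j hj) 2
    _ = c ^ 2 * ∑ j ∈ s, ‖x j‖ ^ 2 := (Finset.mul_sum _ _ _).symm
    _ ≤ c ^ 2 * S ^ 2 := by gcongr
    _ = _ := (mul_pow _ _ _).symm

/-- Nuclear maps are absolutely `2`-summing. -/
theorem IsNuclearMap.exists_sum_sq_le [CompleteSpace G] {T : F →L[ℂ] G} (hT : IsNuclearMap T)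
    (r : H →L[ℂ] F) : ∃ S : ℝ, 0 ≤ S ∧ ∀ (J : Type w) (f : J → H), IsBesselFamily f →
      ∀ s : Finset J, ∑ j ∈ s, ‖T (r (f j))‖ ^ 2 ≤ S ^ 2 := by
  obtain ⟨h, r', a, y, S, hS, rfl, hh, -, ha, -⟩ := hT.exists_factor
  refine ⟨‖r'‖ * (‖r‖ * S), by positivity, fun J f hf s => ?_⟩
  have hb : ∀ t : Finset ℕ, ∑ i ∈ t, ‖(a i).comp r‖ ^ 2 ≤ (‖r‖ * S) ^ 2 := fun t =>
    sum_norm_sq_mul_le (fun _ _ => norm_nonneg _)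
      (fun i _ => ((a i).opNorm_comp_le r).trans_eq (mul_comm _ _)) (ha t)
  have h1 := hf.sum_sq_rows_le (h.comp r) (fun i => (a i).comp r) (fun x i => hh (r x) i) hb s
  exact sum_norm_sq_mul_le (fun _ _ => norm_nonneg _)
    (fun j _ => r'.le_opNorm _) h1

/-- The transposes of nuclear maps are absolutely `2`-summing. -/
theorem IsNuclearMap.exists_sum_sq_inner_le [CompleteSpace G] {T : F →L[ℂ] G}
    (hT : IsNuclearMap T) (q : G →L[ℂ] H) :
    ∃ S : ℝ, 0 ≤ S ∧ ∀ (J : Type w) (f : J → H), IsBesselFamily f →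
      ∀ s : Finset J, ∑ j ∈ s, ‖(innerSL ℂ (f j)).comp (q.comp T)‖ ^ 2 ≤ S ^ 2 := by
  obtain ⟨h, r, a, y, S, hS, rfl, -, hr, -, hy⟩ := hT.exists_factor
  refine ⟨‖h‖ * (‖q‖ * S), by positivity, fun J f hf s => ?_⟩
  -- The adjoint of q ∘ r has the square summable rows ⟨q y_i, ·⟩, and the functional ⟨f_j, q T ·⟩
  -- equals ⟨R f_j, h ·⟩.
  let R : H →L[ℂ] EllTwo ℕ := ContinuousLinearMap.adjoint (q.comp r)
  have hR : ∀ x i, R x i = innerSL ℂ (q (y i)) x := fun x i => by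
    have h1 : inner ℂ (EllTwo.unit i) (R x) = inner ℂ (q (r (EllTwo.unit i))) x :=
      ContinuousLinearMap.adjoint_inner_right _ _ _
    rw [hr] at h1
    change R x i = inner ℂ (q (y i)) x
    rw [← h1, EllTwo.inner_unit]
  have hb : ∀ t : Finset ℕ, ∑ i ∈ t, ‖innerSL ℂ (q (y i))‖ ^ 2 ≤ (‖q‖ * S) ^ 2 := fun t =>
    sum_norm_sq_mul_le (fun _ _ => norm_nonneg _)
      (fun i _ => by rw [innerSL_apply_norm]; exact q.le_opNorm _) (hy t)
  have h1 := hf.sum_sq_rows_le R (fun i => innerSL ℂ (q (y i))) hR hb s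
  refine sum_norm_sq_mul_le (fun _ _ => norm_nonneg _) (fun j _ => ?_) h1
  refine ContinuousLinearMap.opNorm_le_bound _ (by positivity) fun x => ?_
  have h2 : (innerSL ℂ (f j)).comp (q.comp (r.comp h)) x = inner ℂ (R (f j)) (h x) :=
    (ContinuousLinearMap.adjoint_inner_left (q.comp r) (h x) (f j)).symm
  rw [h2]
  calc ‖inner ℂ (R (f j)) (h x)‖ ≤ ‖R (f j)‖ * ‖h x‖ := norm_inner_le_norm _ _
    _ ≤ ‖R (f j)‖ * (‖h‖ * ‖x‖) := by gcongr; exact h.le_opNorm x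
    _ = _ := by ring

end Nuclear

/-! ### `(LN)`-spaces -/

section Interpolation

variable {Z : Type v} [AddCommGroup Z] [Module ℂ Z]

/-- Ehrling's lemma: the open sets ‖y‖ < p‖y‖_k + ε increase with p and, by injectivity of the
inclusions, cover the compact image of the unit ball; so one p suffices. -/
theorem normInterpolation_of_isCompactOperator {𝒵 : BanachSpectrum Z}
    (h : ∀ n, IsCompactOperator (𝒵.incl (Nat.le_succ n))) : NormInterpolation 𝒵 := by
  intro n
  refine ⟨n + 1, n.le_succ, fun k hk ε hε => ?_⟩
  obtain ⟨K, hK, hKs⟩ := (h n).image_closedBall_subset_compact 1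
  let U : ℕ → Set (𝒵.step (n + 1)) := fun p => {y | ‖y‖ < p * ‖𝒵.incl hk y‖ + ε}
  have hU : ∀ p, IsOpen (U p) := fun p => isOpen_lt continuous_norm (by fun_prop)
  have hcov : K ⊆ ⋃ p, U p := fun y _ => by
    rw [Set.mem_iUnion]
    rcases eq_or_ne y 0 with rfl | hy
    · exact ⟨0, by simpa [U] using hε⟩
    · have h0 : 0 < ‖𝒵.incl hk y‖ := norm_pos_iff.2 fun h0 => hy
        (𝒵.incl_injective hk (h0.trans (map_zero _).symm))
      obtain ⟨p, hp⟩ := exists_nat_gt (‖y‖ / ‖𝒵.incl hk y‖)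
      refine ⟨p, ?_⟩
      rw [div_lt_iff₀ h0] at hp
      exact hp.trans (lt_add_of_pos_right _ hε)
  obtain ⟨p, hp⟩ := hK.elim_directed_cover U hU hcov (Monotone.directed_le fun p q hpq y hy =>
    lt_of_lt_of_le (show ‖y‖ < p * ‖𝒵.incl hk y‖ + ε from hy) (by
      have : (p : ℝ) ≤ q := by exact_mod_cast hpq
      gcongr))
  refine ⟨p + 1, by positivity, fun z => ?_⟩
  rcases eq_or_ne z 0 with rfl | hz
  · simp
  have hz0 : 0 < ‖z‖ := norm_pos_iff.2 hz
  have h1 : ‖𝒵.incl n.le_succ (‖z‖⁻¹ • z)‖ <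
      p * ‖𝒵.incl hk (𝒵.incl n.le_succ (‖z‖⁻¹ • z))‖ + ε := hp (hKs ⟨_, by
    rw [mem_closedBall_zero_iff, norm_smul, norm_inv, norm_norm, inv_mul_cancel₀ hz0.ne'], rfl⟩)
  have h2 : ∀ {m} (hm : n ≤ m), ‖𝒵.incl hm (‖z‖⁻¹ • z)‖ = ‖z‖⁻¹ * ‖𝒵.incl hm z‖ := fun hm => by
    rw [← Complex.coe_smul, map_smul, Complex.coe_smul, norm_smul, norm_inv, norm_norm]
  rw [𝒵.incl_incl, h2, h2] at h1
  have h3 := mul_lt_mul_of_pos_left h1 hz0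
  rw [mul_inv_cancel_left₀ hz0.ne'] at h3
  calc ‖𝒵.incl n.le_succ z‖ ≤ _ := h3.le
    _ = p * ‖𝒵.incl (n.le_succ.trans hk) z‖ + ε * ‖z‖ := by field_simp
    _ ≤ _ := by gcongr; linarith

variable {E : Type u} [AddCommGroup E] [Module ℂ E]

/-- If the steps of `𝓔` with compact inclusions stabilize, then the space is finite-dimensional. -/
theorem finiteDimensional_of_range_toLim {𝓔 : BanachSpectrum E}
    (h : ∀ n, IsCompactOperator (𝓔.incl (Nat.le_succ n))) {N : ℕ}
    (hN : ∀ x, ∃ e, 𝓔.toLim N e = x) : FiniteDimensional ℂ E := by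
  -- The inclusion of step N into the next one is then bijective, hence an isomorphism, and it is
  -- compact.
  have hsurj : Function.Surjective (𝓔.incl N.le_succ) := fun y => by
    obtain ⟨e, he⟩ := hN (𝓔.toLim (N + 1) y)
    exact ⟨e, 𝓔.incl_eq (by rw [𝓔.toLim_incl, he])⟩
  let Φ := ContinuousLinearEquiv.ofBijective (𝓔.incl N.le_succ)
    (LinearMap.ker_eq_bot.2 (𝓔.incl_injective _)) (LinearMap.range_eq_top.2 hsurj)
  have hid : IsCompactOperator (id : 𝓔.step N → 𝓔.step N) := by
    have e : (id : 𝓔.step N → 𝓔.step N) = Φ.symm ∘ 𝓔.incl N.le_succ :=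
      funext fun x => (Φ.symm_apply_apply x).symm
    rw [e]
    exact (h N).clm_comp (Φ.symm : 𝓔.step (N + 1) →L[ℂ] 𝓔.step N)
  have : FiniteDimensional ℂ (𝓔.step N) := FiniteDimensional.of_isCompactOperator_id (𝕜 := ℂ) hid
  exact Module.Finite.of_surjective (𝓔.toLim N) hN

/-- In infinite dimensions some b lies outside E_{N+1}. If ‖z‖_m > ε‖z‖_n, then v / ‖z‖_m stays in a
fixed ball of E_N, whose image in E_{N+1} lies in a compact set L. The distance δ > 0 of b to L is
at most the norm of b − v / ‖z‖_m = u / ‖z‖_m, which bounds ‖z‖_m by a multiple of ‖z‖_k. -/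
theorem normInterpolation_of_weakPairS_of_isCompactOperator {𝓔 : BanachSpectrum E}
    (h𝓔 : ∀ n, IsCompactOperator (𝓔.incl (Nat.le_succ n))) (hex : ∀ x, ∃ n e, 𝓔.toLim n e = x)
    (hE : ¬ FiniteDimensional ℂ E) {𝒵 : BanachSpectrum Z} (h : WeakPairS 𝓔 𝒵) :
    NormInterpolation 𝒵 := by
  intro n
  obtain ⟨m, hnm, h⟩ := h n
  refine ⟨m, hnm, fun k hmk ε hε => ?_⟩
  obtain ⟨N, h⟩ := h k hmk
  obtain ⟨x, hx⟩ : ∃ x, ∀ e, 𝓔.toLim (N + 1) e ≠ x := by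
    by_contra! hcon
    exact hE (finiteDimensional_of_range_toLim h𝓔 hcon)
  obtain ⟨M₀, b₀, hb₀⟩ := hex x
  obtain ⟨b, hb⟩ : ∃ b, 𝓔.toLim (max N M₀) b = x :=
    ⟨𝓔.incl (le_max_right _ _) b₀, (𝓔.toLim_incl _ _).trans hb₀⟩
  have hb0 : 0 < ‖b‖ := norm_pos_iff.2 fun h0 => hx 0 (by rw [← hb, h0, map_zero, map_zero])
  obtain ⟨K, hK, C, hC, h⟩ := h _ (le_max_left N M₀)
  have hMK : max N M₀ ≤ max K (N + 1) := hK.trans (le_max_left _ _)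
  obtain ⟨L, hL, hLs⟩ := (h𝓔 N).image_closedBall_subset_compact (C * ‖b‖ / ε)
  have hLne : L.Nonempty := ⟨_, hLs ⟨0, by
    rw [mem_closedBall_zero_iff, norm_zero]
    positivity, rfl⟩⟩
  obtain ⟨y₀, hy₀, hmin⟩ := hL.exists_isMinOn hLne
    (f := fun y => ‖𝓔.incl hMK b - 𝓔.incl (le_max_right K (N + 1)) y‖)
    (Continuous.continuousOn (by fun_prop))
  set δ := ‖𝓔.incl hMK b - 𝓔.incl (le_max_right K (N + 1)) y₀‖ with hδ
  have hδ0 : 0 < δ := norm_pos_iff.2 fun h0 => hx y₀ (by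
    have := congrArg (𝓔.toLim _) h0
    rw [map_sub, map_zero, 𝓔.toLim_incl, 𝓔.toLim_incl, sub_eq_zero, hb] at this
    exact this.symm)
  set ι := ‖𝓔.incl (le_max_left K (N + 1))‖ + 1 with hι
  have hι0 : 0 < ι := by positivity
  refine ⟨ι * C * ‖b‖ / δ, by positivity, fun z => ?_⟩
  obtain ⟨u, v, huv, hu, hv⟩ := h z b
  by_cases hz : ‖𝒵.incl hnm z‖ ≤ ε * ‖z‖
  · exact hz.trans (le_add_of_nonneg_left (by positivity))
  push Not at hz
  have hzm : 0 < ‖𝒵.incl hnm z‖ := lt_of_le_of_lt (by positivity) hz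
  have hv' : ‖(‖𝒵.incl hnm z‖)⁻¹ • v‖ ≤ C * ‖b‖ / ε := by
    rw [norm_smul, norm_inv, norm_norm, inv_mul_le_iff₀ hzm]
    refine hv.trans ?_
    calc C * ‖z‖ * ‖b‖ = (ε * ‖z‖) * (C * ‖b‖ / ε) := by field_simp
      _ ≤ _ := by gcongr
  have hmem := hmin (hLs ⟨_, mem_closedBall_zero_iff.2 hv', rfl⟩)
  have hsplit : 𝓔.incl hMK b - 𝓔.incl (le_max_right K (N + 1))
      (𝓔.incl N.le_succ ((‖𝒵.incl hnm z‖)⁻¹ • v)) =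
      (‖𝒵.incl hnm z‖)⁻¹ • 𝓔.incl (le_max_left K (N + 1)) u := by
    refine 𝓔.incl_eq ?_
    simp only [map_sub, 𝓔.toLim_incl, 𝓔.toLim_real_smul]
    rw [sub_eq_iff_eq_add, ← smul_add, ← huv, inv_smul_smul₀ hzm.ne']
  have h1 : δ ≤ (‖𝒵.incl hnm z‖)⁻¹ * (ι * (C * ‖𝒵.incl (hnm.trans hmk) z‖ * ‖b‖)) := by
    refine le_trans (show δ ≤ _ from hmem) ?_
    change ‖𝓔.incl hMK b - 𝓔.incl (le_max_right K (N + 1))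
      (𝓔.incl N.le_succ ((‖𝒵.incl hnm z‖)⁻¹ • v))‖ ≤ _
    rw [hsplit, norm_smul, norm_inv, norm_norm]
    gcongr
    refine ((𝓔.incl _).le_opNorm u).trans ?_
    gcongr
    linarith
  rw [le_inv_mul_iff₀ hzm] at h1
  refine le_add_of_le_of_nonneg ?_ (by positivity)
  rw [div_mul_eq_mul_div, le_div_iff₀ hδ0]
  refine h1.trans_eq ?_
  ring

end Interpolation

/-! ### The analysis operators of a singular value decomposition -/

section Analysis

variable {H : Type w} [NormedAddCommGroup H] [InnerProductSpace ℂ H]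

theorem IsBesselFamily.exists_analysis {J : Type*} {f : J → H} (hf : IsBesselFamily f) :
    ∃ A : H →L[ℂ] EllTwo J, ‖A‖ ≤ 1 ∧ ∀ x j, A x j = inner ℂ (f j) x := by
  have hfin : ∀ x (s : Finset J), ∑ j ∈ s, ‖inner ℂ (f j) x‖ ^ (2 : ℝ≥0∞).toReal ≤
      (1 * ‖x‖) ^ (2 : ℝ≥0∞).toReal := fun x s => by
    simp only [ENNReal.toReal_ofNat, Real.rpow_ofNat, one_mul]
    exact hf x s
  let A : H →ₗ[ℂ] EllTwo J :=
    { toFun := fun x => ⟨fun j => inner ℂ (f j) x, memℓp_gen' (hfin x)⟩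
      map_add' := fun x y => by
        ext j
        exact inner_add_right (f j) x y
      map_smul' := fun c x => by
        ext j
        exact inner_smul_right (f j) x c }
  refine ⟨A.mkContinuous 1 fun x => ?_, A.mkContinuous_norm_le zero_le_one _, fun x j => rfl⟩
  exact lp.norm_le_of_forall_sum_le (by simp) (by positivity) (hfin x)

variable [CompleteSpace H]

/-- B and A take the coefficients with respect to e and f; in these coordinates D is the diagonal
operator with entries μ_j. -/
theorem exists_svd_analysis (D : H →L[ℂ] H)
    (hD : IsCompactOperator (ContinuousLinearMap.adjoint D ∘L D)) :
    ∃ (J : Type w) (e : HilbertBasis J ℂ H) (f : J → H) (μ : J → ℝ) (B A : H →L[ℂ] EllTwo J),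
      IsBesselFamily f ∧ (∀ j, D (e j) = (μ j : ℂ) • f j) ∧ ‖B‖ ≤ 1 ∧ ‖A‖ ≤ 1 ∧
      (∀ j, B (e j) = EllTwo.unit j) ∧ ∀ j, A (D (e j)) = (μ j : ℂ) • EllTwo.unit j := by
  obtain ⟨J, e, f, μ, hf, hDe, hDf, -⟩ := exists_svd D hD
  obtain ⟨B, hB, hBe⟩ := e.orthonormal.isBesselFamily.exists_analysis
  obtain ⟨A, hA, hAf⟩ := hf.exists_analysis
  have hB' : ∀ j, B (e j) = EllTwo.unit j := fun j => by
    ext i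
    rw [hBe]
    rcases eq_or_ne i j with rfl | hij
    · rw [EllTwo.unit_apply_same, inner_self_eq_norm_sq_to_K, e.orthonormal.1 i]
      simp
    · rw [EllTwo.unit_apply_ne hij, e.orthonormal.2 hij]
  refine ⟨J, e, f, μ, B, A, hf, hDe, hB, hA, hB', fun j => ?_⟩
  ext i
  rw [hAf, ← ContinuousLinearMap.adjoint_inner_left, hDf, inner_smul_left, ← hBe, hB',
    Complex.conj_ofReal, lp.coeFn_smul, Pi.smul_apply, smul_eq_mul]
  rcases eq_or_ne i j with rfl | hij
  · rfl
  · rw [EllTwo.unit_apply_ne hij, mul_zero, mul_zero]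

theorem HilbertBasis.ext_continuousLinearMap {J : Type*} (e : HilbertBasis J ℂ H) {L : Type*}
    [AddCommGroup L] [Module ℂ L] [TopologicalSpace L] [T2Space L] {S T : H →L[ℂ] L}
    (h : ∀ j, S (e j) = T (e j)) : S = T := by
  ext x
  have h1 := (e.hasSum_repr x).mapL S
  have h2 := (e.hasSum_repr x).mapL T
  simp only [map_smul, h] at h1 h2
  exact h1.unique h2

theorem HilbertBasis.ext_inner {J : Type*} (e : HilbertBasis J ℂ H) {x y : H}
    (h : ∀ j, inner ℂ (e j) x = inner ℂ (e j) y) : x = y :=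
  e.repr.injective (by
    ext j
    rw [e.repr_apply_apply, e.repr_apply_apply, h])

end Analysis

/-! ### The condition (S) and operators for nuclear spectra -/

section NuclearPairs

variable {E : Type u} [AddCommGroup E] [Module ℂ E] {Z : Type v} [AddCommGroup Z] [Module ℂ Z]
  {𝓔 : BanachSpectrum E} {𝒵 : BanachSpectrum Z}

/-- (S) is applied to b = T z / ‖z‖_m, which has norm at most 1. -/
theorem exists_split_apply {n m k N M K : ℕ} {hnm : n ≤ m} {hnk : n ≤ k} {C ε : ℝ}
    (hC : 0 ≤ C) (hε : 0 ≤ ε)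
    (h : ∀ (z : 𝒵.step n) (b : 𝓔.step M), ∃ (u : 𝓔.step K) (v : 𝓔.step N),
      ‖𝒵.incl hnm z‖ • 𝓔.toLim M b = 𝓔.toLim K u + 𝓔.toLim N v ∧
      ‖u‖ ≤ C * ‖𝒵.incl hnk z‖ * ‖b‖ ∧ ‖v‖ ≤ ε * ‖z‖ * ‖b‖)
    (T : 𝒵.step m →L[ℂ] 𝓔.step M) (hT : ‖T‖ ≤ 1) (z : 𝒵.step n) :
    ∃ (u : 𝓔.step K) (v : 𝓔.step N),
      𝓔.toLim M (T (𝒵.incl hnm z)) = 𝓔.toLim K u + 𝓔.toLim N v ∧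
      ‖u‖ ≤ C * ‖𝒵.incl hnk z‖ ∧ ‖v‖ ≤ ε * ‖z‖ := by
  rcases eq_or_ne (𝒵.incl hnm z) 0 with h0 | h0
  · exact ⟨0, 0, by simp [h0], by rw [norm_zero]; positivity, by rw [norm_zero]; positivity⟩
  have h1 : 0 < ‖𝒵.incl hnm z‖ := norm_pos_iff.2 h0
  obtain ⟨u, v, huv, hu, hv⟩ := h z (‖𝒵.incl hnm z‖⁻¹ • T (𝒵.incl hnm z))
  have hb : ‖‖𝒵.incl hnm z‖⁻¹ • T (𝒵.incl hnm z)‖ ≤ 1 := by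
    rw [norm_smul, norm_inv, norm_norm, inv_mul_le_iff₀ h1, mul_one]
    exact (T.le_of_opNorm_le hT _).trans_eq (one_mul _)
  refine ⟨u, v, ?_, hu.trans (mul_le_of_le_one_right (by positivity) hb),
    hv.trans (mul_le_of_le_one_right (by positivity) hb)⟩
  rw [← huv, 𝓔.toLim_real_smul, smul_inv_smul₀ h1.ne']

theorem norm_inv_smul_le {G : Type*} [NormedAddCommGroup G] [NormedSpace ℂ G] {μ c : ℝ} {x : G}
    (hc : 0 ≤ c) (h : ‖x‖ ≤ ‖μ‖ * c) : ‖(μ : ℂ)⁻¹ • x‖ ≤ c := by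
  rcases eq_or_ne μ 0 with rfl | hμ
  · simpa using hc
  · rw [norm_smul, norm_inv, Complex.norm_real, inv_mul_le_iff₀ (norm_pos_iff.2 hμ)]
    exact h

/-- For μ = 0 the bound forces x = 0, so the convention 0⁻¹ = 0 does no harm. -/
theorem smul_inv_smul_of_le {G : Type*} [NormedAddCommGroup G] [NormedSpace ℂ G] {μ c : ℝ} {x : G}
    (h : ‖x‖ ≤ ‖μ‖ * c) : (μ : ℂ) • (μ : ℂ)⁻¹ • x = x := by
  rcases eq_or_ne μ 0 with rfl | hμ
  · have : x = 0 := norm_le_zero_iff.1 (by simpa using h)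
    simp [this]
  · exact smul_inv_smul₀ (Complex.ofReal_ne_zero.2 hμ) x

theorem BanachSpectrum.isCompactOperator_incl {𝒳 : BanachSpectrum Z}
    (h : ∀ n, IsNuclearMap (𝒳.incl (Nat.le_succ n))) {n m : ℕ} (hnm : n + 1 ≤ m) :
    IsCompactOperator (𝒳.incl (n.le_succ.trans hnm)) := by
  have e : (𝒳.incl (n.le_succ.trans hnm) : 𝒳.step n → 𝒳.step m) =
      𝒳.incl hnm ∘ 𝒳.incl n.le_succ := funext fun x => (𝒳.incl_incl _ _ x).symm
  rw [e]
  exact (h n).isCompactOperator.clm_comp _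

/-- T is split on singular vectors e_j of an operator between Hilbert spaces through which
inclusions of 𝒵 factor. Nuclear maps are absolutely 2-summing, so the resulting vectors u_j / μ_j
and v_j are square summable and are the columns of bounded operators on ℓ². -/
theorem PairS.pairOp_of_isNuclearMap_right [TopologicalSpace E] [IsTopologicalAddGroup E]
    [ContinuousSMul ℂ E] [T2Space E] (h𝓔 : 𝓔.Covers)
    (h𝒵 : ∀ n, IsNuclearMap (𝒵.incl (Nat.le_succ n))) (h : PairS 𝓔 𝒵) : PairOp 𝓔 𝒵 := by
  intro n
  -- Of the two additional steps at n, and likewise at k, one serves to factor through ℓ² and the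
  -- other to make the columns square summable.
  obtain ⟨m, hnm, h⟩ := h (n + 2)
  refine ⟨m, by omega, fun k hmk => ?_⟩
  obtain ⟨N, h⟩ := h (k + 2) (by omega)
  obtain ⟨hn, rn, hrn⟩ := (h𝒵 n).exists_hilbert_factor
  obtain ⟨hk, rk, hrk⟩ := (h𝒵 k).exists_hilbert_factor
  obtain ⟨S₁, hS₁, hSn⟩ := (h𝒵 (n + 1)).exists_sum_sq_le rn
  obtain ⟨S₂, hS₂, hSk⟩ := (h𝒵 (k + 1)).exists_sum_sq_le rk
  have hn1k : n + 1 + 1 ≤ k := hnm.trans hmk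
  -- D is the inclusion of step n + 1 in step k, seen between the two Hilbert spaces. Its singular
  -- vectors serve both ends at once.
  let D : EllTwo ℕ →L[ℂ] EllTwo ℕ := hk.comp ((𝒵.incl ((n + 1).le_succ.trans hn1k)).comp rn)
  have hDapp : ∀ x, D x = hk (𝒵.incl ((n + 1).le_succ.trans hn1k) (rn x)) := fun _ => rfl
  have hDc : IsCompactOperator D :=
    ((BanachSpectrum.isCompactOperator_incl h𝒵 hn1k).comp_clm rn).clm_comp hk
  obtain ⟨J, e, f, μ, B, A, hf, hDe, hB, hA, hBe, hAD⟩ := exists_svd_analysis D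
    (hDc.clm_comp (ContinuousLinearMap.adjoint D))
  refine ⟨N, fun M hM ε hε => ?_⟩
  obtain ⟨K, -, C, hC, h⟩ := h M hM (ε / ((S₁ + 1) * (‖hn‖ + 1))) (by positivity)
  set ε' := ε / ((S₁ + 1) * (‖hn‖ + 1)) with hε'
  have hε'0 : 0 < ε' := by positivity
  refine ⟨K, C * S₂ * ‖hk‖ + 1, by positivity, fun T hT => ?_⟩
  choose u v huv hu hv using fun j => exists_split_apply hC.le hε'0.le h T hT
    (𝒵.incl (n + 1).le_succ (rn (e j)))
  -- As D e_j = μ_j f_j, the norm in step k + 2 carries the factor μ_j, so division by μ_j is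
  -- allowed.
  have hu' : ∀ j, ‖u j‖ ≤ ‖μ j‖ * (C * ‖𝒵.incl (k + 1).le_succ (rk (f j))‖) := fun j => by
    refine (hu j).trans_eq ?_
    have e1 : 𝒵.incl (hnm.trans (by omega : m ≤ k + 2)) (𝒵.incl (n + 1).le_succ (rn (e j))) =
        𝒵.incl (k + 1).le_succ (rk (D (e j))) := 𝒵.incl_eq (by
      have e2 : rk (D (e j)) = 𝒵.incl k.le_succ (𝒵.incl ((n + 1).le_succ.trans hn1k) (rn (e j))) :=
        DFunLike.congr_fun hrk _
      rw [e2]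
      simp only [𝒵.toLim_incl])
    rw [e1, hDe, map_smul, map_smul, norm_smul, Complex.norm_real]
    ring
  obtain ⟨Ru, hRu, hRuj⟩ := exists_columns (fun j => (μ j : ℂ)⁻¹ • u j) (S := C * S₂)
    (by positivity) fun s => sum_norm_sq_mul_le (fun _ _ => norm_nonneg _)
      (fun j _ => norm_inv_smul_le (by positivity) (hu' j)) (hSk J f hf s)
  obtain ⟨Rv, hRv, hRvj⟩ := exists_columns v (S := ε' * S₁)
    (by positivity) fun s => sum_norm_sq_mul_le (fun _ _ => norm_nonneg _)
      (fun j _ => hv j) (hSn J e e.orthonormal.isBesselFamily s)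
  have hAB : ∀ {n : ℕ} {R : EllTwo J →L[ℂ] 𝓔.step n} {A : EllTwo ℕ →L[ℂ] EllTwo J} {c : ℝ},
      ‖A‖ ≤ 1 → ‖R‖ ≤ c → ‖R.comp A‖ ≤ c := fun {n R A c} hA hR =>
    (R.opNorm_comp_le A).trans ((mul_le_of_le_one_right (norm_nonneg _) hA).trans hR)
  refine ⟨(Ru.comp A).comp hk, (Rv.comp B).comp hn, ?_, ?_, fun z => ?_⟩
  · refine ((Ru.comp A).opNorm_comp_le hk).trans ?_
    have := mul_le_mul_of_nonneg_right (hAB hA hRu) (norm_nonneg hk)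
    linarith
  · refine ((Rv.comp B).opNorm_comp_le hn).trans ?_
    calc ‖Rv.comp B‖ * ‖hn‖ ≤ ε' * S₁ * ‖hn‖ :=
          mul_le_mul_of_nonneg_right (hAB hB hRv) (norm_nonneg hn)
      _ ≤ ε' * (S₁ + 1) * (‖hn‖ + 1) := by gcongr <;> linarith
      _ = ε := by rw [hε']; field_simp
  · have hLR : (h𝓔.toLimL M).comp (T.comp ((𝒵.incl hnm).comp ((𝒵.incl (n + 1).le_succ).comp rn))) =
        (h𝓔.toLimL K).comp ((Ru.comp A).comp D) + (h𝓔.toLimL N).comp (Rv.comp B) := by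
      refine e.ext_continuousLinearMap fun j => ?_
      simp only [ContinuousLinearMap.comp_apply, add_apply, BanachSpectrum.Covers.toLimL_apply,
        huv, hAD, hBe, map_smul, hRuj, hRvj]
      rw [← (𝓔.toLim K).map_smul (μ j : ℂ)⁻¹, ← (𝓔.toLim K).map_smul (μ j : ℂ), smul_inv_smul_of_le (hu' j)]
    have h1 := DFunLike.congr_fun hLR (hn z)
    have e3 : rn (hn z) = 𝒵.incl n.le_succ z := DFunLike.congr_fun hrn z
    simp only [ContinuousLinearMap.comp_apply, add_apply, BanachSpectrum.Covers.toLimL_apply,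
      hDapp, e3, 𝒵.incl_incl] at h1
    exact h1

/-- Dual to the previous case: T is tested against functionals y_j given by singular vectors of D*.
(S) dominates y_j ∘ T by a sum of two norms, Hahn–Banach splits it, and the pieces are the square
summable rows of operators into ℓ². -/
theorem PairS.pairOp_of_isNuclearMap_left
    (h𝓔 : ∀ n, IsNuclearMap (𝓔.incl (Nat.le_succ n))) (h : PairS 𝓔 𝒵) : PairOp 𝓔 𝒵 := by
  intro n
  obtain ⟨m, hnm, h⟩ := h n
  refine ⟨m, hnm, fun k hmk => ?_⟩
  obtain ⟨N, h⟩ := h k hmk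
  obtain ⟨h₁, r₁, hr₁⟩ := (h𝓔 (N + 1)).exists_hilbert_factor
  obtain ⟨S₁, hS₁, hSN⟩ := (h𝓔 N).exists_sum_sq_inner_le h₁
  -- The operator V ends two steps beyond N, and U two steps beyond K: one step for square
  -- summability, one for the return from ℓ².
  refine ⟨N + 2, fun M hM ε hε => ?_⟩
  obtain ⟨K, hK, C, hC, h⟩ := h M (by omega) (ε / ((S₁ + 1) * (‖r₁‖ + 1))) (by positivity)
  set ε' := ε / ((S₁ + 1) * (‖r₁‖ + 1)) with hε'
  have hε'0 : 0 < ε' := by positivity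
  obtain ⟨h₂, r₂, hr₂⟩ := (h𝓔 (K + 1)).exists_hilbert_factor
  obtain ⟨S₂, hS₂, hSK⟩ := (h𝓔 K).exists_sum_sq_inner_le h₂
  have hNK : N + 2 + 1 ≤ K + 1 := by omega
  let D : EllTwo ℕ →L[ℂ] EllTwo ℕ := h₂.comp ((𝓔.incl ((N + 2).le_succ.trans hNK)).comp r₁)
  have hDc : IsCompactOperator D :=
    ((BanachSpectrum.isCompactOperator_incl h𝓔 hNK).comp_clm r₁).clm_comp h₂
  have hDc' : IsCompactOperator (ContinuousLinearMap.adjoint (ContinuousLinearMap.adjoint D) ∘L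
      ContinuousLinearMap.adjoint D) := by
    rw [ContinuousLinearMap.adjoint_adjoint]
    exact hDc.comp_clm _
  obtain ⟨J, g, f, μ, B, A, hf, hDg, hB, hA, hBg, hAD⟩ := exists_svd_analysis _ hDc'
  refine ⟨K + 2, ‖r₂‖ * (C * S₂) + 1, by positivity, fun T hT => ?_⟩
  let y : J → 𝓔.step K →L[ℂ] ℂ := fun j => (innerSL ℂ (g j)).comp (h₂.comp (𝓔.incl K.le_succ))
  let y' : J → 𝓔.step N →L[ℂ] ℂ := fun j => (innerSL ℂ (f j)).comp (h₁.comp (𝓔.incl N.le_succ))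
  -- On E_N the functional y_j is μ_j y'_j, by D* g_j = μ_j f_j; this gives the error part the
  -- factor μ_j.
  have hyy' : ∀ j (hNK' : N ≤ K) b, y j (𝓔.incl hNK' b) = (μ j : ℂ) * y' j b := fun j hNK' b => by
    have e1 : h₂ (𝓔.incl K.le_succ (𝓔.incl hNK' b)) = D (h₁ (𝓔.incl N.le_succ b)) := by
      have e2 : r₁ (h₁ (𝓔.incl N.le_succ b)) = 𝓔.incl (N + 1).le_succ (𝓔.incl N.le_succ b) :=
        DFunLike.congr_fun hr₁ _
      change _ = h₂ (𝓔.incl _ (r₁ (h₁ (𝓔.incl N.le_succ b))))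
      rw [e2]
      simp only [𝓔.incl_incl]
    change inner ℂ (g j) (h₂ (𝓔.incl K.le_succ (𝓔.incl hNK' b))) =
      (μ j : ℂ) * inner ℂ (f j) (h₁ (𝓔.incl N.le_succ b))
    rw [e1, ← ContinuousLinearMap.adjoint_inner_left, hDg, inner_smul_left, Complex.conj_ofReal]
  have hsplit : ∀ j, ∃ (u : 𝒵.step k →L[ℂ] ℂ) (v : 𝒵.step n →L[ℂ] ℂ), ‖u‖ ≤ C * ‖y j‖ ∧
      ‖v‖ ≤ ‖μ j‖ * (ε' * ‖y' j‖) ∧ ∀ z, y j (𝓔.incl hK (T (𝒵.incl hnm z))) =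
        u (𝒵.incl (hnm.trans hmk) z) + v z := fun j => by
    refine exists_functional_split
      ((y j).comp ((𝓔.incl hK).comp (T.comp (𝒵.incl hnm)))).toLinearMap
      (𝒵.incl (hnm.trans hmk)).toLinearMap LinearMap.id (by positivity) (by positivity) fun z => ?_
    obtain ⟨u, v, huv, hu, hv⟩ := exists_split_apply hC.le hε'0.le h T hT z
    have e1 : 𝓔.incl hK (T (𝒵.incl hnm z)) = u + 𝓔.incl (by omega : N ≤ K) v := 𝓔.incl_eq (by
      rw [𝓔.toLim_incl, huv, map_add, 𝓔.toLim_incl])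
    change ‖y j (𝓔.incl hK (T (𝒵.incl hnm z)))‖ ≤ C * ‖y j‖ * ‖𝒵.incl (hnm.trans hmk) z‖ +
      ‖μ j‖ * (ε' * ‖y' j‖) * ‖z‖
    rw [e1, map_add, hyy']
    refine (norm_add_le _ _).trans (add_le_add ?_ ?_)
    · calc ‖y j u‖ ≤ ‖y j‖ * ‖u‖ := (y j).le_opNorm u
        _ ≤ ‖y j‖ * (C * ‖𝒵.incl (hnm.trans hmk) z‖) := by gcongr
        _ = _ := by ring
    · rw [norm_mul, Complex.norm_real]
      calc ‖μ j‖ * ‖y' j v‖ ≤ ‖μ j‖ * (‖y' j‖ * (ε' * ‖z‖)) := by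
            gcongr
            exact ((y' j).le_opNorm v).trans (by gcongr)
        _ = _ := by ring
  choose u v hu hv huv using hsplit
  obtain ⟨Ru, hRu, hRuj⟩ := exists_rows u (S := C * S₂) (by positivity) fun s =>
    sum_norm_sq_mul_le (fun _ _ => norm_nonneg _) (fun j _ => hu j)
      (hSK J g g.orthonormal.isBesselFamily s)
  obtain ⟨Rv, hRv, hRvj⟩ := exists_rows (fun j => (μ j : ℂ)⁻¹ • v j) (S := ε' * S₁)
    (by positivity) fun s => sum_norm_sq_mul_le (fun _ _ => norm_nonneg _)
      (fun j _ => norm_inv_smul_le (by positivity) (hv j)) (hSN J f hf s)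
  have hAB : ∀ {F G : Type _} [NormedAddCommGroup F] [NormedSpace ℂ F] [NormedAddCommGroup G]
      [NormedSpace ℂ G] {R : F →L[ℂ] EllTwo J} {A : EllTwo ℕ →L[ℂ] EllTwo J}
      {r : EllTwo ℕ →L[ℂ] G} {c : ℝ}, ‖A‖ ≤ 1 → ‖R‖ ≤ c →
      ‖r.comp ((ContinuousLinearMap.adjoint A).comp R)‖ ≤ ‖r‖ * c :=
    fun {F G _ _ _ _ R A r c} hA hR => by
      refine (r.opNorm_comp_le _).trans (mul_le_mul_of_nonneg_left ?_ (norm_nonneg r))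
      refine ((ContinuousLinearMap.adjoint A).opNorm_comp_le R).trans ?_
      rw [LinearIsometryEquiv.norm_map]
      exact (mul_le_of_le_one_left (norm_nonneg _) hA).trans hR
  refine ⟨r₂.comp ((ContinuousLinearMap.adjoint B).comp Ru),
    r₁.comp ((ContinuousLinearMap.adjoint A).comp Rv), ?_, ?_, fun z => ?_⟩
  · exact (hAB hB hRu).trans (by linarith)
  · calc _ ≤ ‖r₁‖ * (ε' * S₁) := hAB hA hRv
      _ ≤ (‖r₁‖ + 1) * (ε' * (S₁ + 1)) := by gcongr <;> linarith
      _ = ε := by rw [hε']; field_simp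
  · have key : h₂ (𝓔.incl (hK.trans K.le_succ) (T (𝒵.incl hnm z))) =
        ContinuousLinearMap.adjoint B (Ru (𝒵.incl (hnm.trans hmk) z)) +
          D (ContinuousLinearMap.adjoint A (Rv z)) := by
      refine g.ext_inner fun j => ?_
      rw [inner_add_right, ContinuousLinearMap.adjoint_inner_right, hBg, EllTwo.inner_unit, hRuj,
        ← ContinuousLinearMap.adjoint_inner_left, ContinuousLinearMap.adjoint_inner_right, hAD,
        inner_smul_left, EllTwo.inner_unit, hRvj, Complex.conj_ofReal]
      have e1 := smul_inv_smul_of_le (hv j)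
      have e2 : (μ j : ℂ) * ((μ j : ℂ)⁻¹ • v j) z = v j z := DFunLike.congr_fun e1 z
      rw [e2, ← huv j z]
      change _ = inner ℂ (g j) (h₂ (𝓔.incl K.le_succ (𝓔.incl hK (T (𝒵.incl hnm z)))))
      rw [𝓔.incl_incl]
    have hr₂' : ∀ b, r₂ (h₂ b) = 𝓔.incl (K + 1).le_succ b := fun b => DFunLike.congr_fun hr₂ b
    have h3 := congrArg (fun x => 𝓔.toLim (K + 2) (r₂ x)) key
    simp only [map_add, hr₂'] at h3
    rw [show r₂ (D (ContinuousLinearMap.adjoint A (Rv z))) = 𝓔.incl (K + 1).le_succ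
      (𝓔.incl ((N + 2).le_succ.trans hNK) (r₁ (ContinuousLinearMap.adjoint A (Rv z)))) from
        hr₂' _, 𝓔.toLim_incl, 𝓔.toLim_incl, 𝓔.toLim_incl, 𝓔.toLim_incl] at h3
    exact h3

end NuclearPairs

/-! ### Nuclear spectra and exact sequences -/

section NuclearSequences

variable {E : Type u} [AddCommGroup E] [Module ℂ E] [TopologicalSpace E] [IsTopologicalAddGroup E]
  [ContinuousSMul ℂ E] [LocallyConvexSpace ℝ E] [T2Space E]
  {Z : Type v} [AddCommGroup Z] [Module ℂ Z] [TopologicalSpace Z] [IsTopologicalAddGroup Z]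
  [ContinuousSMul ℂ Z] [LocallyConvexSpace ℝ Z] [T2Space Z]

/-- The vectors y_j of a nuclear representation are lifted with bounds, and the functionals a_j are
kept. -/
theorem exists_lift_of_isNuclearMap {𝒵 : BanachSpectrum Z} (h𝒵 : 𝒵.Covers)
    (hnuc : ∀ n, IsNuclearMap (𝒵.incl (Nat.le_succ n))) (Y : Type w) [AddCommGroup Y] [Module ℂ Y]
    [TopologicalSpace Y] (Q : Y →L[ℂ] Z) (𝒴 : BanachSpectrum Y) (h𝒴 : 𝒴.Covers)
    (hQ : Function.Surjective Q) (n : ℕ) : ∃ p, ∃ σ : 𝒵.step n →L[ℂ] 𝒴.step p,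
      ∀ z, Q (𝒴.toLim p (σ z)) = 𝒵.toLim n z := by
  obtain ⟨a, y, hs, hsum⟩ := hnuc n
  obtain ⟨p, C, hC, hp⟩ := h𝒴.exists_lift_bound Q hQ (h𝒵.toLimL (n + 1))
  choose x hx hxn using fun j => hp (y j)
  obtain ⟨σ, -, hσ⟩ := exists_sum_rank_one a x (Summable.of_nonneg_of_le
    (fun j => by positivity) (fun j => (mul_le_mul_of_nonneg_left (hxn j) (norm_nonneg _)).trans_eq
      (mul_left_comm _ _ _)) (hs.mul_left C))
  refine ⟨p, σ, fun z => ?_⟩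
  have h1 := (hσ z).mapL (Q.comp (h𝒴.toLimL p))
  have h2 := (hsum z).mapL (h𝒵.toLimL (n + 1))
  have h3 : ∀ j, (Q.comp (h𝒴.toLimL p)) (a j z • x j) = h𝒵.toLimL (n + 1) (a j z • y j) :=
    fun j => by
      rw [map_smul, map_smul]
      exact congrArg _ (hx j)
  simp only [h3] at h1
  exact (h1.unique h2).trans (𝒵.toLim_incl _ z)

/-- The functionals a_j ∘ T are extended by Hahn–Banach with equal norms, and the vectors y_j are
kept; the extension takes values one step later. -/
theorem exists_extension_of_isNuclearMap {𝓔 : BanachSpectrum E} (h𝓔 : 𝓔.Covers)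
    (hnuc : ∀ n, IsNuclearMap (𝓔.incl (Nat.le_succ n))) (F : Type w) [NormedAddCommGroup F]
    [NormedSpace ℂ F] (W : Submodule ℂ F) (N : ℕ) (T : W →L[ℂ] 𝓔.step N) :
    ∃ S : F →L[ℂ] E, ∀ x : W, S x = 𝓔.toLim N (T x) := by
  obtain ⟨a, y, hs, hsum⟩ := hnuc N
  choose b hb hbn using fun j => exists_extension_norm_eq W ((a j).comp T)
  obtain ⟨S, -, hS⟩ := exists_sum_rank_one b y (Summable.of_nonneg_of_le
    (fun j => by positivity) (fun j => (mul_le_mul_of_nonneg_right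
      ((hbn j).trans_le ((a j).opNorm_comp_le T)) (norm_nonneg _)).trans_eq
        ((mul_right_comm _ _ _).trans (mul_comm _ _))) (hs.mul_left ‖T‖))
  refine ⟨(h𝓔.toLimL (N + 1)).comp S, fun x => ?_⟩
  have h1 := hS x
  simp only [hb] at h1
  have h2 : S x = 𝓔.incl N.le_succ (T x) := h1.unique (hsum (T x))
  exact (congrArg (𝓔.toLim (N + 1)) h2).trans (𝓔.toLim_incl _ _)

end NuclearSequences

/-! ### Transport of the conditions -/

section Transport

variable {E E' : Type u} [AddCommGroup E] [Module ℂ E] [TopologicalSpace E]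
  [AddCommGroup E'] [Module ℂ E'] [TopologicalSpace E'] (e : E ≃L[ℂ] E')
  {Z : Type v} [AddCommGroup Z] [Module ℂ Z] {𝓔 : BanachSpectrum E'} {𝒵 : BanachSpectrum Z}

theorem BanachSpectrum.transport_toLim (n : ℕ) (x : 𝓔.step n) :
    e ((𝓔.transport e).toLim n x) = 𝓔.toLim n x := e.apply_symm_apply _

theorem smul_eq_add_of_transport {r : ℝ} {n m k : ℕ} {a : 𝓔.step n} {b : 𝓔.step m}
    {c : 𝓔.step k} (h : r • (𝓔.transport e).toLim n a =
      (𝓔.transport e).toLim m b + (𝓔.transport e).toLim k c) :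
    r • 𝓔.toLim n a = 𝓔.toLim m b + 𝓔.toLim k c := by
  have h1 := congrArg e h
  rwa [map_add, ← Complex.coe_smul, map_smul, 𝓔.transport_toLim, 𝓔.transport_toLim,
    𝓔.transport_toLim, Complex.coe_smul] at h1

theorem PairS.of_transport (h : PairS (𝓔.transport e) 𝒵) : PairS 𝓔 𝒵 := by
  intro n
  obtain ⟨m, hnm, h⟩ := h n
  refine ⟨m, hnm, fun k hmk => ?_⟩
  obtain ⟨N, h⟩ := h k hmk
  refine ⟨N, fun M hM ε hε => ?_⟩
  obtain ⟨K, hK, C, hC, h⟩ := h M hM ε hε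
  refine ⟨K, hK, C, hC, fun z b => ?_⟩
  obtain ⟨u, v, huv, huv'⟩ := h z b
  exact ⟨u, v, smul_eq_add_of_transport e huv, huv'⟩

theorem WeakPairS.of_transport (h : WeakPairS (𝓔.transport e) 𝒵) : WeakPairS 𝓔 𝒵 := by
  intro n
  obtain ⟨m, hnm, h⟩ := h n
  refine ⟨m, hnm, fun k hmk => ?_⟩
  obtain ⟨N, h⟩ := h k hmk
  refine ⟨N, fun M hM => ?_⟩
  obtain ⟨K, hK, C, hC, h⟩ := h M hM
  refine ⟨K, hK, C, hC, fun z b => ?_⟩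
  obtain ⟨u, v, huv, huv'⟩ := h z b
  exact ⟨u, v, smul_eq_add_of_transport e huv, huv'⟩

theorem PairOp.transport (h : PairOp 𝓔 𝒵) : PairOp (𝓔.transport e) 𝒵 := by
  intro n
  obtain ⟨m, hnm, h⟩ := h n
  refine ⟨m, hnm, fun k hmk => ?_⟩
  obtain ⟨N, h⟩ := h k hmk
  refine ⟨N, fun M hM ε hε => ?_⟩
  obtain ⟨K, C, hC, h⟩ := h M hM ε hε
  refine ⟨K, C, hC, fun T hT => ?_⟩
  obtain ⟨U, V, hU, hV, h⟩ := h T hT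
  refine ⟨U, V, hU, hV, fun z => ?_⟩
  exact (congrArg e.symm (h z)).trans (map_add e.symm _ _)

end Transport

theorem BanachSpectrum.Covers.projOneZero_of_transport {E : Type u} [AddCommGroup E] [Module ℂ E]
    [TopologicalSpace E] [IsTopologicalAddGroup E] [ContinuousSMul ℂ E] [T2Space E]
    {𝓔 : BanachSpectrum E} (h𝓔 : 𝓔.Covers) {Z Z' : Type v} [AddCommGroup Z] [Module ℂ Z]
    [TopologicalSpace Z] [AddCommGroup Z'] [Module ℂ Z'] [TopologicalSpace Z'] (e : Z ≃L[ℂ] Z')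
    {𝒵 : BanachSpectrum Z'} {φ : ℕ → ℕ} {hφ : StrictMono φ}
    (h : (h𝓔.opSpectrum (𝒵.transport e)).ProjOneZero φ hφ) :
    (h𝓔.opSpectrum 𝒵).ProjOneZero φ hφ := by
  intro f hf
  obtain ⟨s, hs, hfs⟩ := h f fun i => h𝓔.opSpectrum_bdd_iff.2
    (h𝓔.opSpectrum_bdd_iff (𝒵 := 𝒵).1 (hf i))
  exact ⟨s, fun i => h𝓔.opSpectrum_bdd_iff.2
    (h𝓔.opSpectrum_bdd_iff (𝒵 := 𝒵.transport e).1 (hs i)), hfs⟩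

/-! ### The characterization of weak acyclicity -/

section Main

variable {E : Type u} [AddCommGroup E] [Module ℂ E] [TopologicalSpace E] [IsTopologicalAddGroup E]
  [ContinuousSMul ℂ E] [LocallyConvexSpace ℝ E] [T2Space E]
  {Z : Type v} [AddCommGroup Z] [Module ℂ Z] [TopologicalSpace Z] [IsTopologicalAddGroup Z]
  [ContinuousSMul ℂ Z] [LocallyConvexSpace ℝ Z] [T2Space Z]

/-- Common frame of the four cases: 𝒵' and 𝓔 are spectra adapted to the respective hypothesis, and
independence of (S) from the spectrum leads back to 𝒵 and B. -/
theorem isWeaklyAcyclic_iff_of_spectra {B : ℕ → Set E} (hB : IsFundamentalBoundedSeq B)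
    {𝒵 𝒵' : BanachSpectrum Z} (h𝒵 : 𝒵.Covers) (h𝒵' : 𝒵'.Covers) {𝓔 : BanachSpectrum E}
    (h𝓔 : 𝓔.Regular) (hloc : IsLocallyAcyclic.{u, v, max v w} E Z)
    (hop : PairS 𝓔 𝒵' → PairOp 𝓔 𝒵')
    (hnec : (∀ φ hφ, (h𝓔.toCovers.opSpectrum 𝒵').ProjOneZero φ hφ) → PairS 𝓔 𝒵') :
    IsWeaklyAcyclic.{u, v, max v w} E Z ↔ ConditionS B 𝒵 := by
  constructor
  · intro h
    have h1 : PairS 𝓔 𝒵' := hnec fun φ hφ =>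
      IsWeaklyAcyclic.projOneZero.{u, v, w} h h𝒵' h𝓔.toCovers φ hφ
    exact conditionS_of_pairS h𝓔 hB (h1.congr h𝒵' h𝒵)
  · intro h
    have h1 : PairS 𝓔 𝒵' := (pairS_of_conditionS h𝓔 hB h).congr h𝒵 h𝒵'
    exact hloc.isWeaklyAcyclic h𝓔.toCovers h𝒵' (hop h1)

theorem PairS.of_subsingleton [Subsingleton E] (𝓔 : BanachSpectrum E) (𝒵 : BanachSpectrum Z) :
    PairS 𝓔 𝒵 := fun n => ⟨n, le_rfl, fun _ _ => ⟨0, fun M _ ε hε => ⟨M, le_rfl, 1, one_pos,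
      fun z b => ⟨0, 0, Subsingleton.elim _ _, by rw [norm_zero]; positivity,
        by rw [norm_zero]; positivity⟩⟩⟩⟩

end Main

theorem mainTheorem1
    {E : Type u} [AddCommGroup E] [Module ℂ E] [TopologicalSpace E] [IsTopologicalAddGroup E]
    [ContinuousSMul ℂ E] [LocallyConvexSpace ℝ E] [T2Space E]
    {Z : Type v} [AddCommGroup Z] [Module ℂ Z] [TopologicalSpace Z] [T2Space Z]
    (hE : IsLocallyComplete E)
    (B : ℕ → Set E) (hB : IsFundamentalBoundedSeq B)
    (𝒵 : BanachSpectrum Z) (h𝒵 : 𝒵.IsLimit)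
    (h :
      ((∃ (I : Type u) (A : CoechelonMatrix I), Nonempty (E ≃L[ℂ] KSpace ∞ A)) ∧
        ¬ IsNormable E) ∨
      (IsLNSpace E ∧ ¬ FiniteDimensional ℂ E) ∨
      (∃ (I : Type v) (A : CoechelonMatrix I), Nonempty (Z ≃L[ℂ] KSpace 1 A)) ∨
      IsLNSpace Z) :
    IsWeaklyAcyclic.{u, v, max v w} E Z ↔ ConditionS B 𝒵 := by
  have := h𝒵.isTopologicalAddGroup
  have := h𝒵.continuousSMul
  have := h𝒵.locallyConvexSpace
  obtain ⟨⟨I, A, ⟨e⟩⟩, hE'⟩ | ⟨⟨-, 𝓔, h𝓔, hnuc⟩, hdim⟩ | ⟨I, A, ⟨e⟩⟩ | ⟨-, 𝒵', h𝒵', hnuc⟩ := h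
  · have h𝓔 := (kSpectrum_isLimit ∞ A).covers.transport e
    refine isWeaklyAcyclic_iff_of_spectra.{u, v, w} hB h𝒵.covers h𝒵.covers (h𝓔.regular hE)
      (isLocallyAcyclic_of_extends h𝓔 fun F _ _ _ W N T => exists_extension_kInfty A e F W N T)
      (fun h => (h.of_transport e).pairOp_kInfty.transport e) fun h => ?_
    have h1 := weakPairS_of_projOneZero h𝓔 h
    exact h1.pairS (normInterpolation_of_weakPairS_kInfty A e hE' (h1.of_transport e))
  · have hcomp := fun n => (hnuc n).isCompactOperator
    refine isWeaklyAcyclic_iff_of_spectra.{u, v, w} hB h𝒵.covers h𝒵.covers (h𝓔.covers.regular hE)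
      (isLocallyAcyclic_of_extends h𝓔.covers fun F _ _ _ W N T =>
        exists_extension_of_isNuclearMap h𝓔.covers hnuc F W N T)
      (fun h => h.pairOp_of_isNuclearMap_left hnuc) fun h => ?_
    have h1 := weakPairS_of_projOneZero h𝓔.covers h
    exact h1.pairS (normInterpolation_of_weakPairS_of_isCompactOperator hcomp h𝓔.covers.exhausts
      hdim h1)
  · obtain ⟨𝓔, h𝓔⟩ := hE.exists_regular hB
    have h𝒵' := (kSpectrum_isLimit 1 A).covers.transport e
    refine isWeaklyAcyclic_iff_of_spectra.{u, v, w} hB h𝒵.covers h𝒵' h𝓔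
      (isLocallyAcyclic_of_lifts hE hB h𝒵' fun Y _ _ _ Q 𝒴 h𝒴 hQ n =>
        exists_lift_kOne A e Y Q 𝒴 h𝒴 hQ n)
      (fun h => PairS.pairOp_kOne A h𝓔.toCovers h) fun h => ?_
    -- The interpolation inequality needs a nonzero vector of E; for E = 0 condition (S) is trivial.
    rcases subsingleton_or_nontrivial E with hE' | hE'
    · exact PairS.of_subsingleton _ _
    · exact (weakPairS_of_projOneZero h𝓔.toCovers h).pairS
        (normInterpolation_kOne A h𝓔.toCovers fun φ hφ =>
          h𝓔.toCovers.projOneZero_of_transport e (h φ hφ))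
  · obtain ⟨𝓔, h𝓔⟩ := hE.exists_regular hB
    refine isWeaklyAcyclic_iff_of_spectra.{u, v, w} hB h𝒵.covers h𝒵'.covers h𝓔
      (isLocallyAcyclic_of_lifts hE hB h𝒵'.covers fun Y _ _ _ Q 𝒴 h𝒴 hQ n =>
        exists_lift_of_isNuclearMap h𝒵'.covers hnuc Y Q 𝒴 h𝒴 hQ n)
      (fun h => h.pairOp_of_isNuclearMap_right h𝓔.toCovers hnuc) fun h => ?_
    exact (weakPairS_of_projOneZero h𝓔.toCovers h).pairS
      (normInterpolation_of_isCompactOperator fun n => (hnuc n).isCompactOperator)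

end
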